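/- For a finite field $\mathbb{F}_q$ with $q$ elements ($q$ a prime power), let $\Lambda(n,q)$ be the space of alternating $n\times n$ matrices over $\mathbb{F}_q$, that is, of the matrices $A$ with $u^{\mathrm t}Au=0$ for all $u\in\mathbb{F}_q^n$. An alternating space is a linear subspace of $\Lambda(n,q)$. Two alternating spaces $\mathcal{G},\mathcal{H}\le\Lambda(n,q)$ are isometric if there is $A\in\mathrm{GL}(n,q)$ with $\{A^{\mathrm t}BA: B\in\mathcal{G}\}=\mathcal{H}$. Let $\mathrm{LinER}(n,m,q)$ be the uniform distribution on the $m$-dimensional subspaces of $\Lambda(n,q)$. Let $c>0$ be a constant. There are a deterministic algorithm and constants $C\in\mathbb{N}$, $\delta>0$ and $n_0\in\mathbb{N}$, all depending only on $c$, such that for all integers $n\ge n_0$ and $m$ with $m=cn$ and for every prime power $q$, the following holds for all but at most a $1/q^{\delta n}$ fraction of the alternating spaces $\mathcal{G}$ in $\mathrm{LinER}(n,m,q)$: for every alternating space $\mathcal{H}\le\Lambda(n,q)$, given any linear bases of $\mathcal{G}$ and of $\mathcal{H}$, the algorithm decides correctly, in at most $q^{Cn}$ steps, whether $\mathcal{G}$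 and $\mathcal{H}$ are isometric. Here an algorithm is a program for a random access machine with registers and arrays of natural numbers, in which each elementary operation (addition, truncated subtraction, reading or writing a register or an array cell, testing for zero) takes one step. The input consists of $q$, $n$, the dimensions of the two spaces, the addition and multiplication tables of $\mathbb{F}_q$ with respect to an arbitrary labelling of its elements by $0,\dots,q-1$, and the entries of the basis matrices. -/

import Mathlib

/-! ## A machine model with a step count

A deterministic random access machine with structured control. It has registers and arrays, named
by numerals that are fixed in the program text; registers and array cells hold natural numbers. The
only arithmetic is addition and truncated subtraction, so that counting each operation as one step
agrees, up to a polynomial, with Turing machine time. -/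

namespace RAM

/-- Expressions: numerals, registers, array cells (the index may be computed), sums and truncated
differences. -/
inductive Expr where
  | lit (k : ℕ)
  | reg (x : ℕ)
  | cell (a : ℕ) (i : Expr)
  | plus (e f : Expr)
  | minus (e f : Expr)

/-- Programs. -/
inductive Prog where
  | skip
  /-- `x := e` for a register `x` -/
  | assign (x : ℕ) (e : Expr)
  /-- `a[i] := e` for an array `a` -/
  | store (a : ℕ) (i e : Expr)
  | seq (P Q : Prog)
  /-- run `P` if `e ≠ 0`, and `Q` otherwise -/
  | cond (e : Expr) (P Q : Prog)
  /-- repeat `P` as long as `e ≠ 0` -/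
  | loop (e : Expr) (P : Prog)

/-- The contents `reg x` of the registers and `arr a i` of the array cells. -/
structure State where
  reg : ℕ → ℕ
  arr : ℕ → ℕ → ℕ

/-- The value of an expression. -/
def Expr.eval (s : State) : Expr → ℕ
  | .lit k => k
  | .reg x => s.reg x
  | .cell a i => s.arr a (i.eval s)
  | .plus e f => e.eval s + f.eval s
  | .minus e f => e.eval s - f.eval s

/-- The number of steps taken to evaluate an expression: one for each node. -/
def Expr.cost : Expr → ℕ
  | .lit _ => 1
  | .reg _ => 1
  | .cell _ i => i.cost + 1
  | .plus e f => e.cost + f.cost + 1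
  | .minus e f => e.cost + f.cost + 1

/-- `x := v`. -/
def State.setReg (s : State) (x v : ℕ) : State :=
  { s with reg := Function.update s.reg x v }

/-- `a[i] := v`. -/
def State.setCell (s : State) (a i v : ℕ) : State :=
  { s with arr := Function.update s.arr a (Function.update (s.arr a) i v) }

/-- `Runs P s s' t`: started in the state `s`, the program `P` halts in the state `s'` after exactly
`t` steps. -/
inductive Runs : Prog → State → State → ℕ → Prop where
  | skip (s : State) : Runs .skip s s 1
  | assign (s : State) (x : ℕ) (e : Expr) :
      Runs (.assign x e) s (s.setReg x (e.eval s)) (e.cost + 1)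
  | store (s : State) (a : ℕ) (i e : Expr) :
      Runs (.store a i e) s (s.setCell a (i.eval s) (e.eval s)) (i.cost + e.cost + 1)
  | seq {P Q : Prog} {s s' s'' : State} {t t' : ℕ} :
      Runs P s s' t → Runs Q s' s'' t' → Runs (.seq P Q) s s'' (t + t')
  | condTrue {e : Expr} {P Q : Prog} {s s' : State} {t : ℕ} :
      e.eval s ≠ 0 → Runs P s s' t → Runs (.cond e P Q) s s' (e.cost + 1 + t)
  | condFalse {e : Expr} {P Q : Prog} {s s' : State} {t : ℕ} :
      e.eval s = 0 → Runs Q s s' t → Runs (.cond e P Q) s s' (e.cost + 1 + t)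
  | loopDone {e : Expr} {P : Prog} {s : State} :
      e.eval s = 0 → Runs (.loop e P) s s (e.cost + 1)
  | loopStep {e : Expr} {P : Prog} {s s' s'' : State} {t t' : ℕ} :
      e.eval s ≠ 0 → Runs P s s' t → Runs (.loop e P) s' s'' t' →
      Runs (.loop e P) s s'' (e.cost + 1 + t + t')

/-- The initial state: the input numbers stand in the registers `0, 1, 2, …` and the input lists in
the arrays `0, 1, 2, …`, each from index `0` on; everything else is `0`. -/
def State.init (numbers : List ℕ) (lists : List (List ℕ)) : State where
  reg x := numbers.getD x 0
  arr a i := (lists.getD a []).getD i 0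

end RAM

/-! ## Alternating matrix spaces -/

namespace AltSpace

open Matrix

/-- The space `Λ(n, q)` of alternating `n × n` matrices over `F`. -/
def alternating (n : ℕ) (F : Type) [Field F] : Submodule F (Matrix (Fin n) (Fin n) F) where
  carrier := {A | ∀ u : Fin n → F, u ⬝ᵥ (A *ᵥ u) = 0}
  add_mem' {A B} hA hB u := by rw [add_mulVec, dotProduct_add, hA u, hB u, add_zero]
  zero_mem' u := by rw [zero_mulVec, dotProduct_zero]
  smul_mem' a A hA u := by rw [smul_mulVec, dotProduct_smul, hA u, smul_zero]

/-- The `m`-dimensional subspaces of `Λ(n, q)`: the sample space of the uniform distribution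
`LinER(n, m, q)`. -/
def LinER (n m : ℕ) (F : Type) [Field F] : Set (Submodule F (Matrix (Fin n) (Fin n) F)) :=
  {𝒢 | 𝒢 ≤ alternating n F ∧ Module.finrank F 𝒢 = m}

/-- `𝒢` and `ℋ` are isometric: `Aᵀ 𝒢 A = ℋ` for some `A ∈ GL(n, q)`. -/
def Isometric {n : ℕ} {F : Type} [Field F]
    (𝒢 ℋ : Submodule F (Matrix (Fin n) (Fin n) F)) : Prop :=
  ∃ A : GL (Fin n) F,
    (fun B : Matrix (Fin n) (Fin n) F => (A : Matrix (Fin n) (Fin n) F)ᵀ * B * A) '' 𝒢 = ℋ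

/-- The tuple `G` of matrices is a linear basis of the space `𝒢`. -/
def IsLinearBasis {n m : ℕ} {F : Type} [Field F] (G : Fin m → Matrix (Fin n) (Fin n) F)
    (𝒢 : Submodule F (Matrix (Fin n) (Fin n) F)) : Prop :=
  LinearIndependent F G ∧ Submodule.span F (Set.range G) = 𝒢

section Encoding

variable {F : Type} {q : ℕ}

/-- The table of a binary operation on `F`, row by row, where the elements of `F` are written as
the numbers below `q` through the labelling `e`. -/
def opTable (e : F ≃ Fin q) (op : F → F → F) : List ℕ :=
  List.ofFn fun k : Fin (q * q) => (e (op (e.symm k.divNat) (e.symm k.modNat)) : ℕ)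

/-- The entries of a tuple of matrices: matrix by matrix, and row by row in each matrix. -/
def tupleEntries {n m : ℕ} (e : F ≃ Fin q) (G : Fin m → Matrix (Fin n) (Fin n) F) : List ℕ :=
  List.ofFn fun k : Fin (m * (n * n)) =>
    (e (G k.divNat k.modNat.divNat k.modNat.modNat) : ℕ)

/-- The machine's input for a pair of matrix tuples over a field `F` of order `q`: the numbers
`q, n, m, m'`, the addition table and the multiplication table of `F`, and the entries of the two
tuples. -/
def input [Field F] {n m m' : ℕ} (e : F ≃ Fin q) (G : Fin m → Matrix (Fin n) (Fin n) F)
    (H : Fin m' → Matrix (Fin n) (Fin n) F) : RAM.State :=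
  RAM.State.init [q, n, m, m']
    [opTable e (· + ·), opTable e (· * ·), tupleEntries e G, tupleEntries e H]

end Encoding

/-- The program `P` tests any alternating space `ℋ` for isometry to `𝒢` in at most `T` steps: for
every alternating space `ℋ`, every labelling of the field elements and all linear bases of `𝒢` and
`ℋ` as input, it halts within `T` steps with the answer `1` in register `0` if the two spaces
are isometric, and with the answer `0` if they are not. -/
def TestsIsometryTo {n : ℕ} {F : Type} [Field F] [Fintype F] (P : RAM.Prog) (T : ℕ)
    (𝒢 : Submodule F (Matrix (Fin n) (Fin n) F)) : Prop :=
  ∀ ℋ : Submodule F (Matrix (Fin n) (Fin n) F), ℋ ≤ alternating n F →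
  ∀ (e : F ≃ Fin (Fintype.card F)) (m m' : ℕ)
    (G : Fin m → Matrix (Fin n) (Fin n) F) (H : Fin m' → Matrix (Fin n) (Fin n) F),
    IsLinearBasis G 𝒢 → IsLinearBasis H ℋ →
    ∃ (s : RAM.State) (t : ℕ), RAM.Runs P (input e G H) s t ∧ t ≤ T ∧
      (Isometric 𝒢 ℋ → s.reg 0 = 1) ∧ (¬ Isometric 𝒢 ℋ → s.reg 0 = 0)

end AltSpace

/-!
Suppose that `A` is an isometry from `𝒢` to `ℋ` and put `D = A⁻¹`. For matrices `γ i` in `𝒢` and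
their images `η i = Aᵀ * γ i * A` in `ℋ`, the pair `A`, `D` solves the *linear* system
`Aᵀ * γ i = η i * D`. The algorithm guesses a constant number `R = 20` of matrices `γ i` in `𝒢`, as
many matrices `η i` in `ℋ`, and the first column of `D` up to a scalar, which are
`q ^ (2 * R * m + n) = q ^ O(n)` guesses, solves the system by elimination, and tests each of the
vectors that span the solution space: `A * D` has to be a nonzero scalar matrix, and each
`Aᵀ * G k`, for `G k` in the given basis of `𝒢`, has to be of the form `h' * D` with `h'` in `ℋ`.
A pair that passes is an isometry up to a scalar, so that the answer `1` is always correct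
(`isometric_of_certifies`).

Call the tuple `γ` *rigid* if `P * γ i = γ i * Q` for all `i` with `Q` singular implies `P = Q = 0`.
If `γ` is rigid, then for the right guess the difference of any solution and a suitable multiple
of the pair `A`, `D` vanishes: after multiplication by `A` or `D` it is such a pair `P`, `Q`, as its
`D` has first column zero. Thus the solution space is a line, and the test finds the isometry
(`exists_digits_succeeds`). Hence the algorithm is correct for all `𝒢` that contain a rigid
`20`-tuple.

It remains to see that few `𝒢` contain none. If `γ` is not rigid, then the kernels and images of
`P` and `Q`, or their orthogonal complements, yield `a ≥ 1` independent vectors, where `a` is at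
most about `n / 4`, whose images under all `γ i` lie in a space of dimension `2 * a`
(`exists_small_contracted`). An alternating matrix can map `a` independent vectors to arbitrary
vectors in their orthogonal complement, so that this costs each `γ i` at least `a * (n - 3 * a)`
dimensions (`finrank_contracting_add_le`). For `20` matrices this outweighs the choice of the
`3 * a` vectors by a factor `q ^ n`, up to the `n` values of `a` (`ncard_nonrigid_mul_le`). Counting
linear bases by their first `20` members transfers the bound to subspaces
(`ncard_subspaces_mul_le`).

The time bound is obtained without step counting for the individual programs: if all loops of a
program make at most `B` rounds, its time is at most a polynomial in `B`
(`RAM.Prog.exists_timeBound_le`), and `B = q ^ O(n)` bounds the rounds of all loops here.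
-/

namespace RAM

/-! ### Running time and correctness of programs -/

/-- The number of steps of a program all of whose loops make at most `B` rounds. -/
def Prog.timeBound (B : ℕ) : Prog → ℕ
  | .skip => 1
  | .assign _ e => e.cost + 1
  | .store _ i e => i.cost + e.cost + 1
  | .seq P Q => P.timeBound B + Q.timeBound B
  | .cond e P Q => e.cost + 1 + (P.timeBound B + Q.timeBound B)
  | .loop e P => B * (e.cost + 1 + P.timeBound B) + (e.cost + 1)

theorem Prog.exists_timeBound_le (P : Prog) :
    ∃ K k : ℕ, ∀ B, 1 ≤ B → P.timeBound B ≤ K * B ^ k := by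
  induction P with
  | skip => exact ⟨1, 0, fun B _ => by simp [timeBound]⟩
  | assign x e => exact ⟨e.cost + 1, 0, fun B _ => by simp [timeBound]⟩
  | store a i e => exact ⟨i.cost + e.cost + 1, 0, fun B _ => by simp [timeBound]⟩
  | seq P Q hP hQ =>
    obtain ⟨K, k, h⟩ := hP
    obtain ⟨K', k', h'⟩ := hQ
    refine ⟨K + K', k + k', fun B hB => ?_⟩
    have h1 : B ^ k ≤ B ^ (k + k') := Nat.pow_le_pow_right hB (by omega)
    have h2 : B ^ k' ≤ B ^ (k + k') := Nat.pow_le_pow_right hB (by omega)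
    calc P.timeBound B + Q.timeBound B ≤ K * B ^ k + K' * B ^ k' := add_le_add (h B hB) (h' B hB)
      _ ≤ K * B ^ (k + k') + K' * B ^ (k + k') := by gcongr
      _ = _ := by ring
  | cond e P Q hP hQ =>
    obtain ⟨K, k, h⟩ := hP
    obtain ⟨K', k', h'⟩ := hQ
    refine ⟨e.cost + 1 + (K + K'), k + k', fun B hB => ?_⟩
    have h1 : B ^ k ≤ B ^ (k + k') := Nat.pow_le_pow_right hB (by omega)
    have h2 : B ^ k' ≤ B ^ (k + k') := Nat.pow_le_pow_right hB (by omega)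
    have h3 : 1 ≤ B ^ (k + k') := Nat.one_le_pow _ _ hB
    calc e.cost + 1 + (P.timeBound B + Q.timeBound B)
        ≤ (e.cost + 1) * 1 + (K * B ^ k + K' * B ^ k') := by
          have := h B hB
          have := h' B hB
          omega
      _ ≤ (e.cost + 1) * B ^ (k + k') + (K * B ^ (k + k') + K' * B ^ (k + k')) := by gcongr
      _ = _ := by ring
  | loop e P hP =>
    obtain ⟨K, k, h⟩ := hP
    refine ⟨2 * (e.cost + 1) + K, k + 1, fun B hB => ?_⟩
    have h1 : 1 ≤ B ^ (k + 1) := Nat.one_le_pow _ _ hB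
    have h2 : B ≤ B ^ (k + 1) := by
      calc B = B ^ 1 := (pow_one B).symm
        _ ≤ B ^ (k + 1) := Nat.pow_le_pow_right hB (by omega)
    calc B * (e.cost + 1 + P.timeBound B) + (e.cost + 1)
        ≤ B * (e.cost + 1 + K * B ^ k) + (e.cost + 1) * 1 := by
          have := h B hB
          gcongr
          omega
      _ = (e.cost + 1) * B + K * B ^ (k + 1) + (e.cost + 1) * 1 := by ring
      _ ≤ (e.cost + 1) * B ^ (k + 1) + K * B ^ (k + 1) + (e.cost + 1) * B ^ (k + 1) := by gcongr
      _ = _ := by ring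

/-- All registers that the program writes are numbered `r` or higher, all arrays `a` or higher. -/
def Prog.writesAbove (r a : ℕ) : Prog → Bool
  | .skip => true
  | .assign x _ => decide (r ≤ x)
  | .store b _ _ => decide (a ≤ b)
  | .seq P Q => P.writesAbove r a && Q.writesAbove r a
  | .cond _ P Q => P.writesAbove r a && Q.writesAbove r a
  | .loop _ P => P.writesAbove r a

/-- The states agree in the registers below `r` and in the arrays below `a`. -/
structure Agree (r a : ℕ) (s s' : State) : Prop where
  reg : ∀ x < r, s'.reg x = s.reg x
  arr : ∀ b < a, s'.arr b = s.arr b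

theorem Agree.refl (r a : ℕ) (s : State) : Agree r a s s := ⟨fun _ _ => rfl, fun _ _ => rfl⟩

theorem Agree.trans {r a : ℕ} {s s' s'' : State} (h : Agree r a s s') (h' : Agree r a s' s'') :
    Agree r a s s'' :=
  ⟨fun x hx => (h'.reg x hx).trans (h.reg x hx), fun b hb => (h'.arr b hb).trans (h.arr b hb)⟩

theorem Agree.mono {r a r' a' : ℕ} {s s' : State} (h : Agree r a s s') (hr : r' ≤ r)
    (ha : a' ≤ a) : Agree r' a' s s' :=
  ⟨fun x hx => h.reg x (by omega), fun b hb => h.arr b (by omega)⟩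

@[simp] theorem State.reg_setReg_self (s : State) (x v : ℕ) : (s.setReg x v).reg x = v := by
  simp [State.setReg]

theorem State.reg_setReg_ne (s : State) {x y : ℕ} (v : ℕ) (h : y ≠ x) :
    (s.setReg x v).reg y = s.reg y := by
  simp [State.setReg, Function.update_of_ne h]

@[simp] theorem State.arr_setReg (s : State) (x v : ℕ) : (s.setReg x v).arr = s.arr := rfl

@[simp] theorem State.reg_setCell (s : State) (a i v : ℕ) : (s.setCell a i v).reg = s.reg := rfl

theorem State.arr_setCell_ne (s : State) {a b : ℕ} (i v : ℕ) (h : b ≠ a) :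
    (s.setCell a i v).arr b = s.arr b := by
  simp [State.setCell, Function.update_of_ne h]

@[simp] theorem State.arr_setCell_self (s : State) (a i v : ℕ) :
    (s.setCell a i v).arr a = Function.update (s.arr a) i v := by
  simp [State.setCell]

theorem agree_setReg {r a x : ℕ} (s : State) (v : ℕ) (h : r ≤ x) : Agree r a s (s.setReg x v) :=
  ⟨fun y hy => State.reg_setReg_ne s v (by omega), fun _ _ => rfl⟩

theorem agree_setCell {r a b : ℕ} (s : State) (i v : ℕ) (h : a ≤ b) :
    Agree r a s (s.setCell b i v) :=
  ⟨fun _ _ => rfl, fun c hc => State.arr_setCell_ne s i v (by omega)⟩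

theorem Runs.agree {P : Prog} {s s' : State} {t r a : ℕ} (h : Runs P s s' t)
    (hP : P.writesAbove r a = true) : Agree r a s s' := by
  induction h with
  | skip s => exact Agree.refl _ _ _
  | assign s x e => exact agree_setReg _ _ (by simpa [Prog.writesAbove] using hP)
  | store s a i e => exact agree_setCell _ _ _ (by simpa [Prog.writesAbove] using hP)
  | seq _ _ h1 h2 =>
    simp only [Prog.writesAbove, Bool.and_eq_true] at hP
    exact (h1 hP.1).trans (h2 hP.2)
  | condTrue _ _ h1 =>
    simp only [Prog.writesAbove, Bool.and_eq_true] at hP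
    exact h1 hP.1
  | condFalse _ _ h1 =>
    simp only [Prog.writesAbove, Bool.and_eq_true] at hP
    exact h1 hP.2
  | loopDone _ => exact Agree.refl _ _ _
  | loopStep _ _ _ h1 h2 => exact (h1 hP).trans (h2 hP)

/-- Started in `s`, the program halts in a state with property `Q`, within the time that it takes
if every loop makes at most `B` rounds. -/
def Halts (B : ℕ) (P : Prog) (s : State) (Q : State → Prop) : Prop :=
  ∃ (s' : State) (t : ℕ), Runs P s s' t ∧ t ≤ P.timeBound B ∧ Q s'

variable {B : ℕ} {P P' : Prog} {s : State} {Q Q' : State → Prop}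

theorem Halts.imp (h : Halts B P s Q) (hQ : ∀ s', Q s' → Q' s') : Halts B P s Q' := by
  obtain ⟨s', t, h1, h2, h3⟩ := h
  exact ⟨s', t, h1, h2, hQ s' h3⟩

/-- The frame rule. -/
theorem Halts.imp_agree (h : Halts B P s Q) {r a : ℕ} (hP : P.writesAbove r a = true)
    (hQ : ∀ s', Agree r a s s' → Q s' → Q' s') : Halts B P s Q' := by
  obtain ⟨s', t, h1, h2, h3⟩ := h
  exact ⟨s', t, h1, h2, hQ s' (h1.agree hP) h3⟩

theorem Halts.skip (h : Q s) : Halts B .skip s Q :=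
  ⟨s, 1, Runs.skip s, le_rfl, h⟩

theorem Halts.assign {x : ℕ} {e : Expr} (h : Q (s.setReg x (e.eval s))) :
    Halts B (.assign x e) s Q :=
  ⟨_, _, Runs.assign s x e, le_rfl, h⟩

theorem Halts.store {a : ℕ} {i e : Expr} (h : Q (s.setCell a (i.eval s) (e.eval s))) :
    Halts B (.store a i e) s Q :=
  ⟨_, _, Runs.store s a i e, le_rfl, h⟩

theorem Halts.seq (h : Halts B P s fun s' => Halts B P' s' Q) : Halts B (.seq P P') s Q := by
  obtain ⟨s', t, h1, h2, s'', t', h3, h4, h5⟩ := h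
  exact ⟨s'', t + t', Runs.seq h1 h3, add_le_add h2 h4, h5⟩

theorem Halts.cond {e : Expr} (h : e.eval s ≠ 0 → Halts B P s Q)
    (h' : e.eval s = 0 → Halts B P' s Q) : Halts B (.cond e P P') s Q := by
  by_cases he : e.eval s = 0
  · obtain ⟨s', t, h1, h2, h3⟩ := h' he
    exact ⟨s', _, Runs.condFalse he h1, by simp only [Prog.timeBound]; omega, h3⟩
  · obtain ⟨s', t, h1, h2, h3⟩ := h he
    exact ⟨s', _, Runs.condTrue he h1, by simp only [Prog.timeBound]; omega, h3⟩

/-- A loop that makes `N - i` further rounds, with invariant `I`. -/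
theorem Halts.loop {e : Expr} {N : ℕ} (I : ℕ → State → Prop) (hN : N ≤ B) (h0 : I 0 s)
    (he : ∀ i s', i < N → I i s' → e.eval s' ≠ 0) (hd : ∀ s', I N s' → e.eval s' = 0)
    (hstep : ∀ i s', i < N → I i s' → Halts B P s' (I (i + 1)))
    (hQ : ∀ s', I N s' → Q s') : Halts B (.loop e P) s Q := by
  have key : ∀ k i s', i + k = N → I i s' → ∃ (s'' : State) (t : ℕ), Runs (.loop e P) s' s'' t ∧
      t ≤ k * (e.cost + 1 + P.timeBound B) + (e.cost + 1) ∧ I N s'' := by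
    intro k
    induction k with
    | zero =>
      intro i s' hi h
      obtain rfl : i = N := by omega
      exact ⟨s', _, Runs.loopDone (hd s' h), by omega, h⟩
    | succ k ih =>
      intro i s' hi h
      obtain ⟨s1, t1, h1, h2, h3⟩ := hstep i s' (by omega) h
      obtain ⟨s2, t2, h4, h5, h6⟩ := ih (i + 1) s1 (by omega) h3
      refine ⟨s2, _, Runs.loopStep (he i s' (by omega) h) h1 h4, ?_, h6⟩
      rw [Nat.succ_mul]
      omega
  obtain ⟨s', t, h1, h2, h3⟩ := key N 0 s (by omega) h0
  refine ⟨s', t, h1, h2.trans ?_, hQ s' h3⟩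
  simp only [Prog.timeBound]
  gcongr

/-- `for x := 0, …, e - 1 do P`. -/
def Prog.for (x : ℕ) (e : Expr) (P : Prog) : Prog :=
  .seq (.assign x (.lit 0))
    (.loop (.minus e (.reg x)) (.seq P (.assign x (.plus (.reg x) (.lit 1)))))

/-- The rule for counting loops: the body writes no register up to the counter `x` and no array
below `a`, so that these keep their contents; the invariant must not speak of the counter. -/
theorem Halts.for {x a : ℕ} {e : Expr} {N : ℕ} (I : ℕ → State → Prop)
    (hP : P.writesAbove (x + 1) a = true) (hN : N ≤ B)
    (he : ∀ s', Agree x a s s' → e.eval s' = N)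
    (hI : ∀ i s' v, I i s' → I i (s'.setReg x v)) (h0 : I 0 s)
    (hstep : ∀ i s', i < N → Agree x a s s' → s'.reg x = i → I i s' → Halts B P s' (I (i + 1)))
    (hQ : ∀ s', Agree x a s s' → I N s' → Q s') : Halts B (.for x e P) s Q := by
  refine Halts.seq (Halts.assign ?_)
  refine Halts.loop (N := N) (fun i s' => Agree x a s s' ∧ s'.reg x = i ∧ I i s') hN
    ⟨agree_setReg _ _ le_rfl, by simp [Expr.eval], hI _ _ _ h0⟩ ?_ ?_ ?_ ?_
  · rintro i s' hi ⟨h1, h2, h3⟩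
    simp only [Expr.eval, he s' h1, h2]
    omega
  · rintro s' ⟨h1, h2, h3⟩
    simp [Expr.eval, he s' h1, h2]
  · rintro i s' hi ⟨h1, h2, h3⟩
    refine Halts.seq ((hstep i s' hi h1 h2 h3).imp_agree hP fun s1 h4 h5 => Halts.assign ?_)
    have h6 : s1.reg x = i := (h4.reg x (by omega)).trans h2
    refine ⟨(h1.trans (h4.mono (by omega) le_rfl)).trans (agree_setReg _ _ le_rfl), ?_, ?_⟩
    · simp [Expr.eval, h6]
    · exact hI _ _ _ h5
  · rintro s' ⟨h1, h2, h3⟩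
    exact hQ s' h1 h3

end RAM

namespace RAM

variable {B : ℕ} {P : Prog} {s : State} {Q : State → Prop}

/-! ### Tables of multiples and powers -/

/-- `a[i] := i * w` for `i ≤ len`, with counter `x`. -/
def Prog.table (x a : ℕ) (w len : Expr) : Prog :=
  .seq (.store a (.lit 0) (.lit 0))
    (.for x len (.store a (.plus (.reg x) (.lit 1)) (.plus (.cell a (.reg x)) w)))

theorem Halts.table {x a : ℕ} {w len : Expr} {W N : ℕ} (hN : N ≤ B)
    (hw : ∀ s', Agree x a s s' → w.eval s' = W) (hlen : ∀ s', Agree x a s s' → len.eval s' = N)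
    (hQ : ∀ s', Agree x a s s' → (∀ b, b ≠ a → s'.arr b = s.arr b) →
      (∀ i ≤ N, s'.arr a i = i * W) → Q s') :
    Halts B (.table x a w len) s Q := by
  refine Halts.seq (Halts.store ?_)
  have h0 : Agree x a s (s.setCell a (Expr.eval s (.lit 0)) (Expr.eval s (.lit 0))) :=
    agree_setCell _ _ _ le_rfl
  refine Halts.for (a := a) (N := N) (fun i s' => (∀ b, b ≠ a → s'.arr b = s.arr b) ∧
    ∀ j ≤ i, s'.arr a j = j * W) (by simp [Prog.writesAbove]) hN
    (fun s' h => hlen s' (h0.trans h)) (fun i s' v h => h) ?_ ?_ ?_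
  · refine ⟨fun b hb => State.arr_setCell_ne _ _ _ hb, fun j hj => ?_⟩
    obtain rfl : j = 0 := by omega
    simp [Expr.eval]
  · rintro i s' hi h1 h2 ⟨h3, h4⟩
    refine Halts.store ⟨fun b hb => (State.arr_setCell_ne _ _ _ hb).trans (h3 b hb), ?_⟩
    intro j hj
    simp only [Expr.eval, h2, h4 i le_rfl, hw s' (h0.trans h1), State.arr_setCell_self]
    rcases Nat.lt_or_ge j (i + 1) with h | h
    · rw [Function.update_of_ne (by omega), h4 j (by omega)]
    · obtain rfl : j = i + 1 := by omega
      simp [Nat.succ_mul]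
  · rintro s' h1 ⟨h2, h3⟩
    exact hQ s' (h0.trans h1) h2 h3

/-- Register `x + 2` is set to `w ^ len`. -/
def Prog.power (x : ℕ) (w len : Expr) : Prog :=
  .seq (.assign (x + 2) (.lit 1))
    (.for x len (.seq (.assign (x + 3) (.lit 0))
      (.seq (.for (x + 1) w (.assign (x + 3) (.plus (.reg (x + 3)) (.reg (x + 2)))))
        (.assign (x + 2) (.reg (x + 3))))))

theorem Halts.power {x a : ℕ} {w len : Expr} {W N : ℕ} (hN : N ≤ B) (hW : W ≤ B)
    (hw : ∀ s', Agree x a s s' → w.eval s' = W) (hlen : ∀ s', Agree x a s s' → len.eval s' = N)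
    (hQ : ∀ s', Agree x a s s' → s'.reg (x + 2) = W ^ N → Q s') :
    Halts B (.power x w len) s Q := by
  refine Halts.seq (Halts.assign ?_)
  have h0 : Agree x a s (s.setReg (x + 2) (Expr.eval s (.lit 1))) := agree_setReg _ _ (by omega)
  refine Halts.for (a := a) (N := N) (fun i s' => s'.reg (x + 2) = W ^ i)
    (by simp [Prog.writesAbove, Prog.for]) hN (fun s' h => hlen s' (h0.trans h))
    (fun i s' v h => by rw [State.reg_setReg_ne _ _ (by omega), h]) (by simp [Expr.eval]) ?_
    (fun s' h1 h2 => hQ s' (h0.trans h1) h2)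
  intro i s1 _ h1 _ h3
  refine Halts.seq (Halts.assign (Halts.seq ?_))
  have h4 : Agree x a s (s1.setReg (x + 3) (Expr.eval s1 (.lit 0))) :=
    (h0.trans h1).trans (agree_setReg _ _ (by omega))
  refine Halts.for (a := a) (N := W)
    (fun j s' => s'.reg (x + 2) = W ^ i ∧ s'.reg (x + 3) = j * W ^ i)
    (by simp [Prog.writesAbove]) hW (fun s' h => hw s' (h4.trans (h.mono (by omega) le_rfl)))
    (fun j s' v h => ?_) ?_ ?_ ?_
  · rwa [State.reg_setReg_ne _ _ (by omega), State.reg_setReg_ne _ _ (by omega)]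
  · rw [State.reg_setReg_ne _ _ (by omega), h3]
    simp [Expr.eval]
  · rintro j s' _ _ _ ⟨h6, h7⟩
    refine Halts.assign ⟨?_, ?_⟩
    · rw [State.reg_setReg_ne _ _ (by omega), h6]
    · simp [Expr.eval, h6, h7, Nat.succ_mul]
  · rintro s' _ ⟨_, h7⟩
    refine Halts.assign ?_
    simp [Expr.eval, h7, pow_succ, mul_comm]

/-! ### Exhaustive search -/

/-- Run `P` once for every array `d` of `len` digits below `w`; `M` is the number `w ^ len` of
these arrays, which are found as the `w`-ary expansions of the numbers below `M`. The register
`x + 1` is left to `P` for its answer. -/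
def Prog.search (x d : ℕ) (w len M : Expr) (P : Prog) : Prog :=
  .for x M (.seq (.assign (x + 3) (.reg x))
    (.seq (.for (x + 2) len
      (.seq (.assign (x + 4) (.lit 0))
      (.seq (.loop (.minus (.plus (.reg (x + 3)) (.lit 1)) w)
        (.seq (.assign (x + 3) (.minus (.reg (x + 3)) w))
          (.assign (x + 4) (.plus (.reg (x + 4)) (.lit 1)))))
      (.seq (.store d (.reg (x + 2)) (.reg (x + 3)))
        (.assign (x + 3) (.reg (x + 4)))))))
    P))

/-- The digits of a number. -/
theorem Halts.digits {x a d : ℕ} {w len : Expr} {W N τ : ℕ} (ha : a ≤ d) (hW : 0 < W)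
    (hN : N ≤ B) (hτ : τ ≤ B)
    (hw : ∀ s', Agree x a s s' → w.eval s' = W) (hlen : ∀ s', Agree x a s s' → len.eval s' = N)
    (hs : s.reg (x + 1) = τ)
    (hQ : ∀ s', Agree x a s s' → (∀ i < N, s'.arr d i = τ / W ^ i % W) → Q s') :
    Halts B (.for x len
      (.seq (.assign (x + 2) (.lit 0))
      (.seq (.loop (.minus (.plus (.reg (x + 1)) (.lit 1)) w)
        (.seq (.assign (x + 1) (.minus (.reg (x + 1)) w))
          (.assign (x + 2) (.plus (.reg (x + 2)) (.lit 1)))))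
      (.seq (.store d (.reg x) (.reg (x + 1)))
        (.assign (x + 1) (.reg (x + 2))))))) s Q := by
  refine Halts.for (a := a) (N := N)
    (fun i s' => s'.reg (x + 1) = τ / W ^ i ∧ ∀ j < i, s'.arr d j = τ / W ^ j % W)
    (by simp [Prog.writesAbove, ha]) hN hlen
    (fun i s' v h => by rwa [State.reg_setReg_ne _ _ (by omega)]) (by simp [hs]) ?_
    (fun s' h1 h2 => hQ s' h1 h2.2)
  rintro i s1 hi h1 h2 ⟨h3, h4⟩
  refine Halts.seq (Halts.assign (Halts.seq ?_))
  set v := τ / W ^ i with hv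
  have hvB : v / W ≤ B := (Nat.div_le_self _ _).trans ((Nat.div_le_self _ _).trans hτ)
  have h5 : Agree x a s (s1.setReg (x + 2) (Expr.eval s1 (.lit 0))) :=
    h1.trans (agree_setReg _ _ (by omega))
  refine Halts.loop (N := v / W) (fun k s' => Agree x a s s' ∧ s'.reg x = i ∧ s'.arr = s1.arr ∧
    s'.reg (x + 1) = v - k * W ∧ s'.reg (x + 2) = k) hvB ?_ ?_ ?_ ?_ ?_
  · refine ⟨h5, ?_, rfl, ?_, ?_⟩
    · rw [State.reg_setReg_ne _ _ (by omega), h2]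
    · rw [State.reg_setReg_ne _ _ (by omega), h3]
      simp
    · simp [Expr.eval]
  · rintro k s' hk ⟨h6, -, -, h8, -⟩
    have : (k + 1) * W ≤ v := by
      calc (k + 1) * W ≤ v / W * W := Nat.mul_le_mul_right _ hk
        _ ≤ v := Nat.div_mul_le_self _ _
    rw [Nat.succ_mul] at this
    simp only [Expr.eval, h8, hw s' h6]
    omega
  · rintro s' ⟨h6, -, -, h8, -⟩
    have h9 : v - v / W * W = v % W := by
      have := Nat.div_add_mod v W
      rw [mul_comm] at this
      omega
    have := Nat.mod_lt v hW
    simp only [Expr.eval, h8, hw s' h6, h9]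
    omega
  · rintro k s' hk ⟨h6, h7, h8, h9, h10⟩
    refine Halts.seq (Halts.assign (Halts.assign ⟨?_, ?_, h8, ?_, ?_⟩))
    · exact (h6.trans (agree_setReg _ _ (by omega))).trans (agree_setReg _ _ (by omega))
    · rw [State.reg_setReg_ne _ _ (by omega), State.reg_setReg_ne _ _ (by omega), h7]
    · rw [State.reg_setReg_ne _ _ (by omega), State.reg_setReg_self]
      simp only [Expr.eval, h9, hw s' h6, Nat.succ_mul]
      omega
    · simp only [Expr.eval, State.reg_setReg_self]
      rw [State.reg_setReg_ne _ _ (by omega), h10]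
  · rintro s' ⟨h6, h7, h8, h9, h10⟩
    have h11 : v - v / W * W = v % W := by
      have := Nat.div_add_mod v W
      rw [mul_comm] at this
      omega
    refine Halts.seq (Halts.store (Halts.assign ⟨?_, ?_⟩))
    · simp only [Expr.eval, State.reg_setReg_self, State.reg_setCell, h10, hv]
      rw [Nat.div_div_eq_div_mul, pow_succ]
    · intro j hj
      simp only [State.arr_setReg, State.arr_setCell_self, Expr.eval, h7, h9, h8, h11]
      rcases Nat.lt_or_ge j i with h | h
      · rw [Function.update_of_ne (by omega), h4 j h]
      · obtain rfl : j = i := by omega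
        simp [hv]

theorem exists_digits {W N : ℕ} (δ : ℕ → ℕ) (hδ : ∀ i < N, δ i < W) :
    ∃ τ < W ^ N, ∀ i < N, τ / W ^ i % W = δ i := by
  induction N generalizing δ with
  | zero => exact ⟨0, by simp, by simp⟩
  | succ N ih =>
    obtain ⟨τ, h1, h2⟩ := ih (fun i => δ (i + 1)) fun i hi => hδ (i + 1) (by omega)
    have h0 := hδ 0 (by omega)
    have hW : 0 < W := by omega
    refine ⟨τ * W + δ 0, ?_, ?_⟩
    · calc τ * W + δ 0 < τ * W + W := by omega
        _ = (τ + 1) * W := by ring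
        _ ≤ W ^ N * W := Nat.mul_le_mul_right _ h1
        _ = W ^ (N + 1) := (pow_succ _ _).symm
    · rintro (_ | i) hi
      · simp [Nat.mod_eq_of_lt h0]
      · rw [pow_succ', ← Nat.div_div_eq_div_mul, Nat.add_div_of_dvd_right (Dvd.intro_left τ rfl),
          Nat.mul_div_cancel _ hW, Nat.div_eq_of_lt h0, add_zero]
        exact h2 i (by omega)

/-- Correctness of the exhaustive search, for a body that may raise the flag in register `x + 1`
only on digit arrays with property `S`, and that does raise it on those with property `C`. -/
theorem Halts.search {x a d : ℕ} {w len M : Expr} {W N : ℕ} (S C : (ℕ → ℕ) → Prop)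
    (ha : a ≤ d) (hP : P.writesAbove (x + 1) a = true) (hW : 0 < W) (hN : N ≤ B) (hM : W ^ N ≤ B)
    (hw : ∀ s', Agree x a s s' → w.eval s' = W) (hlen : ∀ s', Agree x a s s' → len.eval s' = N)
    (hMe : ∀ s', Agree x a s s' → M.eval s' = W ^ N)
    (hs : s.reg (x + 1) = 0)
    (hbody : ∀ s', Agree x a s s' → (∀ i < N, s'.arr d i < W) →
      Halts B P s' fun s'' => (s'.reg (x + 1) ≠ 0 → s''.reg (x + 1) ≠ 0) ∧
        (s''.reg (x + 1) ≠ 0 → s'.reg (x + 1) ≠ 0 ∨ S (s'.arr d)) ∧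
        (C (s'.arr d) → s''.reg (x + 1) ≠ 0))
    (hQ : ∀ s', Agree x a s s' →
      (s'.reg (x + 1) ≠ 0 → ∃ δ : ℕ → ℕ, (∀ i < N, δ i < W) ∧ S δ) →
      (∀ δ : ℕ → ℕ, (∀ i < N, δ i < W) → (∀ δ' : ℕ → ℕ, (∀ i < N, δ' i = δ i) → C δ') →
        s'.reg (x + 1) ≠ 0) → Q s') :
    Halts B (.search x d w len M P) s Q := by
  refine Halts.for (a := a) (N := W ^ N)
    (fun τ s' => (s'.reg (x + 1) ≠ 0 → ∃ δ : ℕ → ℕ, (∀ i < N, δ i < W) ∧ S δ) ∧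
      ∀ τ' < τ, (∀ δ' : ℕ → ℕ, (∀ i < N, δ' i = τ' / W ^ i % W) → C δ') → s'.reg (x + 1) ≠ 0)
    (by simp [Prog.writesAbove, Prog.for, hP, ha]) hM hMe
    (fun i s' v h => by rwa [State.reg_setReg_ne _ _ (by omega)]) (by simp [hs]) ?_ ?_
  · rintro τ s1 hτ h1 h2 ⟨h3, h4⟩
    refine Halts.seq (Halts.assign (Halts.seq ?_))
    have h5 : Agree (x + 2) a s1 (s1.setReg (x + 3) (Expr.eval s1 (.reg x))) :=
      agree_setReg _ _ (by omega)
    refine Halts.digits (x := x + 2) (a := a) (N := N) (W := W) (τ := τ) ha hW hN (by omega)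
      (fun s' h => hw s' (h1.trans ((h5.trans h).mono (by omega) le_rfl)))
      (fun s' h => hlen s' (h1.trans ((h5.trans h).mono (by omega) le_rfl)))
      (by simp [Expr.eval, h2]) ?_
    intro s2 h6 h7
    have h8 : Agree (x + 2) a s1 s2 := h5.trans h6
    have h9 : s2.reg (x + 1) = s1.reg (x + 1) := h8.reg _ (by omega)
    have hdig : ∀ i < N, s2.arr d i < W := fun i hi => by
      rw [h7 i hi]
      exact Nat.mod_lt _ hW
    refine (hbody s2 (h1.trans (h8.mono (by omega) le_rfl)) hdig).imp ?_
    rintro s3 ⟨h10, h11, h12⟩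
    rw [h9] at h10 h11
    refine ⟨fun h => (h11 h).elim h3 fun h => ⟨_, hdig, h⟩, fun τ' hτ' hC => ?_⟩
    rcases Nat.lt_or_ge τ' τ with h | h
    · exact h10 (h4 τ' h hC)
    · obtain rfl : τ' = τ := by omega
      exact h12 (hC _ h7)
  · rintro s' h1 ⟨h2, h3⟩
    refine hQ s' h1 h2 fun δ hδ hC => ?_
    obtain ⟨τ, h4, h5⟩ := exists_digits δ hδ
    exact h3 τ h4 fun δ' hδ' => hC δ' fun i hi => (hδ' i hi).trans (h5 i hi)

end RAM

namespace RAM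

variable {B : ℕ} {P : Prog} {s : State} {Q : State → Prop}
variable {F : Type} [Field F] {q : ℕ} {e : F ≃ Fin q}

/-! ### Arithmetic in the finite field -/

/-- Nonzero if and only if the two values differ. -/
def Expr.ne (E E' : Expr) : Expr := .plus (.minus E E') (.minus E' E)

theorem Expr.eval_ne_eq_zero {E E' : Expr} : (Expr.ne E E').eval s = 0 ↔ E.eval s = E'.eval s := by
  simp only [Expr.ne, Expr.eval]
  omega

/-- Look up a sum of field elements; the array `4` holds the multiples of `q`. -/
def Expr.fadd (E E' : Expr) : Expr := .cell 0 (.plus (.cell 4 E) E')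

/-- Look up a product of field elements. -/
def Expr.fmul (E E' : Expr) : Expr := .cell 1 (.plus (.cell 4 E) E')

/-- The arrays `0`, `1` and `4` are fit for the evaluation of sums and products of field elements
that are written as numbers by means of `e`. -/
structure HasOps (e : F ≃ Fin q) (s : State) : Prop where
  add : ∀ x y : F, s.arr 0 ((e x : ℕ) * q + e y) = e (x + y)
  mul : ∀ x y : F, s.arr 1 ((e x : ℕ) * q + e y) = e (x * y)
  row : ∀ i < q, s.arr 4 i = i * q

theorem HasOps.agree {r a : ℕ} {s' : State} (h : HasOps e s) (ha : 5 ≤ a) (hs : Agree r a s s') :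
    HasOps e s' := by
  obtain ⟨h1, h2, h3⟩ := h
  refine ⟨?_, ?_, ?_⟩
  · rwa [hs.arr 0 (by omega)]
  · rwa [hs.arr 1 (by omega)]
  · rwa [hs.arr 4 (by omega)]

theorem HasOps.eval_fadd {E E' : Expr} {x y : F} (h : HasOps e s) (hE : E.eval s = e x)
    (hE' : E'.eval s = e y) : (Expr.fadd E E').eval s = e (x + y) := by
  simp only [Expr.fadd, Expr.eval, hE, hE', h.row _ (e x).isLt, h.add]

theorem HasOps.eval_fmul {E E' : Expr} {x y : F} (h : HasOps e s) (hE : E.eval s = e x)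
    (hE' : E'.eval s = e y) : (Expr.fmul E E').eval s = e (x * y) := by
  simp only [Expr.fmul, Expr.eval, hE, hE', h.row _ (e x).isLt, h.mul]

theorem label_inj {F : Type} {e : F ≃ Fin q} {x y : F} : ((e x : Fin q) : ℕ) = e y ↔ x = y := by
  rw [Fin.val_inj, e.injective.eq_iff]

/-- The register `x + 1` is set to the number below `len` at which the value of `E` is `0`; the
register `x` runs through the candidates. -/
def Prog.find (x : ℕ) (len E : Expr) : Prog :=
  .for x len (.cond E .skip (.assign (x + 1) (.reg x)))

theorem Halts.find {x a : ℕ} {len E : Expr} {N i₀ : ℕ} (hN : N ≤ B) (hi₀ : i₀ < N)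
    (hlen : ∀ s', Agree x a s s' → len.eval s' = N)
    (hE : ∀ i s', i < N → Agree x a s s' → s'.reg x = i → (E.eval s' = 0 ↔ i = i₀))
    (hQ : ∀ s', Agree x a s s' → s'.reg (x + 1) = i₀ → Q s') :
    Halts B (.find x len E) s Q := by
  refine Halts.for (a := a) (N := N) (fun i s' => i₀ < i → s'.reg (x + 1) = i₀)
    (by simp [Prog.writesAbove]) hN hlen
    (fun i s' v h => by rwa [State.reg_setReg_ne _ _ (by omega)]) (by simp) ?_
    (fun s' h1 h2 => hQ s' h1 (h2 hi₀))
  intro i s1 hi h1 h2 h3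
  refine Halts.cond (fun h => Halts.skip fun h4 => ?_) (fun h => Halts.assign fun h4 => ?_)
  · have : i ≠ i₀ := fun h5 => h ((hE i s1 hi h1 h2).2 h5)
    exact h3 (by omega)
  · simp only [State.reg_setReg_self, Expr.eval, h2]
    exact (hE i s1 hi h1 h2).1 h

/-- The register `x + 1` is set to the sum over the values `0, …, len - 1` of the register `x` of
the field elements denoted by `E`. -/
def Prog.sum (x : ℕ) (len E : Expr) : Prog :=
  .seq (.assign (x + 1) (.reg 4)) (.for x len (.assign (x + 1) (.fadd (.reg (x + 1)) E)))

theorem Halts.sum {x a : ℕ} {len E : Expr} {N : ℕ} (f : ℕ → F) (hN : N ≤ B) (ha : 5 ≤ a)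
    (hs : HasOps e s) (h0 : s.reg 4 = e 0)
    (hlen : ∀ s', Agree x a s s' → len.eval s' = N)
    (hE : ∀ i s', i < N → Agree x a s s' → s'.reg x = i → E.eval s' = e (f i))
    (hQ : ∀ s', Agree x a s s' → s'.reg (x + 1) = e (∑ i ∈ Finset.range N, f i) → Q s') :
    Halts B (.sum x len E) s Q := by
  refine Halts.seq (Halts.assign ?_)
  have h1 : Agree x a s (s.setReg (x + 1) (Expr.eval s (.reg 4))) := agree_setReg _ _ (by omega)
  refine Halts.for (a := a) (N := N)
    (fun i s' => s'.reg (x + 1) = e (∑ j ∈ Finset.range i, f j))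
    (by simp [Prog.writesAbove]) hN (fun s' h => hlen s' (h1.trans h))
    (fun i s' v h => by rwa [State.reg_setReg_ne _ _ (by omega)]) (by simp [Expr.eval, h0]) ?_
    (fun s' h2 h3 => hQ s' (h1.trans h2) h3)
  intro i s' hi h2 h3 h4
  refine Halts.assign ?_
  rw [State.reg_setReg_self, Finset.sum_range_succ]
  exact (hs.agree ha (h1.trans h2)).eval_fadd h4 (hE i s' hi (h1.trans h2) h3)

end RAM

namespace AltSpace

open RAM

variable {B : ℕ} {s : State} {Q : State → Prop}
variable {F : Type} [Field F] {q : ℕ} {e : F ≃ Fin q}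
variable {n m R : ℕ} {g h : ℕ → ℕ → ℕ → F}

/-! ### The working state of the isometry test -/

/-- Array `a` holds the matrices `g 0, …, g (k - 1)`. -/
def HoldsTuple {F : Type} (e : F ≃ Fin q) (n a k : ℕ) (g : ℕ → ℕ → ℕ → F) (s : State) : Prop :=
  ∀ i < k, ∀ x < n, ∀ y < n, s.arr a ((i * n + x) * n + y) = e (g i x y)

/-- The state after the preparations: the arrays `2` and `3` hold two `m`-tuples of `n × n`
matrices, the registers `4` and `5` the field elements `0` and `-1`, the registers `6` and `7` the
numbers of unknowns and of digits to be guessed, the registers `8` and `10` the numbers of digit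
arrays of length `2 * R * m + n` and `m`, and the arrays `5`, `6`, `7` multiples of `n`, of
`m` and of `2 * n ^ 2`. -/
structure Ready (e : F ≃ Fin q) (n m R : ℕ) (g h : ℕ → ℕ → ℕ → F) (s : State) : Prop where
  ops : HasOps e s
  q_eq : s.reg 0 = q
  n_eq : s.reg 1 = n
  m_eq : s.reg 2 = m
  zero : s.reg 4 = e 0
  neg : s.reg 5 = e (-1)
  N_eq : s.reg 6 = 2 * (n * n)
  L_eq : s.reg 7 = 2 * R * m + n
  qL_eq : s.reg 8 = q ^ (2 * R * m + n)
  qm_eq : s.reg 10 = q ^ m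
  fst : HoldsTuple e n 2 m g s
  snd : HoldsTuple e n 3 m h s
  row_fst : ∀ k ≤ m + R, s.arr 5 k = k * n
  row_snd : ∀ k ≤ m + R, ∀ x < n, s.arr 5 (k * n + x) = (k * n + x) * n
  row_low : ∀ x ≤ n, s.arr 5 x = x * n
  digit : ∀ i ≤ 2 * R, s.arr 6 i = i * m
  vec : ∀ i ≤ 2 * (n * n), s.arr 7 i = i * (2 * (n * n))

theorem HoldsTuple.agree {F : Type} {e : F ≃ Fin q} {g : ℕ → ℕ → ℕ → F} {r a b k : ℕ}
    {s' : State} (hs : HoldsTuple e n b k g s) (hb : b < a)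
    (hag : Agree r a s s') : HoldsTuple e n b k g s' := by
  unfold HoldsTuple
  rw [hag.arr b hb]
  exact hs

theorem Ready.agree {s' : State} {r a : ℕ} (hs : Ready e n m R g h s) (hr : 12 ≤ r) (ha : 8 ≤ a)
    (hag : Agree r a s s') : Ready e n m R g h s' where
  ops := hs.ops.agree (by omega) hag
  q_eq := (hag.reg _ (by omega)).trans hs.q_eq
  n_eq := (hag.reg _ (by omega)).trans hs.n_eq
  m_eq := (hag.reg _ (by omega)).trans hs.m_eq
  zero := (hag.reg _ (by omega)).trans hs.zero
  neg := (hag.reg _ (by omega)).trans hs.neg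
  N_eq := (hag.reg _ (by omega)).trans hs.N_eq
  L_eq := (hag.reg _ (by omega)).trans hs.L_eq
  qL_eq := (hag.reg _ (by omega)).trans hs.qL_eq
  qm_eq := (hag.reg _ (by omega)).trans hs.qm_eq
  fst := hs.fst.agree (by omega) hag
  snd := hs.snd.agree (by omega) hag
  row_fst := by rw [hag.arr 5 (by omega)]; exact hs.row_fst
  row_snd := by rw [hag.arr 5 (by omega)]; exact hs.row_snd
  row_low := by rw [hag.arr 5 (by omega)]; exact hs.row_low
  digit := by rw [hag.arr 6 (by omega)]; exact hs.digit
  vec := by rw [hag.arr 7 (by omega)]; exact hs.vec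

/-! ### Linear combinations of the given matrices -/

/-- For `i < cnt`, the `i`-th matrix of the array `dst` becomes the linear combination of the
matrices of the array `src` with the coefficients from row `off + i` of the array `dg`. -/
def combine (x dg src dst : ℕ) (off cnt : Expr) : Prog :=
  .for x cnt (.for (x + 1) (.reg 1) (.for (x + 2) (.reg 1)
    (.seq (.sum (x + 3) (.reg 2)
      (.fmul (.cell dg (.plus (.cell 6 (.plus off (.reg x))) (.reg (x + 3))))
        (.cell src (.plus (.cell 5 (.plus (.cell 5 (.reg (x + 3))) (.reg (x + 1))))
          (.reg (x + 2))))))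
      (.store dst (.plus (.cell 5 (.plus (.cell 5 (.reg x)) (.reg (x + 1)))) (.reg (x + 2)))
        (.reg (x + 4))))))

theorem halts_combine {x a dg src dst o k : ℕ} (c : ℕ → ℕ → F) (g' : ℕ → ℕ → ℕ → F)
    (hx : 12 ≤ x) (ha : 8 ≤ a) (hda : a ≤ dst) (hdg : dg < a) (hsrc : src < a)
    (hn : n ≤ B) (hm : m ≤ B) (hk : k ≤ B) (hkR : k ≤ R) (hok : o + k ≤ 2 * R)
    {cnt : Expr} (hcnt : ∀ s', Agree x a s s' → cnt.eval s' = k)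
    (hs : Ready e n m R g h s)
    (hc : ∀ i < k, ∀ j < m, s.arr dg ((o + i) * m + j) = e (c i j))
    (hg : HoldsTuple e n src m g' s)
    (hQ : ∀ s', Agree x a s s' →
      HoldsTuple e n dst k (fun i y z => ∑ j ∈ Finset.range m, c i j * g' j y z) s' → Q s') :
    Halts B (combine x dg src dst (.lit o) cnt) s Q := by
  set tgt : ℕ → ℕ := fun y => e (∑ j ∈ Finset.range m, c (y / n / n) j * g' j (y / n % n) (y % n))
    with htgt
  have htgt' : ∀ i y z, y < n → z < n → tgt ((i * n + y) * n + z) =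
      e (∑ j ∈ Finset.range m, c i j * g' j y z) := by
    intro i y z hy hz
    have h1 : ((i * n + y) * n + z) / n = i * n + y := by
      rw [mul_comm, Nat.mul_add_div (by omega), Nat.div_eq_of_lt hz, add_zero]
    have h2 : (i * n + y) / n = i := by
      rw [mul_comm, Nat.mul_add_div (by omega), Nat.div_eq_of_lt hy, add_zero]
    simp only [htgt, h1, h2, Nat.mul_add_mod_of_lt hy, Nat.mul_add_mod_of_lt hz]
  refine Halts.for (a := a) (N := k) (fun i s' => ∀ y < i * n * n, s'.arr dst y = tgt y)
    ?_ hk hcnt (fun i s' v h => h) (by simp) ?_ ?_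
  · simp only [Prog.sum, Prog.for, Prog.writesAbove, Bool.and_eq_true,
      decide_eq_true_eq]
    omega
  · intro i s1 hi ag1 r1 I1
    have R1 := hs.agree hx ha ag1
    refine Halts.for (a := a) (N := n)
      (fun y s' => ∀ z < (i * n + y) * n, s'.arr dst z = tgt z) ?_ hn (fun s' h' => ?_)
      (fun i s' v h => h) (by simpa using I1) ?_ (fun s' _ h' => ?_)
    · simp only [Prog.sum, Prog.for, Prog.writesAbove, Bool.and_eq_true,
        decide_eq_true_eq]
      omega
    · exact (R1.agree (by omega) ha h').n_eq
    · intro y s2 hy ag2 r2 I2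
      have R2 := R1.agree (by omega) ha ag2
      refine Halts.for (a := a) (N := n)
        (fun z s' => ∀ w < (i * n + y) * n + z, s'.arr dst w = tgt w) ?_ hn (fun s' h' => ?_)
        (fun i s' v h => h) (by simpa using I2) ?_ (fun s' _ h' => ?_)
      · simp only [Prog.sum, Prog.for, Prog.writesAbove, Bool.and_eq_true,
          decide_eq_true_eq]
        omega
      · exact (R2.agree (by omega) ha h').n_eq
      · intro z s3 hz ag3 r3 I3
        have R3 := R2.agree (by omega) ha ag3
        have ag03 : Agree x a s s3 :=
          (ag1.trans (ag2.mono (by omega) le_rfl)).trans (ag3.mono (by omega) le_rfl)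
        have r31 : s3.reg (x + 1) = y := (ag3.reg _ (by omega)).trans r2
        have r30 : s3.reg x = i :=
          (ag3.reg _ (by omega)).trans ((ag2.reg _ (by omega)).trans r1)
        refine Halts.seq (Halts.sum (a := dst + 1) (fun j => c i j * g' j y z) hm (by omega)
          R3.ops R3.zero (fun s' h' => ?_) ?_ ?_)
        · exact (R3.agree (by omega) (by omega) h').m_eq
        · intro j s4 hj ag4 r4
          have R4 := R3.agree (by omega) (by omega) ag4
          refine R4.ops.eval_fmul ?_ ?_
          · simp only [Expr.eval, r4, ag4.reg x (by omega), r30]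
            rw [R4.digit _ (by omega), ag4.arr dg (by omega), ag03.arr dg hdg, hc i hi j hj]
          · simp only [Expr.eval, r4, ag4.reg (x + 1) (by omega), ag4.reg (x + 2) (by omega), r31,
              r3]
            rw [R4.row_fst j (by omega), R4.row_snd j (by omega) y hy, ag4.arr src (by omega),
              ag03.arr src hsrc, hg j hj y hy z hz]
        · intro s4 ag4 r4
          have R4 := R3.agree (by omega) (by omega) ag4
          refine Halts.store fun w hw => ?_
          have hidx : Expr.eval s4 (.plus (.cell 5 (.plus (.cell 5 (.reg x)) (.reg (x + 1))))
              (.reg (x + 2))) = (i * n + y) * n + z := by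
            simp only [Expr.eval, ag4.reg x (by omega), ag4.reg (x + 1) (by omega),
              ag4.reg (x + 2) (by omega), r30, r31, r3]
            rw [R4.row_fst i (by omega), R4.row_snd i (by omega) y hy]
          rw [State.arr_setCell_self, hidx]
          rcases Nat.lt_or_ge w ((i * n + y) * n + z) with h' | h'
          · rw [Function.update_of_ne (by omega), ag4.arr dst (by omega), I3 w h']
          · obtain rfl : w = (i * n + y) * n + z := by omega
            rw [Function.update_self, htgt' i y z hy hz]
            simpa [Expr.eval] using r4
      · intro w hw
        exact h' w (by rwa [← add_assoc, add_mul (i * n + y), one_mul] at hw)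
    · intro w hw
      exact h' w (by rw [add_mul, one_mul] at hw; exact hw)
  · intro s' h1 h2
    refine hQ s' h1 fun i hi y hy z hz => ?_
    rw [h2 _ ?_, htgt' i y z hy hz]
    calc (i * n + y) * n + z < (i * n + y) * n + n := by omega
      _ = (i * n + y + 1) * n := by ring
      _ ≤ (i * n + n) * n := Nat.mul_le_mul_right _ (by omega)
      _ = (i + 1) * n * n := by ring
      _ ≤ k * n * n := Nat.mul_le_mul_right _ (Nat.mul_le_mul_right _ hi)

end AltSpace

namespace AltSpace

open RAM

variable {B : ℕ} {s : State} {Q : State → Prop}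
variable {F : Type} [Field F] {q : ℕ} {e : F ≃ Fin q}
variable {n m R : ℕ} {g h : ℕ → ℕ → ℕ → F}

/-! ### The linear equations -/

/-- A pair of `n × n` matrices `X`, `Y` is written row by row as a vector, `Y` before `X`. This is
the entry in row `y` and column `z` of the matrix `X * gᵀ + h * Yᵀ`. -/
def residual (n : ℕ) (g h : ℕ → ℕ → F) (y z : ℕ) : (ℕ → F) →ₗ[F] F :=
  ∑ k ∈ Finset.range n, (g z k • LinearMap.proj (n * n + (y * n + k)) +
    h y k • LinearMap.proj (z * n + k))

theorem residual_apply (g h : ℕ → ℕ → F) (y z : ℕ) (v : ℕ → F) :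
    residual n g h y z v = ∑ k ∈ Finset.range n,
      (v (n * n + (y * n + k)) * g z k + v (z * n + k) * h y k) := by
  simp only [residual, LinearMap.coe_sum, Finset.sum_apply, LinearMap.add_apply,
    LinearMap.smul_apply, LinearMap.proj_apply, smul_eq_mul]
  exact Finset.sum_congr rfl fun k _ => by ring

/-- The span of the first `N` vectors. -/
def spanBelow (N : ℕ) (V : ℕ → ℕ → F) : Submodule F (ℕ → F) :=
  Submodule.span F (V '' Set.Iio N)

/-- One step of the elimination without divisions. The pivot vector `V p` itself becomes `0`. -/
theorem mem_spanBelow_eliminate {N p : ℕ} {V V' : ℕ → ℕ → F} {l : (ℕ → F) →ₗ[F] F} (hp : p < N)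
    (hl : l (V p) ≠ 0) (hV' : ∀ j < N, V' j = l (V p) • V j - l (V j) • V p) (x : ℕ → F) :
    x ∈ spanBelow N V' ↔ x ∈ spanBelow N V ∧ l x = 0 := by
  have hmem : ∀ j < N, V j ∈ spanBelow N V := fun j hj => Submodule.subset_span ⟨j, hj, rfl⟩
  have hmem' : ∀ j < N, V' j ∈ spanBelow N V' := fun j hj => Submodule.subset_span ⟨j, hj, rfl⟩
  constructor
  · intro hx
    refine Submodule.span_induction (p := fun x _ => x ∈ spanBelow N V ∧ l x = 0) ?_ ?_ ?_ ?_ hx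
    · rintro _ ⟨j, hj, rfl⟩
      rw [hV' j hj]
      refine ⟨sub_mem (Submodule.smul_mem _ _ (hmem j hj)) (Submodule.smul_mem _ _ (hmem p hp)), ?_⟩
      simp [mul_comm]
    · exact ⟨zero_mem _, map_zero l⟩
    · rintro x y - - ⟨h1, h2⟩ ⟨h3, h4⟩
      exact ⟨add_mem h1 h3, by rw [map_add, h2, h4, add_zero]⟩
    · rintro c x - ⟨h1, h2⟩
      exact ⟨Submodule.smul_mem _ _ h1, by rw [map_smul, h2, smul_zero]⟩
  · rintro ⟨hx, hlx⟩
    have key : l (V p) • x - l x • V p ∈ spanBelow N V' := by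
      refine Submodule.span_induction
        (p := fun x _ => l (V p) • x - l x • V p ∈ spanBelow N V') ?_ ?_ ?_ ?_ hx
      · rintro _ ⟨j, hj, rfl⟩
        rw [← hV' j hj]
        exact hmem' j hj
      · simp
      · intro x y _ _ h1 h2
        have h3 := add_mem h1 h2
        rw [map_add]
        convert h3 using 1
        module
      · intro c x _ h1
        have h3 := Submodule.smul_mem _ c h1
        rw [map_smul, smul_eq_mul]
        convert h3 using 1
        module
    rw [hlx, zero_smul, sub_zero] at key
    have h3 := Submodule.smul_mem _ (l (V p))⁻¹ key
    rwa [inv_smul_smul₀ hl] at h3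

/-- Without a pivot, the equation holds on the whole span. -/
theorem mem_spanBelow_of_forall {N : ℕ} {V : ℕ → ℕ → F} {l : (ℕ → F) →ₗ[F] F}
    (hl : ∀ j < N, l (V j) = 0) (x : ℕ → F) :
    x ∈ spanBelow N V ↔ x ∈ spanBelow N V ∧ l x = 0 := by
  refine ⟨fun hx => ⟨hx, ?_⟩, fun hx => hx.1⟩
  have : spanBelow N V ≤ LinearMap.ker l := Submodule.span_le.2 fun y ⟨j, hj, hy⟩ => by
    rw [← hy]
    exact hl j hj
  exact this hx

/-- The first `N` vectors `V 0, V 1, …`, of length `N` each, stand in the array `11`. -/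
def HoldsVecs {F : Type} (e : F ≃ Fin q) (N : ℕ) (V : ℕ → ℕ → F) (s : State) : Prop :=
  ∀ j < N, ∀ l < N, s.arr 11 (j * N + l) = e (V j l)

/-- The register `x + 1` is set to the `residual` of the `j`-th vector of the array `11` at row `y`
and column `z`, where the registers `jr`, `yr` and `zr` contain `j`, `y` and `z`. -/
def residualProg (x jr yr zr ga : ℕ) (gi : Expr) (ha : ℕ) (hi : Expr) : Prog :=
  .sum x (.reg 1) (.fadd
    (.fmul (.cell 11 (.plus (.cell 7 (.reg jr)) (.plus (.cell 5 (.reg 1))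
        (.plus (.cell 5 (.reg yr)) (.reg x)))))
      (.cell ga (.plus (.cell 5 (.plus gi (.reg zr))) (.reg x))))
    (.fmul (.cell 11 (.plus (.plus (.cell 7 (.reg jr)) (.cell 5 (.reg zr))) (.reg x)))
      (.cell ha (.plus (.cell 5 (.plus hi (.reg yr))) (.reg x)))))

theorem add_lt_square {y k : ℕ} (hy : y < n) (hk : k < n) : y * n + k < n * n := by
  calc y * n + k < y * n + n := by omega
    _ = (y + 1) * n := by ring
    _ ≤ n * n := Nat.mul_le_mul_right _ hy

theorem halts_residual {x a jr yr zr ga ha i i' j y z : ℕ} {gi hi : Expr} {v : ℕ → F}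
    {g' h' : ℕ → ℕ → F} (hx : 12 ≤ x) (haa : 12 ≤ a) (hga : ga < a) (hha : ha < a)
    (hjr : jr < x) (hyr : yr < x) (hzr : zr < x) (hn : n ≤ B)
    (hs : Ready e n m R g h s) (hj : s.reg jr = j) (hjN : j < 2 * (n * n))
    (hy : s.reg yr = y) (hyn : y < n) (hz : s.reg zr = z) (hzn : z < n)
    (hgi : ∀ s', Agree x a s s' → gi.eval s' = i * n) (hiR : i ≤ m + R)
    (hhi : ∀ s', Agree x a s s' → hi.eval s' = i' * n) (hiR' : i' ≤ m + R)
    (hv : ∀ l < 2 * (n * n), s.arr 11 (j * (2 * (n * n)) + l) = e (v l))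
    (hg : ∀ y < n, ∀ z < n, s.arr ga ((i * n + y) * n + z) = e (g' y z))
    (hh : ∀ y < n, ∀ z < n, s.arr ha ((i' * n + y) * n + z) = e (h' y z))
    (hQ : ∀ s', Agree x a s s' → s'.reg (x + 1) = e (residual n g' h' y z v) → Q s') :
    Halts B (residualProg x jr yr zr ga gi ha hi) s Q := by
  refine Halts.sum (a := a)
    (fun k => v (n * n + (y * n + k)) * g' z k + v (z * n + k) * h' y k) hn (by omega) hs.ops
    hs.zero (fun s' ag => (hs.agree hx (by omega) ag).n_eq) ?_ ?_
  · intro k s' hk ag r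
    have R' := hs.agree hx (by omega) ag
    have h1 := add_lt_square hyn hk
    have h2 := add_lt_square hzn hk
    refine R'.ops.eval_fadd (R'.ops.eval_fmul ?_ ?_) (R'.ops.eval_fmul ?_ ?_)
    · simp only [Expr.eval, ag.reg jr hjr, ag.reg yr hyr, hj, hy, r, R'.n_eq]
      rw [R'.vec j (by omega), R'.row_low y (by omega), R'.row_low n le_rfl, ag.arr 11 (by omega),
        hv _ (by omega)]
    · simp only [Expr.eval, hgi s' ag, ag.reg zr hzr, hz, r]
      rw [R'.row_snd i hiR z hzn, ag.arr ga hga, hg z hzn k hk]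
    · simp only [Expr.eval, ag.reg jr hjr, ag.reg zr hzr, hj, hz, r]
      rw [R'.vec j (by omega), R'.row_low z (by omega), ag.arr 11 (by omega), add_assoc,
        hv _ (by omega)]
    · simp only [Expr.eval, hhi s' ag, ag.reg yr hyr, hy, r]
      rw [R'.row_snd i' hiR' y hyn, ag.arr ha hha, hh y hyn k hk]
  · intro s' ag r
    exact hQ s' ag (by rw [r, residual_apply])

/-! ### Elimination -/

/-- Restrict the span of the vectors in the array `11` to the kernel of the residual at row `y` and
column `z` for the `i`-th pair of matrices in the arrays `9` and `10`, where `i`, `y` and `z` stand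
in the registers `14`, `15` and `16`. The values of the residual go to the array `12`, the pivot
to register `18`, its index to register `19`, and the pivot vector to the array `13`. -/
def eliminate : Prog :=
  .seq (.assign 18 (.reg 4)) (.seq
    (.for 17 (.reg 6)
      (.seq (residualProg 20 17 15 16 9 (.cell 5 (.reg 14)) 10 (.cell 5 (.reg 14)))
      (.seq (.store 12 (.reg 17) (.reg 21))
        (.cond (.ne (.reg 21) (.reg 4))
          (.seq (.assign 18 (.reg 21)) (.assign 19 (.reg 17))) .skip))))
    (.cond (.ne (.reg 18) (.reg 4))
      (.seq
        (.for 20 (.reg 6) (.store 13 (.reg 20) (.cell 11 (.plus (.cell 7 (.reg 19)) (.reg 20)))))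
        (.for 20 (.reg 6) (.for 21 (.reg 6)
          (.store 11 (.plus (.cell 7 (.reg 20)) (.reg 21))
            (.fadd (.fmul (.reg 18) (.cell 11 (.plus (.cell 7 (.reg 20)) (.reg 21))))
              (.fmul (.reg 5) (.fmul (.cell 12 (.reg 20)) (.cell 13 (.reg 21)))))))))
      .skip))

theorem HoldsVecs.agree {F : Type} {e : F ≃ Fin q} {N r a : ℕ} {V : ℕ → ℕ → F} {s' : State}
    (hs : HoldsVecs e N V s)
    (ha : 12 ≤ a) (hag : Agree r a s s') : HoldsVecs e N V s' := by
  unfold HoldsVecs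
  rw [hag.arr 11 (by omega)]
  exact hs

theorem halts_update {N p : ℕ} {V : ℕ → ℕ → F} {l : (ℕ → F) →ₗ[F] F} (hN : 2 * (n * n) = N)
    (hNB : N ≤ B) (hs : Ready e n m R g h s) (hV : HoldsVecs e N V s) (hp : p < N)
    (h12 : ∀ j < N, s.arr 12 j = e (l (V j))) (h13 : ∀ j < N, s.arr 13 j = e (V p j))
    (h18 : s.reg 18 = e (l (V p)))
    (hQ : ∀ s', HoldsVecs e N (fun j => l (V p) • V j - l (V j) • V p) s' → Q s') :
    Halts B (.for 20 (.reg 6) (.for 21 (.reg 6)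
          (.store 11 (.plus (.cell 7 (.reg 20)) (.reg 21))
            (.fadd (.fmul (.reg 18) (.cell 11 (.plus (.cell 7 (.reg 20)) (.reg 21))))
              (.fmul (.reg 5) (.fmul (.cell 12 (.reg 20)) (.cell 13 (.reg 21)))))))) s Q := by
  subst hN
  set N := 2 * (n * n) with hNdef
  set tgt : ℕ → ℕ := fun y =>
    e (l (V p) * V (y / N) (y % N) + -1 * (l (V (y / N)) * V p (y % N))) with htgt
  have hdiv : ∀ j k, k < N → (j * N + k) / N = j ∧ (j * N + k) % N = k := fun j k hk =>
    ⟨by rw [mul_comm, Nat.mul_add_div (by omega), Nat.div_eq_of_lt hk, add_zero],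
      Nat.mul_add_mod_of_lt hk⟩
  -- The vectors are overwritten one entry after the other; each entry is read just before.
  let I : ℕ → State → Prop := fun i s' => (∀ b, b ≠ 11 → s'.arr b = s.arr b) ∧
    (∀ y < i, s'.arr 11 y = tgt y) ∧ ∀ y, i ≤ y → s'.arr 11 y = s.arr 11 y
  have hN6 : ∀ {r s'}, 12 ≤ r → Agree r 11 s s' → Expr.eval s' (.reg 6) = N := fun hr ag =>
    (ag.reg 6 (by omega)).trans hs.N_eq
  refine Halts.for (a := 11) (N := N) (fun i => I (i * N)) (by decide) hNB
    (fun s' h' => hN6 (by omega) h') (fun i s' v h => h) ?_ ?_ ?_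
  · exact ⟨fun b _ => rfl, fun y hy => by omega, fun y _ => rfl⟩
  · intro j s1 hj ag1 r1 I1
    refine Halts.for (a := 11) (N := N) (fun k => I (j * N + k)) (by decide) hNB
      (fun s' h' => hN6 (r := 20) (by omega) (ag1.trans (h'.mono (by omega) le_rfl)))
      (fun i s' v h => h) I1 ?_ ?_
    · rintro k s2 hk ag2 r2 ⟨I2, I3, I4⟩
      have ag : Agree 20 11 s s2 := ag1.trans (ag2.mono (by omega) le_rfl)
      have R2 := hs.agree (by omega) (by omega) ag
      have r20 : s2.reg 20 = j := (ag2.reg 20 (by omega)).trans r1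
      obtain ⟨hd, hm⟩ := hdiv j k hk
      have hidx : Expr.eval s2 (.plus (.cell 7 (.reg 20)) (.reg 21)) = j * N + k := by
        simp only [Expr.eval, r20, r2]
        rw [R2.vec j hj.le]
      have hval : Expr.eval s2
          (.fadd (.fmul (.reg 18) (.cell 11 (.plus (.cell 7 (.reg 20)) (.reg 21))))
            (.fmul (.reg 5) (.fmul (.cell 12 (.reg 20)) (.cell 13 (.reg 21))))) =
          tgt (j * N + k) := by
        simp only [htgt, hd, hm]
        refine R2.ops.eval_fadd (R2.ops.eval_fmul ?_ ?_) (R2.ops.eval_fmul R2.neg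
          (R2.ops.eval_fmul ?_ ?_))
        · exact (ag.reg 18 (by omega)).trans h18
        · rw [Expr.eval, hidx, I4 _ le_rfl, hV j hj k hk]
        · simp only [Expr.eval, r20]
          rw [I2 12 (by omega), h12 j hj]
        · simp only [Expr.eval, r2]
          rw [I2 13 (by omega), h13 k hk]
      refine Halts.store ?_
      rw [hidx, hval]
      refine ⟨fun b hb => (State.arr_setCell_ne _ _ _ hb).trans (I2 b hb), fun y hy => ?_,
        fun y hy => ?_⟩
      · rw [State.arr_setCell_self]
        rcases Nat.lt_or_ge y (j * N + k) with h' | h'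
        · rw [Function.update_of_ne (by omega), I3 y h']
        · obtain rfl : y = j * N + k := by omega
          rw [Function.update_self]
      · rw [State.arr_setCell_self, Function.update_of_ne (by omega), I4 y (by omega)]
    · rintro s' - h'
      rw [add_mul, one_mul]
      exact h'
  · rintro s' - ⟨-, h2, -⟩
    refine hQ s' fun j hj k hk => ?_
    obtain ⟨hd, hm⟩ := hdiv j k hk
    have hlt : j * N + k < N * N := add_lt_square hj hk
    rw [h2 _ hlt]
    simp only [htgt, hd, hm]
    congr 2
    simp
    ring

theorem halts_eliminate {V : ℕ → ℕ → F} {g' h' : ℕ → ℕ → ℕ → F} {i y z N : ℕ}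
    (hN : 2 * (n * n) = N) (hNB : N ≤ B) (hn : n ≤ B) (hs : Ready e n m R g h s)
    (hg : HoldsTuple e n 9 R g' s) (hh : HoldsTuple e n 10 R h' s)
    (hi : s.reg 14 = i) (hiR : i < R) (hy : s.reg 15 = y) (hyn : y < n) (hz : s.reg 16 = z)
    (hzn : z < n) (hV : HoldsVecs e N V s) :
    Halts B eliminate s fun s' => ∃ V', HoldsVecs e N V' s' ∧
      ∀ x, x ∈ spanBelow N V' ↔ x ∈ spanBelow N V ∧ residual n (g' i) (h' i) y z x = 0 := by
  set l := residual n (g' i) (h' i) y z with hl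
  have h0 : Agree 17 12 s (s.setReg 18 (Expr.eval s (.reg 4))) := agree_setReg _ _ (by omega)
  refine Halts.seq (Halts.assign (Halts.seq ?_))
  refine Halts.for (a := 12) (N := N) (fun j s' => (∀ k < j, s'.arr 12 k = e (l (V k))) ∧
    (s'.reg 18 = e 0 ∧ (∀ k < j, l (V k) = 0) ∨
      s'.reg 19 < N ∧ s'.reg 18 = e (l (V (s'.reg 19))) ∧ l (V (s'.reg 19)) ≠ 0))
    (by decide) hNB ?_ ?_ ?_ ?_ ?_
  · intro s' ag
    exact ((h0.trans ag).reg 6 (by omega)).trans (hs.N_eq.trans hN)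
  · intro j s' v h'
    rwa [State.reg_setReg_ne _ _ (by omega), State.reg_setReg_ne _ _ (by omega)]
  · exact ⟨by omega, Or.inl ⟨by simp [Expr.eval, hs.zero], by omega⟩⟩
  · rintro j s1 hj ag1 r1 ⟨I1, I2⟩
    replace ag1 := h0.trans ag1
    have R1 := hs.agree (by omega) (by omega) ag1
    have V1 := hV.agree (by omega) ag1
    refine Halts.seq (halts_residual (a := 13) (i := i) (i' := i) (v := V j) (g' := g' i)
      (h' := h' i) (by omega) (by omega) (by omega) (by omega) (by omega) (by omega) (by omega)
      hn R1 r1 (by omega) ((ag1.reg 15 (by omega)).trans hy) hyn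
      ((ag1.reg 16 (by omega)).trans hz) hzn ?_ (by omega) ?_ (by omega) ?_
      (hg.agree (by omega) ag1 i hiR) (hh.agree (by omega) ag1 i hiR) ?_)
    · intro s' ag
      simp only [Expr.eval, ag.reg 14 (by omega), ag1.reg 14 (by omega), hi]
      rw [(R1.agree (by omega) (by omega) ag).row_fst i (by omega)]
    · intro s' ag
      simp only [Expr.eval, ag.reg 14 (by omega), ag1.reg 14 (by omega), hi]
      rw [(R1.agree (by omega) (by omega) ag).row_fst i (by omega)]
    · rw [hN]
      exact V1 j hj
    · intro s2 ag2 r2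
      have r17 : s2.reg 17 = j := (ag2.reg 17 (by omega)).trans r1
      have z2 : s2.reg 4 = e 0 := (R1.agree (by omega) (by omega) ag2).zero
      have hval : ∀ k < j + 1, Function.update (s2.arr 12) j (e (l (V j))) k = e (l (V k)) := by
        intro k hk
        rcases Nat.lt_or_ge k j with h' | h'
        · rw [Function.update_of_ne (by omega), ag2.arr 12 (by omega), I1 k h']
        · obtain rfl : k = j := by omega
          rw [Function.update_self]
      refine Halts.seq (Halts.store ?_)
      simp only [Expr.eval]
      rw [r17, show s2.reg 21 = e (l (V j)) from r2]
      refine Halts.cond (fun hne => Halts.seq (Halts.assign (Halts.assign ⟨?_, Or.inr ?_⟩)))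
        (fun heq => Halts.skip ⟨?_, ?_⟩)
      · simpa using hval
      · have hne' : l (V j) ≠ 0 := fun h' => hne <| Expr.eval_ne_eq_zero.2 <| by
          simp only [Expr.eval, State.reg_setCell, z2]
          rw [show s2.reg 21 = e (l (V j)) from r2, h']
        simp only [Expr.eval, State.reg_setReg_self, State.reg_setCell]
        rw [State.reg_setReg_ne _ _ (by omega), State.reg_setReg_ne _ _ (by omega),
          State.reg_setReg_self, State.reg_setCell, r17]
        exact ⟨hj, r2, hne'⟩
      · simpa using hval
      · have heq' : l (V j) = 0 := by
          have h' := Expr.eval_ne_eq_zero.1 heq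
          simp only [Expr.eval, State.reg_setCell, z2] at h'
          rw [show s2.reg 21 = e (l (V j)) from r2] at h'
          exact label_inj.1 h'
        simp only [State.reg_setCell]
        rw [ag2.reg 18 (by omega), ag2.reg 19 (by omega)]
        refine I2.imp_left fun h' => ⟨h'.1, fun k hk => ?_⟩
        rcases Nat.lt_or_ge k j with h'' | h''
        · exact h'.2 k h''
        · obtain rfl : k = j := by omega
          exact heq'
  · rintro s1 ag1 ⟨I1, I2⟩
    replace ag1 := h0.trans ag1
    have R1 := hs.agree (by omega) (by omega) ag1
    have V1 := hV.agree (by omega) ag1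
    refine Halts.cond (fun hne => ?_) (fun heq => Halts.skip ⟨V, V1, ?_⟩)
    · replace hne : s1.reg 18 ≠ e 0 := fun h' => hne <| Expr.eval_ne_eq_zero.2 <| by
        simp only [Expr.eval, R1.zero, h']
      obtain ⟨hp, h18, hp0⟩ := I2.resolve_left fun h' => hne h'.1
      set p := s1.reg 19 with hpdef
      refine Halts.seq (Halts.for (a := 13) (N := N) (fun j s' => ∀ k < j, s'.arr 13 k = e (V p k))
        (by decide) hNB (fun s' ag => (ag.reg 6 (by omega)).trans (R1.N_eq.trans hN))
        (fun i s' v h => h) (by simp) ?_ ?_)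
      · intro j s2 hj ag2 r2 I3
        refine Halts.store fun k hk => ?_
        have R2 := R1.agree (by omega) (by omega) ag2
        simp only [State.arr_setCell_self, Expr.eval, r2]
        rcases Nat.lt_or_ge k j with h' | h'
        · rw [Function.update_of_ne (by omega), I3 k h']
        · obtain rfl : k = j := by omega
          rw [Function.update_self, ag2.reg 19 (by omega), R2.vec _ (by omega), hN,
            V1.agree (by omega) ag2 p hp k hj]
      · intro s2 ag2 I3
        refine halts_update (l := l) hN hNB (R1.agree (by omega) (by omega) ag2)
          (V1.agree (by omega) ag2) hp ?_ I3 ((ag2.reg 18 (by omega)).trans h18) ?_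
        · rw [ag2.arr 12 (by omega)]
          exact I1
        · exact fun s' hs' => ⟨_, hs', mem_spanBelow_eliminate hp hp0 fun j _ => rfl⟩
    · have heq' : s1.reg 18 = e 0 := by
        have h' := Expr.eval_ne_eq_zero.1 heq
        simpa only [Expr.eval, R1.zero] using h'
      refine mem_spanBelow_of_forall (I2.elim (fun h' => h'.2) fun h' => ?_)
      exact absurd (label_inj.1 (h'.2.1.symm.trans heq')) h'.2.2

/-- The elimination of all equations for the `R` pairs of matrices. -/
def solve (R : ℕ) : Prog :=
  .for 14 (.lit R) (.for 15 (.reg 1) (.for 16 (.reg 1) eliminate))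

theorem halts_solve {V : ℕ → ℕ → F} {g' h' : ℕ → ℕ → ℕ → F} {N : ℕ}
    (hN : 2 * (n * n) = N) (hNB : N ≤ B) (hn : n ≤ B) (hR : R ≤ B) (hs : Ready e n m R g h s)
    (hg : HoldsTuple e n 9 R g' s) (hh : HoldsTuple e n 10 R h' s) (hV : HoldsVecs e N V s) :
    Halts B (solve R) s fun s' => ∃ V', HoldsVecs e N V' s' ∧ ∀ x, x ∈ spanBelow N V' ↔
      x ∈ spanBelow N V ∧ ∀ i < R, ∀ y < n, ∀ z < n, residual n (g' i) (h' i) y z x = 0 := by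
  refine Halts.for (a := 11) (N := R) (fun i s' => ∃ V', HoldsVecs e N V' s' ∧
      ∀ x, x ∈ spanBelow N V' ↔ x ∈ spanBelow N V ∧
        ∀ i' < i, ∀ y < n, ∀ z < n, residual n (g' i') (h' i') y z x = 0)
    (by decide) hR (fun s' _ => rfl) (fun i s' v h => h) ⟨V, hV, by simp⟩ ?_ (fun s' _ h => h)
  rintro i s1 hi ag1 r1 ⟨V1, hV1, hx1⟩
  have R1 := hs.agree (by omega) (by omega) ag1
  refine Halts.for (a := 11) (N := n) (fun y s' => ∃ V', HoldsVecs e N V' s' ∧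
      ∀ x, x ∈ spanBelow N V' ↔ x ∈ spanBelow N V1 ∧
        ∀ y' < y, ∀ z < n, residual n (g' i) (h' i) y' z x = 0)
    (by decide) hn (fun s' ag => (R1.agree (by omega) (by omega) ag).n_eq) (fun i s' v h => h)
    ⟨V1, hV1, by simp⟩ ?_ ?_
  · rintro y s2 hy ag2 r2 ⟨V2, hV2, hx2⟩
    have R2 := R1.agree (by omega) (by omega) ag2
    refine Halts.for (a := 11) (N := n) (fun z s' => ∃ V', HoldsVecs e N V' s' ∧
        ∀ x, x ∈ spanBelow N V' ↔ x ∈ spanBelow N V2 ∧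
          ∀ z' < z, residual n (g' i) (h' i) y z' x = 0)
      (by decide) hn (fun s' ag => (R2.agree (by omega) (by omega) ag).n_eq) (fun i s' v h => h)
      ⟨V2, hV2, by simp⟩ ?_ ?_
    · rintro z s3 hz ag3 r3 ⟨V3, hV3, hx3⟩
      have R3 := R2.agree (by omega) (by omega) ag3
      refine (halts_eliminate hN hNB hn R3
        (((hg.agree (by omega) ag1).agree (by omega) ag2).agree (by omega) ag3)
        (((hh.agree (by omega) ag1).agree (by omega) ag2).agree (by omega) ag3)
        ((ag3.reg 14 (by omega)).trans ((ag2.reg 14 (by omega)).trans r1)) hi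
        ((ag3.reg 15 (by omega)).trans r2) hy r3 hz hV3).imp ?_
      rintro s4 ⟨V4, hV4, hx4⟩
      refine ⟨V4, hV4, fun x => ?_⟩
      rw [hx4, hx3, Nat.forall_lt_succ_right, and_assoc]
    · rintro s' - ⟨V3, hV3, hx3⟩
      refine ⟨V3, hV3, fun x => ?_⟩
      rw [hx3, hx2, Nat.forall_lt_succ_right, and_assoc]
  · rintro s' - ⟨V3, hV3, hx3⟩
    refine ⟨V3, hV3, fun x => ?_⟩
    rw [hx3, hx1, Nat.forall_lt_succ_right, and_assoc]

end AltSpace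

namespace AltSpace

open RAM

variable {B : ℕ} {s : State} {Q : State → Prop}
variable {F : Type} [Field F] {q : ℕ} {e : F ≃ Fin q}
variable {n m R : ℕ} {g h : ℕ → ℕ → ℕ → F}

/-! ### The initial vectors -/

/-- The label of a nonzero field element. -/
def unitExpr : Expr := .minus (.lit 1) (.reg 4)

theorem exists_unitExpr_eval (hq : 1 < q) (hs : s.reg 4 = e 0) :
    ∃ u : F, u ≠ 0 ∧ unitExpr.eval s = e u := by
  have h1 : 1 - (e 0 : ℕ) < q := by omega
  refine ⟨e.symm ⟨1 - e 0, h1⟩, fun h' => ?_, by simp [unitExpr, Expr.eval, hs]⟩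
  have h2 : (⟨1 - e 0, h1⟩ : Fin q) = e 0 := (Equiv.symm_apply_eq e).1 h'
  have h3 := congrArg Fin.val h2
  simp only at h3
  omega

/-- Vectors that span the space of all vectors whose first `n` entries are proportional to `v`.
The first `n` of them are equal. -/
def initVec (n : ℕ) (u : F) (v : ℕ → F) (j : ℕ) : ℕ → F := fun l =>
  if j < n ∧ l < n then v l else if j = l then u else 0

/-- Fill the array `11` with the initial vectors, where `v` starts at position `2 * R * m` of the
array `8`. -/
def initVecs (R : ℕ) : Prog :=
  .for 20 (.reg 6) (.for 21 (.reg 6) (.seq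
    (.cond (.ne (.reg 20) (.reg 21)) (.assign 22 (.reg 4)) (.assign 22 unitExpr)) (.seq
    (.cond (.minus (.reg 1) (.reg 20)) (.cond (.minus (.reg 1) (.reg 21))
      (.assign 22 (.cell 8 (.plus (.cell 6 (.lit (2 * R))) (.reg 21)))) .skip) .skip)
    (.store 11 (.plus (.cell 7 (.reg 20)) (.reg 21)) (.reg 22)))))

theorem halts_initVecs {N : ℕ} {v : ℕ → F} (hq : 1 < q) (hN : 2 * (n * n) = N) (hNB : N ≤ B)
    (hs : Ready e n m R g h s) (hv : ∀ l < n, s.arr 8 (2 * R * m + l) = e (v l))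
    (hQ : ∀ s' u, u ≠ 0 → HoldsVecs e N (initVec n u v) s' → Q s') :
    Halts B (initVecs R) s Q := by
  subst hN
  obtain ⟨u, hu0, hu⟩ := exists_unitExpr_eval hq hs.zero
  set N := 2 * (n * n) with hNdef
  set tgt : ℕ → ℕ := fun y => e (initVec n u v (y / N) (y % N)) with htgt
  have hdiv : ∀ j k, k < N → (j * N + k) / N = j ∧ (j * N + k) % N = k := fun j k hk =>
    ⟨by rw [mul_comm, Nat.mul_add_div (by omega), Nat.div_eq_of_lt hk, add_zero],
      Nat.mul_add_mod_of_lt hk⟩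
  refine Halts.for (a := 11) (N := N) (fun i s' => ∀ y < i * N, s'.arr 11 y = tgt y)
    (by simp [Prog.for, Prog.writesAbove]) hNB (fun s' ag => ?_) (fun i s' v h => h) (by simp) ?_ ?_
  · exact (ag.reg 6 (by omega)).trans hs.N_eq
  · intro j s1 hj ag1 r1 I1
    have R1 := hs.agree (by omega) (by omega) ag1
    refine Halts.for (a := 11) (N := N) (fun k s' => ∀ y < j * N + k, s'.arr 11 y = tgt y)
      (by simp [Prog.writesAbove]) hNB (fun s' ag => ?_) (fun i s' v h => h) (by simpa using I1)
      ?_ ?_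
    · exact (R1.agree (by omega) (by omega) ag).N_eq
    · intro k s2 hk ag2 r2 I2
      have R2 := R1.agree (by omega) (by omega) ag2
      have r20 : s2.reg 20 = j := (ag2.reg 20 (by omega)).trans r1
      obtain ⟨hd, hm⟩ := hdiv j k hk
      have hstore : ∀ s3 : State, Agree 22 16 s2 s3 → s3.reg 22 = e (initVec n u v j k) →
          Halts B (.store 11 (.plus (.cell 7 (.reg 20)) (.reg 21)) (.reg 22)) s3
            fun s' => ∀ y < j * N + (k + 1), s'.arr 11 y = tgt y := by
        intro s3 ag3 r3
        have R3 := R2.agree (by omega) (by omega) ag3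
        refine Halts.store fun y hy => ?_
        simp only [State.arr_setCell_self, Expr.eval, r3, ag3.reg 20 (by omega),
          ag3.reg 21 (by omega), r20, r2]
        rw [R3.vec j hj.le, ← hNdef]
        rcases Nat.lt_or_ge y (j * N + k) with h' | h'
        · rw [Function.update_of_ne (by omega), ag3.arr 11 (by omega), I2 y h']
        · obtain rfl : y = j * N + k := by omega
          rw [Function.update_self]
          simp only [htgt, hd, hm]
      refine Halts.seq (Halts.imp (Q := fun s3 => Agree 22 16 s2 s3 ∧
        s3.reg 22 = e (if j = k then u else 0)) ?_ ?_)
      · refine Halts.cond (fun hne => Halts.assign ⟨agree_setReg _ _ le_rfl, ?_⟩)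
          (fun heq => Halts.assign ⟨agree_setReg _ _ le_rfl, ?_⟩)
        · have : j ≠ k := fun h' => hne (Expr.eval_ne_eq_zero.2 (by simp [Expr.eval, r20, r2, h']))
          simp [Expr.eval, R2.zero, this]
        · have h' : j = k := by simpa [Expr.eval, r20, r2] using Expr.eval_ne_eq_zero.1 heq
          rw [State.reg_setReg_self, if_pos h', ← hu]
          simp only [unitExpr, Expr.eval, R2.zero, hs.zero]
      · rintro s3 ⟨ag3, r3⟩
        have R3 := R2.agree (by omega) (by omega) ag3
        have e1 : Expr.eval s3 (.minus (.reg 1) (.reg 20)) = n - j := by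
          simp only [Expr.eval, R3.n_eq, ag3.reg 20 (by omega), r20]
        have e2 : Expr.eval s3 (.minus (.reg 1) (.reg 21)) = n - k := by
          simp only [Expr.eval, R3.n_eq, ag3.reg 21 (by omega), r2]
        refine Halts.seq (Halts.cond (fun h1 => Halts.cond (fun h2 => Halts.assign ?_)
          fun h2 => Halts.skip ?_) fun h1 => Halts.skip ?_)
        · refine hstore _ (ag3.trans (agree_setReg _ _ le_rfl)) ?_
          rw [State.reg_setReg_self, initVec, if_pos (c := j < n ∧ k < n) (by omega)]
          simp only [Expr.eval, ag3.reg 21 (by omega), r2]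
          rw [R3.digit _ le_rfl, ag3.arr 8 (by omega), ag2.arr 8 (by omega), ag1.arr 8 (by omega),
            hv k (by omega)]
        · exact hstore _ ag3 (by rw [r3, initVec, if_neg (c := j < n ∧ k < n) (by omega)])
        · exact hstore _ ag3 (by rw [r3, initVec, if_neg (c := j < n ∧ k < n) (by omega)])
    · intro s' _ h'
      rwa [add_mul, one_mul]
  · intro s' _ h'
    refine hQ s' u hu0 fun j hj k hk => ?_
    obtain ⟨hd, hm⟩ := hdiv j k hk
    rw [h' _ (add_lt_square hj hk)]
    simp only [htgt, hd, hm]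

/-! ### The final test of a solution -/

/-- The field element with a given label. -/
noncomputable def decode (e : F ≃ Fin q) (x : ℕ) : F :=
  if hx : x < q then e.symm ⟨x, hx⟩ else 0

theorem label_decode {x : ℕ} (hx : x < q) : (e (decode e x) : ℕ) = x := by
  simp [decode, hx]

theorem decode_label (x : F) : decode e (e x : ℕ) = x := by
  simp [decode]

/-- For the matrices `X = Aᵀ` and `Y = Dᵀ` encoded in the vector `w`: the product `A * D` is the
scalar matrix `μ`. -/
def IsInversePair (n : ℕ) (μ : F) (w : ℕ → F) : Prop :=
  ∀ y < n, ∀ z < n, ∑ k ∈ Finset.range n, w (n * n + (k * n + y)) * w (z * n + k) =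
    if y = z then μ else 0

/-- For the matrices `X` and `Y` encoded in the vector `w`: the matrix `X * gᵀ` is of the form
`- h' * Yᵀ` with a linear combination `h'` of `h 0, …, h (m - 1)`. -/
def MapsInto (n m : ℕ) (g : ℕ → ℕ → F) (h : ℕ → ℕ → ℕ → F) (w : ℕ → F) : Prop :=
  ∃ c : ℕ → F, ∀ y < n, ∀ z < n,
    residual n g (fun y z => ∑ j ∈ Finset.range m, c j * h j y z) y z w = 0

/-- Clear the flag in register `18` unless the vector whose index stands in register `14` is an
inverse pair for the scalar in cell `0` of the array `14`. -/
def checkInverse : Prog :=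
  .for 16 (.reg 1) (.for 17 (.reg 1) (.seq
    (.sum 19 (.reg 1) (.fmul
      (.cell 11 (.plus (.cell 7 (.reg 14)) (.plus (.cell 5 (.reg 1))
        (.plus (.cell 5 (.reg 19)) (.reg 16)))))
      (.cell 11 (.plus (.plus (.cell 7 (.reg 14)) (.cell 5 (.reg 17))) (.reg 19)))))
    (.cond (.ne (.reg 16) (.reg 17))
      (.cond (.ne (.reg 20) (.reg 4)) (.assign 18 (.lit 0)) .skip)
      (.cond (.ne (.reg 20) (.cell 14 (.lit 0)))
        (.assign 18 (.lit 0)) .skip))))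

/-- A conditional that clears the flag in register `f` if the value of `E` is not `0`. -/
theorem halts_clear {f : ℕ} {E : Expr} {p : Prop} (hE : E.eval s = 0 ↔ p)
    (hQ : ∀ s', s'.arr = s.arr → (∀ x, x ≠ f → s'.reg x = s.reg x) →
      (s'.reg f ≠ 0 ↔ s.reg f ≠ 0 ∧ p) → Q s') :
    Halts B (.cond E (.assign f (.lit 0)) .skip) s Q := by
  refine Halts.cond (fun h1 => Halts.assign (hQ _ rfl (fun x hx => State.reg_setReg_ne _ _ hx) ?_))
    fun h1 => Halts.skip (hQ _ rfl (fun _ _ => rfl) ?_)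
  · simp [Expr.eval, ← hE, h1]
  · simp [← hE, h1]

theorem halts_checkInverse {N j : ℕ} {μ : F} {V : ℕ → ℕ → F} (hN : 2 * (n * n) = N)
    (hn : n ≤ B) (hs : Ready e n m R g h s) (hμ : s.arr 14 0 = e μ)
    (hV : HoldsVecs e N V s) (hj : s.reg 14 = j) (hjN : j < N)
    (hQ : ∀ s', Agree 16 16 s s' →
      (s'.reg 18 ≠ 0 ↔ s.reg 18 ≠ 0 ∧ IsInversePair n μ (V j)) → Q s') :
    Halts B checkInverse s Q := by
  subst hN
  refine Halts.for (a := 16) (N := n) (fun y s' => s'.reg 18 ≠ 0 ↔ s.reg 18 ≠ 0 ∧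
    ∀ y' < y, ∀ z < n, ∑ k ∈ Finset.range n, V j (n * n + (k * n + y')) * V j (z * n + k) =
      if y' = z then μ else 0) (by simp [Prog.for, Prog.sum, Prog.writesAbove]) hn
    (fun s' ag => (hs.agree (by omega) (by omega) ag).n_eq)
    (fun i s' v h => by rwa [State.reg_setReg_ne _ _ (by omega)]) (by simp) ?_ hQ
  intro y s1 hy ag1 r1 I1
  have R1 := hs.agree (by omega) (by omega) ag1
  refine Halts.for (a := 16) (N := n) (fun z s' => s'.reg 18 ≠ 0 ↔ s1.reg 18 ≠ 0 ∧
    ∀ z' < z, ∑ k ∈ Finset.range n, V j (n * n + (k * n + y)) * V j (z' * n + k) =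
      if y = z' then μ else 0) (by simp [Prog.for, Prog.sum, Prog.writesAbove]) hn
    (fun s' ag => (R1.agree (by omega) (by omega) ag).n_eq)
    (fun i s' v h => by rwa [State.reg_setReg_ne _ _ (by omega)]) (by simp) ?_ ?_
  · intro z s2 hz ag2 r2 I2
    have R2 := R1.agree (by omega) (by omega) ag2
    have ag02 : Agree 16 16 s s2 := ag1.trans (ag2.mono (by omega) le_rfl)
    have V2 := hV.agree (by omega) ag02
    have r14 : s2.reg 14 = j := (ag02.reg 14 (by omega)).trans hj
    have r16 : s2.reg 16 = y := (ag2.reg 16 (by omega)).trans r1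
    refine Halts.seq (Halts.sum (a := 16)
      (fun k => V j (n * n + (k * n + y)) * V j (z * n + k)) hn (by omega) R2.ops R2.zero
      (fun s' ag => (R2.agree (by omega) (by omega) ag).n_eq) ?_ ?_)
    · intro k s3 hk ag3 r3
      have R3 := R2.agree (by omega) (by omega) ag3
      have h1 := add_lt_square hk hy
      have h2 := add_lt_square hz hk
      have V3 := V2.agree (by omega) ag3 j hjN
      refine R3.ops.eval_fmul ?_ ?_
      · simp only [Expr.eval, ag3.reg 14 (by omega), ag3.reg 16 (by omega), r14, r16, r3, R3.n_eq]
        rw [R3.vec j hjN.le, R3.row_low n le_rfl, R3.row_low k hk.le, V3 _ (by omega)]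
      · simp only [Expr.eval, ag3.reg 14 (by omega), ag3.reg 17 (by omega), r14, r2, r3]
        rw [R3.vec j hjN.le, R3.row_low z hz.le, add_assoc, V3 _ (by omega)]
    · intro s3 ag3 r3
      have R3 := R2.agree (by omega) (by omega) ag3
      have r16' : s3.reg 16 = y := (ag3.reg 16 (by omega)).trans r16
      have r17' : s3.reg 17 = z := (ag3.reg 17 (by omega)).trans r2
      have r18' : s3.reg 18 = s2.reg 18 := ag3.reg 18 (by omega)
      refine Halts.cond (fun hne => ?_) fun heq => ?_
      · have hyz : y ≠ z := fun h' => hne <| Expr.eval_ne_eq_zero.2 <| by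
          simp only [Expr.eval, r16', r17', h']
        refine halts_clear (p := ∑ k ∈ Finset.range n, V j (n * n + (k * n + y)) *
          V j (z * n + k) = if y = z then μ else 0) (Expr.eval_ne_eq_zero.trans ?_)
          fun s' _ _ h' => ?_
        · rw [if_neg hyz]
          simp only [Expr.eval, R3.zero, r3]
          exact label_inj
        · rw [h', r18', I2, Nat.forall_lt_succ_right, and_assoc]
      · have hyz : y = z := by
          have h' := Expr.eval_ne_eq_zero.1 heq
          simpa only [Expr.eval, r16', r17'] using h'
        refine halts_clear (p := ∑ k ∈ Finset.range n, V j (n * n + (k * n + y)) *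
          V j (z * n + k) = if y = z then μ else 0) (Expr.eval_ne_eq_zero.trans ?_)
          fun s' _ _ h' => ?_
        · rw [if_pos hyz]
          simp only [Expr.eval, r3]
          rw [ag3.arr 14 (by omega), ag02.arr 14 (by omega), hμ]
          exact label_inj
        · rw [h', r18', I2, Nat.forall_lt_succ_right, and_assoc]
  · intro s' _ h'
    rw [h', I1, Nat.forall_lt_succ_right, and_assoc]

/-- Clear the flag in register `18` if the vector with index in register `14` does not map some
matrix of the array `2` into the span of the matrices of the array `3`. The coefficients of the
linear combinations are found by exhaustive search. -/
def checkSpan : Prog :=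
  .for 16 (.reg 2) (.seq (.assign 20 (.lit 0)) (.seq
    (.search 19 14 (.reg 0) (.reg 2) (.reg 10)
      (.seq (combine 21 14 3 15 (.lit 0) (.lit 1))
      (.seq (.assign 23 (.lit 1))
      (.seq (.for 21 (.reg 1) (.for 22 (.reg 1) (.seq
          (residualProg 24 14 21 22 2 (.cell 5 (.reg 16)) 15 (.lit 0))
          (.cond (.ne (.reg 25) (.reg 4)) (.assign 23 (.lit 0)) .skip))))
        (.cond (.reg 23) (.assign 20 (.lit 1)) .skip)))))
    (.cond (.minus (.lit 1) (.reg 20)) (.assign 18 (.lit 0)) .skip)))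

theorem halts_checkResidual {N j i : ℕ} {V : ℕ → ℕ → F} {h' : ℕ → ℕ → F} (hN : 2 * (n * n) = N)
    (hn : n ≤ B) (hs : Ready e n m R g h s) (hV : HoldsVecs e N V s) (hj : s.reg 14 = j)
    (hjN : j < N) (hi : s.reg 16 = i) (him : i < m) (hh : HoldsTuple e n 15 1 (fun _ => h') s)
    (hQ : ∀ s', Agree 21 16 s s' → (s'.reg 23 ≠ 0 ↔ s.reg 23 ≠ 0 ∧
      ∀ y < n, ∀ z < n, residual n (g i) h' y z (V j) = 0) → Q s') :
    Halts B (.for 21 (.reg 1) (.for 22 (.reg 1) (.seq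
          (residualProg 24 14 21 22 2 (.cell 5 (.reg 16)) 15 (.lit 0))
          (.cond (.ne (.reg 25) (.reg 4)) (.assign 23 (.lit 0)) .skip)))) s Q := by
  subst hN
  refine Halts.for (a := 16) (N := n) (fun y s' => s'.reg 23 ≠ 0 ↔ s.reg 23 ≠ 0 ∧
    ∀ y' < y, ∀ z < n, residual n (g i) h' y' z (V j) = 0) (by decide) hn
    (fun s' ag => (hs.agree (by omega) (by omega) ag).n_eq)
    (fun i s' v h => by rwa [State.reg_setReg_ne _ _ (by omega)]) (by simp) ?_ hQ
  intro y s1 hy ag1 r1 I1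
  have R1 := hs.agree (by omega) (by omega) ag1
  refine Halts.for (a := 16) (N := n) (fun z s' => s'.reg 23 ≠ 0 ↔ s1.reg 23 ≠ 0 ∧
    ∀ z' < z, residual n (g i) h' y z' (V j) = 0) (by decide) hn
    (fun s' ag => (R1.agree (by omega) (by omega) ag).n_eq)
    (fun i s' v h => by rwa [State.reg_setReg_ne _ _ (by omega)]) (by simp) ?_ ?_
  · intro z s2 hz ag2 r2 I2
    have R2 := R1.agree (by omega) (by omega) ag2
    have ag02 : Agree 21 16 s s2 := ag1.trans (ag2.mono (by omega) le_rfl)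
    refine Halts.seq (halts_residual (a := 16) (i := i) (i' := 0) (by omega) (by omega) (by omega)
      (by omega) (by omega) (by omega) (by omega) hn R2 ((ag02.reg 14 (by omega)).trans hj) hjN
      ((ag2.reg 21 (by omega)).trans r1) hy r2 hz ?_ (by omega) ?_ (by omega)
      (hV.agree (by omega) ag02 j hjN) (R2.fst i him)
      (hh.agree (by omega) ag02 0 (by omega)) ?_)
    · intro s' ag
      simp only [Expr.eval, ag.reg 16 (by omega), ag02.reg 16 (by omega), hi]
      rw [(R2.agree (by omega) (by omega) ag).row_fst i (by omega)]
    · intro s' ag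
      simp [Expr.eval]
    · intro s3 ag3 r3
      have R3 := R2.agree (by omega) (by omega) ag3
      refine halts_clear (p := residual n (g i) h' y z (V j) = 0)
        (Expr.eval_ne_eq_zero.trans ?_) fun s' _ _ h' => ?_
      · simp only [Expr.eval, R3.zero]
        rw [show s3.reg 25 = _ from r3]
        exact label_inj
      · rw [h', ag3.reg 23 (by omega), I2, Nat.forall_lt_succ_right, and_assoc]
  · intro s' _ h'
    rw [h', I1, Nat.forall_lt_succ_right, and_assoc]

theorem halts_checkSpan {N j : ℕ} {V : ℕ → ℕ → F} (hN : 2 * (n * n) = N)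
    (hn : n ≤ B) (hm : m ≤ B) (hB : 1 ≤ B) (hR : 1 ≤ R) (hqm : q ^ m ≤ B)
    (hs : Ready e n m R g h s) (hV : HoldsVecs e N V s) (hj : s.reg 14 = j) (hjN : j < N)
    (hQ : ∀ s', Agree 16 14 s s' →
      (s'.reg 18 ≠ 0 ↔ s.reg 18 ≠ 0 ∧ ∀ i < m, MapsInto n m (g i) h (V j)) → Q s') :
    Halts B checkSpan s Q := by
  have hq : 0 < q := (e 0).pos
  refine Halts.for (a := 14) (N := m) (fun i s' => s'.reg 18 ≠ 0 ↔ s.reg 18 ≠ 0 ∧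
    ∀ i' < i, MapsInto n m (g i') h (V j)) (by decide) hm
    (fun s' ag => (hs.agree (by omega) (by omega) ag).m_eq)
    (fun i s' v h => by rwa [State.reg_setReg_ne _ _ (by omega)]) (by simp) ?_ hQ
  intro i s1 hi ag1 r1 I1
  have h2 : Agree 19 14 s1 (s1.setReg 20 (Expr.eval s1 (.lit 0))) := agree_setReg _ _ (by omega)
  have R2 : Ready e n m R g h (s1.setReg 20 (Expr.eval s1 (.lit 0))) :=
    (hs.agree (by omega) (by omega) ag1).agree (by omega) (by omega) h2
  set S : (ℕ → ℕ) → Prop := fun δ => ∀ y < n, ∀ z < n, residual n (g i)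
    (fun y z => ∑ j ∈ Finset.range m, decode e (δ j) * h j y z) y z (V j) = 0 with hS
  refine Halts.seq (Halts.assign (Halts.seq (Halts.search (a := 14) (N := m) (W := q) S S
    (by omega) (by decide) hq hm hqm
    (fun s' ag => (R2.agree (by omega) (by omega) ag).q_eq)
    (fun s' ag => (R2.agree (by omega) (by omega) ag).m_eq)
    (fun s' ag => (R2.agree (by omega) (by omega) ag).qm_eq)
    (by simp [Expr.eval]) ?_ ?_)))
  · intro s3 ag3 hdig
    have R3 := R2.agree (by omega) (by omega) ag3
    have ag03 : Agree 16 14 s s3 := ag1.trans ((h2.trans ag3).mono (by omega) le_rfl)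
    have V3 := hV.agree (by omega) ag03
    refine Halts.seq (halts_combine (a := 15) (o := 0) (k := 1)
      (fun _ j => decode e (s3.arr 14 j)) h (by omega) (by omega) (by omega)
      (by omega) (by omega) hn hm hB hR (by omega) (fun s' _ => rfl) R3 ?_ R3.snd ?_)
    · intro i' hi' j' hj'
      obtain rfl : i' = 0 := by omega
      rw [label_decode]
      · simp
      · exact hdig _ hj'
    · intro s4 ag4 h4
      refine Halts.seq (Halts.assign ?_)
      set s5 := s4.setReg 23 (Expr.eval s4 (.lit 1)) with hs5
      have ag5 : Agree 21 15 s3 s5 := ag4.trans (agree_setReg _ _ (by omega))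
      have ag05 : Agree 16 14 s s5 := ag03.trans (ag5.mono (by omega) (by omega))
      refine Halts.seq (halts_checkResidual (i := i) (j := j)
        (h' := fun y z => ∑ j ∈ Finset.range m, decode e (s3.arr 14 j) * h j y z) hN hn
        (R3.agree (by omega) (by omega) ag5) (V3.agree (by omega) ag5)
        ((ag05.reg 14 (by omega)).trans hj) hjN
        ((ag5.reg 16 (by omega)).trans ((ag3.reg 16 (by omega)).trans
          ((h2.reg 16 (by omega)).trans r1))) hi ?_ ?_)
      · intro i' hi'
        obtain rfl : i' = 0 := by omega
        exact h4 0 (by omega)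
      · intro s6 ag6 h6
        have h20 : s6.reg 20 = s3.reg 20 :=
          (ag6.reg 20 (by omega)).trans (ag5.reg 20 (by omega))
        have h6' : s6.reg 23 ≠ 0 ↔ S (s3.arr 14) := by
          rw [h6, hs5, State.reg_setReg_self]
          simp [Expr.eval, hS]
        refine Halts.cond (fun h7 => Halts.assign ?_) fun h7 => Halts.skip ?_
        · simp only [Expr.eval, State.reg_setReg_self] at h7 ⊢
          exact ⟨by simp, fun _ => Or.inr (h6'.1 h7), by simp⟩
        · simp only [Expr.eval] at h7
          simp only [h20]
          exact ⟨id, Or.inl, fun h8 => absurd h7 (h6'.2 h8)⟩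
  · intro s3 ag3 h3 h4
    have h5 : s3.reg 20 ≠ 0 ↔ MapsInto n m (g i) h (V j) := by
      constructor
      · intro h'
        obtain ⟨δ, -, hδ⟩ := h3 h'
        exact ⟨_, hδ⟩
      · rintro ⟨c, hc⟩
        refine h4 (fun j => e (c j)) (fun _ _ => (e _).isLt) fun δ' hδ' y hy z hz => ?_
        rw [← hc y hy z hz]
        congr 1
        congr 1
        funext y z
        refine Finset.sum_congr rfl fun k hk => ?_
        rw [hδ' k (Finset.mem_range.1 hk), decode_label]
    refine halts_clear (p := MapsInto n m (g i) h (V j)) ?_ fun s' _ _ h' => ?_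
    · rw [← h5]
      simp only [Expr.eval]
      omega
    · rw [h', ag3.reg 18 (by omega), h2.reg 18 (by omega), I1, Nat.forall_lt_succ_right,
        and_assoc]

/-- The vector `w` certifies that the span of the `m` matrices `g i` is isometric to a subspace of
the span of the matrices `h i`. -/
def Certifies (n m : ℕ) (g h : ℕ → ℕ → ℕ → F) (w : ℕ → F) : Prop :=
  (∃ μ, μ ≠ 0 ∧ IsInversePair n μ w) ∧ ∀ i < m, MapsInto n m (g i) h w

theorem exists_isInversePair_iff (hn : 0 < n) {w : ℕ → F} :
    (∃ μ, μ ≠ 0 ∧ IsInversePair n μ w) ↔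
      ∑ k ∈ Finset.range n, w (n * n + (k * n)) * w k ≠ 0 ∧
      IsInversePair n (∑ k ∈ Finset.range n, w (n * n + (k * n)) * w k) w := by
  refine ⟨?_, fun h' => ⟨_, h'⟩⟩
  rintro ⟨μ, hμ, hw⟩
  have h1 := hw 0 hn 0 hn
  simp only [add_zero, zero_mul, zero_add, if_true] at h1
  rw [h1]
  exact ⟨hμ, hw⟩

/-- Raise the flag in register `15` if one of the vectors in the array `11` is a certificate. The
scalar `A * D` is read off from the entry in the upper left corner. -/
def testAll : Prog :=
  .seq (.assign 15 (.lit 0)) (.for 14 (.reg 6)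
    (.seq (.sum 16 (.reg 1) (.fmul
      (.cell 11 (.plus (.cell 7 (.reg 14)) (.plus (.cell 5 (.reg 1)) (.cell 5 (.reg 16)))))
      (.cell 11 (.plus (.cell 7 (.reg 14)) (.reg 16)))))
    (.seq (.store 14 (.lit 0) (.reg 17))
    (.seq (.assign 18 (.lit 1))
    (.seq (.cond (.minus (.lit 1) (.ne (.reg 17) (.reg 4))) (.assign 18 (.lit 0)) .skip)
    (.seq checkInverse (.seq checkSpan
      (.cond (.reg 18) (.assign 15 (.lit 1)) .skip))))))))

theorem halts_testAll {N : ℕ} {V : ℕ → ℕ → F} (hN : 2 * (n * n) = N) (hNB : N ≤ B)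
    (hn0 : 0 < n) (hn : n ≤ B) (hm : m ≤ B) (hB : 1 ≤ B) (hR : 1 ≤ R) (hqm : q ^ m ≤ B)
    (hs : Ready e n m R g h s) (hV : HoldsVecs e N V s)
    (hQ : ∀ s', Agree 14 14 s s' → (s'.reg 15 ≠ 0 ↔ ∃ j < N, Certifies n m g h (V j)) → Q s') :
    Halts B testAll s Q := by
  have h0 : Agree 14 14 s (s.setReg 15 (Expr.eval s (.lit 0))) := agree_setReg _ _ (by omega)
  refine Halts.seq (Halts.assign (Halts.for (a := 14) (N := N) (fun k s' => s'.reg 15 ≠ 0 ↔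
    ∃ j < k, Certifies n m g h (V j)) (by decide) hNB
    ?_ (fun i s' v h => by rwa [State.reg_setReg_ne _ _ (by omega)]) (by simp [Expr.eval])
    ?_ fun s' ag => hQ s' (h0.trans ag)))
  · exact fun s' ag => ((h0.trans ag).reg 6 (by omega)).trans (hs.N_eq.trans hN)
  · intro j s1 hj ag1 r1 I1
    replace ag1 := h0.trans ag1
    have R1 := hs.agree (by omega) (by omega) ag1
    have V1 := hV.agree (by omega) ag1
    set μ := ∑ k ∈ Finset.range n, V j (n * n + (k * n)) * V j k with hμ
    refine Halts.seq (Halts.sum (a := 14) (fun k => V j (n * n + (k * n)) * V j k) hn (by omega)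
      R1.ops R1.zero (fun s' ag => (R1.agree (by omega) (by omega) ag).n_eq) ?_ fun s2 ag2 r2 => ?_)
    · intro k s' hk ag r
      have R' := R1.agree (by omega) (by omega) ag
      have V' := V1.agree (by omega) ag j hj
      have h1 := add_lt_square hk hn0
      have h2 := add_lt_square hn0 hk
      refine R'.ops.eval_fmul ?_ ?_
      · simp only [Expr.eval, ag.reg 14 (by omega), r1, r, R'.n_eq]
        rw [R'.vec j (by omega), R'.row_low n le_rfl, R'.row_low k hk.le, hN, V' _ (by omega)]
      · simp only [Expr.eval, ag.reg 14 (by omega), r1, r]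
        rw [R'.vec j (by omega), hN, V' _ (by omega)]
    refine Halts.seq (Halts.store (Halts.seq (Halts.assign (Halts.seq ?_))))
    set s3 := (s2.setCell 14 (Expr.eval s2 (.lit 0)) (Expr.eval s2 (.reg 17))).setReg 18
      (Expr.eval (s2.setCell 14 (Expr.eval s2 (.lit 0)) (Expr.eval s2 (.reg 17))) (.lit 1))
      with hs3
    have ag3 : Agree 16 14 s1 s3 := ag2.trans
      ((agree_setCell _ _ _ le_rfl).trans (agree_setReg _ _ (by omega)))
    have R3 := R1.agree (by omega) (by omega) ag3
    have r17 : s3.reg 17 = e μ := by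
      rw [hs3, State.reg_setReg_ne _ _ (by omega)]
      exact r2
    have a14 : s3.arr 14 0 = e μ := by
      simp only [hs3, State.arr_setReg, State.arr_setCell_self, Expr.eval, Function.update_self]
      exact r2
    have r18 : s3.reg 18 ≠ 0 := by simp [hs3, Expr.eval]
    clear_value s3
    refine halts_clear (p := μ ≠ 0) ?_ fun s4 ha4 hr4 h4 => ?_
    · have h4 : Expr.eval s3 (.ne (.reg 17) (.reg 4)) = 0 ↔ μ = 0 := by
        rw [Expr.eval_ne_eq_zero]
        simp only [Expr.eval, R3.zero, r17]
        exact label_inj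
      rw [ne_eq, ← h4]
      change 1 - Expr.eval s3 _ = 0 ↔ _
      omega
    have ag4 : Agree 16 14 s1 s4 := ag3.trans ⟨fun x hx => hr4 x (by omega), fun b _ => by rw [ha4]⟩
    have R4 := R1.agree (by omega) (by omega) ag4
    refine Halts.seq (halts_checkInverse (μ := μ) (V := V) hN hn R4 (by rw [ha4, a14])
      (V1.agree (by omega) ag4) ((ag4.reg 14 (by omega)).trans r1) hj fun s5 ag5 h5 => ?_)
    replace ag5 : Agree 16 14 s1 s5 := ag4.trans (ag5.mono le_rfl (by omega))
    have R5 := R1.agree (by omega) (by omega) ag5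
    refine Halts.seq (halts_checkSpan hN hn hm hB hR hqm R5
      (V1.agree (by omega) ag5) ((ag5.reg 14 (by omega)).trans r1) hj fun s6 ag6 h6 => ?_)
    replace ag6 : Agree 16 14 s1 s6 := ag5.trans ag6
    have h18 : s6.reg 18 ≠ 0 ↔ Certifies n m g h (V j) := by
      rw [h6, h5, h4, Certifies, exists_isInversePair_iff hn0]
      simp only [ne_eq, r18, not_false_eq_true, true_and, hμ]
    refine Halts.cond (fun h7 => Halts.assign ?_) fun h7 => Halts.skip ?_
    · simp only [Expr.eval, State.reg_setReg_self] at h7 ⊢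
      exact ⟨fun _ => ⟨j, by omega, h18.1 h7⟩, by simp⟩
    · simp only [Expr.eval] at h7
      rw [ag6.reg 15 (by omega), I1]
      constructor
      · rintro ⟨k, hk, h8⟩
        exact ⟨k, by omega, h8⟩
      · rintro ⟨k, hk, h8⟩
        refine ⟨k, ?_, h8⟩
        have : k ≠ j := fun h9 => h18.2 (h9 ▸ h8) h7
        omega

end AltSpace

namespace AltSpace

open RAM

variable {B : ℕ} {s : State} {Q : State → Prop}
variable {F : Type} [Field F] {q : ℕ} {e : F ≃ Fin q}
variable {n m R : ℕ} {g h : ℕ → ℕ → ℕ → F}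

/-! ### The isometry test -/

/-- What the test does with one array `8` of guessed digits. -/
def tryGuess (R : ℕ) : Prog :=
  .seq (combine 14 8 2 9 (.lit 0) (.lit R)) (.seq (combine 14 8 3 10 (.lit R) (.lit R))
    (.seq (initVecs R) (.seq (solve R) (.seq testAll
      (.cond (.reg 15) (.assign 13 (.lit 1)) .skip)))))

/-- The digits `δ` encode, in this order, `R` linear combinations of the matrices `g i`, as many of
the matrices `h i`, and a vector. This says that every family of vectors spanning the
solution space of the linear system determined by these data contains a certificate. -/
def Succeeds (e : F ≃ Fin q) (n m R : ℕ) (g h : ℕ → ℕ → ℕ → F) (δ : ℕ → ℕ) : Prop :=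
  ∀ (u : F) (V : ℕ → ℕ → F), u ≠ 0 →
    (∀ x, x ∈ spanBelow (2 * (n * n)) V ↔
      x ∈ spanBelow (2 * (n * n)) (initVec n u fun l => decode e (δ (2 * R * m + l))) ∧
      ∀ i < R, ∀ y < n, ∀ z < n, residual n
        (fun y z => ∑ j ∈ Finset.range m, decode e (δ (i * m + j)) * g j y z)
        (fun y z => ∑ j ∈ Finset.range m, decode e (δ ((R + i) * m + j)) * h j y z) y z x = 0) →
    ∃ j < 2 * (n * n), Certifies n m g h (V j)

theorem add_lt_digits {i j : ℕ} (hi : i < 2 * R) (hj : j < m) :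
    i * m + j < 2 * R * m + n := by
  calc i * m + j < i * m + m := by omega
    _ = (i + 1) * m := by ring
    _ ≤ 2 * R * m := Nat.mul_le_mul_right _ hi
    _ ≤ 2 * R * m + n := Nat.le_add_right _ _

theorem halts_tryGuess (hq : 1 < q) (hNB : 2 * (n * n) ≤ B) (hn0 : 0 < n) (hn : n ≤ B) (hm : m ≤ B)
    (hB : 1 ≤ B) (hR : 1 ≤ R) (hRB : R ≤ B) (hqm : q ^ m ≤ B) (hs : Ready e n m R g h s)
    (hd : ∀ i < 2 * R * m + n, s.arr 8 i < q) :
    Halts B (tryGuess R) s fun s' => (s.reg 13 ≠ 0 → s'.reg 13 ≠ 0) ∧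
      (s'.reg 13 ≠ 0 → s.reg 13 ≠ 0 ∨ ∃ w, Certifies n m g h w) ∧
      (Succeeds e n m R g h (s.arr 8) → s'.reg 13 ≠ 0) := by
  have hlab : ∀ i < 2 * R * m + n, s.arr 8 i = e (decode e (s.arr 8 i)) := fun i hi =>
    (label_decode (hd i hi)).symm
  refine Halts.seq (halts_combine (a := 9) (o := 0) (k := R)
    (fun i j => decode e (s.arr 8 (i * m + j))) g (by omega) (by omega) (by omega) (by omega)
    (by omega) hn hm hRB le_rfl (by omega) (fun _ _ => rfl) hs ?_ hs.fst fun s1 ag1 h1 => ?_)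
  · intro i hi j hj
    rw [zero_add]
    exact hlab _ (add_lt_digits (by omega) hj)
  have R1 := hs.agree (by omega) (by omega) ag1
  refine Halts.seq (halts_combine (a := 10) (o := R) (k := R)
    (fun i j => decode e (s.arr 8 ((R + i) * m + j))) h (by omega) (by omega) (by omega)
    (by omega) (by omega) hn hm hRB le_rfl (by omega) (fun _ _ => rfl) R1 ?_ R1.snd
    fun s2 ag2 h2 => ?_)
  · intro i hi j hj
    rw [ag1.arr 8 (by omega)]
    exact hlab _ (add_lt_digits (by omega) hj)
  have R2 := R1.agree (by omega) (by omega) ag2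
  have ag02 : Agree 14 9 s s2 := ag1.trans (ag2.mono le_rfl (by omega))
  refine Halts.seq ((halts_initVecs (v := fun l => decode e (s.arr 8 (2 * R * m + l))) hq rfl hNB
    R2 ?_ (Q := fun s' => ∃ u, u ≠ 0 ∧ HoldsVecs e (2 * (n * n))
      (initVec n u fun l => decode e (s.arr 8 (2 * R * m + l))) s')
    fun s' u hu hs' => ⟨u, hu, hs'⟩).imp_agree (r := 14) (a := 11)
      (by simp [initVecs, Prog.for, Prog.writesAbove]) ?_)
  · intro l hl
    rw [ag02.arr 8 (by omega)]
    exact hlab _ (by omega)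
  rintro s3 ag3 ⟨u, hu, V3⟩
  have R3 := R2.agree (by omega) (by omega) ag3
  refine Halts.seq ((halts_solve rfl hNB hn hRB R3 ((h1.agree (by omega) ag2).agree (by omega) ag3)
    (h2.agree (by omega) ag3) V3).imp_agree (r := 14) (a := 11) ?_ ?_)
  · have : eliminate.writesAbove 14 11 = true := by decide
    simp [solve, Prog.for, Prog.writesAbove, this]
  rintro s4 ag4 ⟨V, V4, hV⟩
  have R4 := R3.agree (by omega) (by omega) ag4
  have ag04 : Agree 14 9 s s4 :=
    (ag02.trans (ag3.mono le_rfl (by omega))).trans (ag4.mono le_rfl (by omega))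
  refine Halts.seq (halts_testAll rfl hNB hn0 hn hm hB hR hqm R4 V4 fun s5 ag5 h5 => ?_)
  have h13 : s5.reg 13 = s.reg 13 := (ag5.reg 13 (by omega)).trans (ag04.reg 13 (by omega))
  refine Halts.cond (fun h6 => Halts.assign ?_) fun h6 => Halts.skip ?_
  · simp only [Expr.eval, State.reg_setReg_self] at h6 ⊢
    obtain ⟨j, -, h7⟩ := h5.1 h6
    exact ⟨by simp, fun _ => Or.inr ⟨_, h7⟩, by simp⟩
  · simp only [Expr.eval] at h6
    rw [h13]
    exact ⟨id, Or.inl, fun h7 => absurd h6 (h5.2 (h7 u V hu hV))⟩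

/-- Set up the array of multiples of `q` and find the labels of `0` and `-1`. -/
def setupField : Prog :=
  .seq (.table 12 4 (.reg 0) (.reg 0))
  (.seq (.find 12 (.reg 0) (.ne (.fadd (.reg 12) (.reg 12)) (.reg 12)))
  (.seq (.assign 4 (.reg 13))
  (.seq (.find 12 (.reg 0) (.ne (.fadd (.fmul (.reg 12) unitExpr) unitExpr) (.reg 4)))
    (.assign 5 (.reg 13)))))

theorem halts_setupField (hq : 1 < q) (hqB : q ≤ B) (hs0 : s.reg 0 = q)
    (hadd : ∀ x y : F, s.arr 0 ((e x : ℕ) * q + e y) = e (x + y))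
    (hmul : ∀ x y : F, s.arr 1 ((e x : ℕ) * q + e y) = e (x * y))
    (hQ : ∀ s', Agree 4 4 s s' → HasOps e s' → s'.reg 4 = e 0 → s'.reg 5 = e (-1) → Q s') :
    Halts B setupField s Q := by
  refine Halts.seq (Halts.table (N := q) (W := q) hqB
    (fun s' ag => (ag.reg 0 (by omega)).trans hs0) (fun s' ag => (ag.reg 0 (by omega)).trans hs0)
    fun s1 ag1 _ h1 => ?_)
  have O1 : HasOps e s1 := ⟨by rwa [ag1.arr 0 (by omega)], by rwa [ag1.arr 1 (by omega)],
    fun i hi => h1 i hi.le⟩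
  have q1 : s1.reg 0 = q := (ag1.reg 0 (by omega)).trans hs0
  refine Halts.seq (Halts.find (a := 16) (N := q) (i₀ := e 0) hqB (e 0).isLt
    (fun s' ag => (ag.reg 0 (by omega)).trans q1) ?_ fun s2 ag2 h2 => ?_)
  · intro i s' hi ag r
    have O' := O1.agree (by omega) ag
    have hi' : Expr.eval s' (.reg 12) = e (decode e i) := by
      rw [label_decode hi]
      exact r
    rw [Expr.eval_ne_eq_zero, O'.eval_fadd hi' hi', hi', label_inj, add_eq_left]
    rw [← label_inj (e := e), label_decode hi]
  refine Halts.seq (Halts.assign ?_)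
  set s3 := s2.setReg 4 (Expr.eval s2 (.reg 13)) with hs3
  have ag3 : Agree 4 5 s1 s3 := (ag2.mono (by omega) (by omega)).trans (agree_setReg _ _ le_rfl)
  have O3 : HasOps e s3 := O1.agree (by omega) ag3
  have z3 : s3.reg 4 = e 0 := by simpa [hs3, Expr.eval] using h2
  obtain ⟨u, hu0, hu⟩ := exists_unitExpr_eval hq z3
  refine Halts.seq (Halts.find (a := 16) (N := q) (i₀ := e (-1)) hqB (e (-1)).isLt
    (fun s' ag => (ag.reg 0 (by omega)).trans ((ag3.reg 0 (by omega)).trans q1)) ?_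
    fun s4 ag4 h4 => Halts.assign ?_)
  · intro i s' hi ag r
    have O' := O3.agree (by omega) ag
    have hi' : Expr.eval s' (.reg 12) = e (decode e i) := by
      rw [label_decode hi]
      exact r
    have hu' : Expr.eval s' unitExpr = e u := by
      rw [← hu]
      simp only [unitExpr, Expr.eval, ag.reg 4 (by omega)]
    have z' : Expr.eval s' (.reg 4) = e 0 := (ag.reg 4 (by omega)).trans z3
    rw [Expr.eval_ne_eq_zero, O'.eval_fadd (O'.eval_fmul hi' hu') hu', z', label_inj]
    have : decode e i * u + u = 0 ↔ decode e i = -1 := by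
      rw [← add_one_mul, mul_eq_zero, or_iff_left hu0, add_eq_zero_iff_eq_neg]
    rw [this, ← label_inj (e := e), label_decode hi]
  · refine hQ _ ?_ ?_ ?_ ?_
    · exact (ag1.mono (by omega) le_rfl).trans ((ag3.mono le_rfl (by omega)).trans
        ((ag4.mono (by omega) (by omega)).trans (agree_setReg _ _ (by omega))))
    · exact (O3.agree (by omega) ag4).agree le_rfl (agree_setReg (r := 0) _ _ (by omega))
    · rw [State.reg_setReg_ne _ _ (by omega), ag4.reg 4 (by omega), z3]
    · rw [State.reg_setReg_self]
      exact h4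

/-- Set up the tables of multiples and the numbers of unknowns, digits, and guesses. -/
def setupTables (R : ℕ) : Prog :=
  .seq (.table 12 5 (.reg 1) (.plus (.reg 2) (.lit (R + 1))))
  (.seq (.assign 9 (.cell 5 (.plus (.reg 2) (.lit (R + 1)))))
  (.seq (.table 12 5 (.reg 1) (.reg 9))
  (.seq (.table 12 6 (.reg 2) (.lit (2 * R)))
  (.seq (.assign 6 (.plus (.cell 5 (.reg 1)) (.cell 5 (.reg 1))))
  (.seq (.table 12 7 (.reg 6) (.reg 6))
  (.seq (.assign 7 (.plus (.cell 6 (.lit (2 * R))) (.reg 1)))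
  (.seq (.power 12 (.reg 0) (.reg 7))
  (.seq (.assign 8 (.reg 14))
  (.seq (.power 12 (.reg 0) (.reg 2))
    (.assign 10 (.reg 14)))))))))))

theorem halts_setupTables (hn : 0 < n) (hqB : q ≤ B) (hNB : 2 * (n * n) ≤ B)
    (hrow : (m + R + 1) * n ≤ B) (hR : 2 * R ≤ B) (hL : 2 * R * m + n ≤ B)
    (hq : s.reg 0 = q) (hn1 : s.reg 1 = n) (hm : s.reg 2 = m) (hops : HasOps e s)
    (h4 : s.reg 4 = e 0) (h5 : s.reg 5 = e (-1)) (hg : HoldsTuple e n 2 m g s)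
    (hh : HoldsTuple e n 3 m h s) (hQ : ∀ s', Ready e n m R g h s' → Q s') :
    Halts B (setupTables R) s Q := by
  have hle : ∀ k ≤ m + R + 1, k ≤ (m + R + 1) * n := fun k hk =>
    hk.trans (Nat.le_mul_of_pos_right _ hn)
  refine Halts.seq (Halts.table (N := m + R + 1) (W := n) ((hle _ le_rfl).trans hrow)
    (fun s' ag => (ag.reg 1 (by omega)).trans hn1)
    (fun s' ag => by simp only [Expr.eval, ag.reg 2 (by omega), hm]; omega) fun s1 ag1 _ h1 => ?_)
  refine Halts.seq (Halts.assign ?_)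
  set s2 := s1.setReg 9 (Expr.eval s1 (.cell 5 (.plus (.reg 2) (.lit (R + 1))))) with hs2
  have ag2 : Agree 6 5 s s2 := (ag1.mono (by omega) le_rfl).trans (agree_setReg _ _ (by omega))
  have r9 : s2.reg 9 = (m + R + 1) * n := by
    simp only [hs2, State.reg_setReg_self, Expr.eval, ag1.reg 2 (by omega), hm]
    exact h1 _ le_rfl
  refine Halts.seq (Halts.table (N := (m + R + 1) * n) (W := n) hrow
    (fun s' ag => (ag.reg 1 (by omega)).trans ((ag2.reg 1 (by omega)).trans hn1))
    (fun s' ag => (ag.reg 9 (by omega)).trans r9) fun s3 ag3 _ h3 => ?_)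
  replace ag3 : Agree 6 5 s s3 := ag2.trans (ag3.mono (by omega) le_rfl)
  refine Halts.seq (Halts.table (N := 2 * R) (W := m) hR
    (fun s' ag => (ag.reg 2 (by omega)).trans ((ag3.reg 2 (by omega)).trans hm))
    (fun s' ag => rfl) fun s4 ag34 _ h4' => ?_)
  have ag4 : Agree 6 5 s s4 := ag3.trans (ag34.mono (by omega) (by omega))
  refine Halts.seq (Halts.assign ?_)
  set s5 := s4.setReg 6 (Expr.eval s4 (.plus (.cell 5 (.reg 1)) (.cell 5 (.reg 1)))) with hs5
  have ag45 : Agree 6 16 s4 s5 := agree_setReg _ _ le_rfl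
  have r6 : s5.reg 6 = 2 * (n * n) := by
    simp only [hs5, State.reg_setReg_self, Expr.eval, ag4.reg 1 (by omega), hn1]
    rw [ag34.arr 5 (by omega), h3 n (Nat.le_mul_of_pos_left _ (by omega))]
    ring
  refine Halts.seq (Halts.table (N := 2 * (n * n)) (W := 2 * (n * n)) hNB
    (fun s' ag => (ag.reg 6 (by omega)).trans r6)
    (fun s' ag => (ag.reg 6 (by omega)).trans r6) fun s6 ag56 _ h6 => ?_)
  have ag46 : Agree 6 7 s4 s6 := (ag45.mono le_rfl (by omega)).trans (ag56.mono (by omega) le_rfl)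
  refine Halts.seq (Halts.assign ?_)
  set s7 := s6.setReg 7 (Expr.eval s6 (.plus (.cell 6 (.lit (2 * R))) (.reg 1)))
    with hs7
  have ag67 : Agree 7 16 s6 s7 := agree_setReg _ _ le_rfl
  have r7 : s7.reg 7 = 2 * R * m + n := by
    simp only [hs7, State.reg_setReg_self, Expr.eval, ag46.reg 1 (by omega), ag4.reg 1 (by omega),
      hn1]
    rw [ag46.arr 6 (by omega), h4' _ le_rfl]
  have q7 : s7.reg 0 = q := (ag67.reg 0 (by omega)).trans ((ag46.reg 0 (by omega)).trans
    ((ag4.reg 0 (by omega)).trans hq))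
  have m7 : s7.reg 2 = m := (ag67.reg 2 (by omega)).trans ((ag46.reg 2 (by omega)).trans
    ((ag4.reg 2 (by omega)).trans hm))
  refine Halts.seq (Halts.power (a := 16) (N := 2 * R * m + n) (W := q) hL hqB
    (fun s' ag => (ag.reg 0 (by omega)).trans q7)
    (fun s' ag => (ag.reg 7 (by omega)).trans r7) fun s8 ag78 h8 => Halts.seq (Halts.assign ?_))
  set s9 := s8.setReg 8 (Expr.eval s8 (.reg 14)) with hs9
  have ag79 : Agree 8 16 s7 s9 := (ag78.mono (by omega) le_rfl).trans (agree_setReg _ _ le_rfl)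
  have r8 : s9.reg 8 = q ^ (2 * R * m + n) := by
    simpa [hs9, Expr.eval] using h8
  refine Halts.seq (Halts.power (a := 16) (N := m) (W := q) ((hle m (by omega)).trans hrow) hqB
    (fun s' ag => (ag.reg 0 (by omega)).trans ((ag79.reg 0 (by omega)).trans q7))
    (fun s' ag => (ag.reg 2 (by omega)).trans ((ag79.reg 2 (by omega)).trans m7))
    fun s10 ag10 h10 => Halts.assign (hQ _ ?_))
  set s11 := s10.setReg 10 (Expr.eval s10 (.reg 14)) with hs11
  have ag911 : Agree 9 16 s9 s11 :=
      (ag10.mono (by omega) le_rfl).trans (agree_setReg _ _ (by omega))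
  have ag711 : Agree 8 16 s7 s11 := ag79.trans (ag911.mono (by omega) le_rfl)
  have ag611 : Agree 7 16 s6 s11 := ag67.trans (ag711.mono (by omega) le_rfl)
  have ag511 : Agree 7 7 s5 s11 :=
      (ag56.mono (by omega) le_rfl).trans (ag611.mono le_rfl (by omega))
  have ag411 : Agree 6 7 s4 s11 :=
    (ag45.mono le_rfl (by omega)).trans (ag511.mono (by omega) le_rfl)
  have ag11 : Agree 6 5 s s11 := ag4.trans (ag411.mono le_rfl (by omega))
  have a5 : s11.arr 5 = s3.arr 5 := (ag411.arr 5 (by omega)).trans (ag34.arr 5 (by omega))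
  exact {
    ops := hops.agree le_rfl ag11
    q_eq := (ag11.reg 0 (by omega)).trans hq
    n_eq := (ag11.reg 1 (by omega)).trans hn1
    m_eq := (ag11.reg 2 (by omega)).trans hm
    zero := (ag11.reg 4 (by omega)).trans h4
    neg := (ag11.reg 5 (by omega)).trans h5
    N_eq := (ag511.reg 6 (by omega)).trans r6
    L_eq := (ag711.reg 7 (by omega)).trans r7
    qL_eq := (ag911.reg 8 (by omega)).trans r8
    qm_eq := by simpa [hs11, Expr.eval] using h10
    fst := hg.agree (by omega) ag11
    snd := hh.agree (by omega) ag11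
    row_fst := fun k hk => by
      rw [a5]
      exact h3 k (hle k (by omega))
    row_snd := fun k hk x hx => by
      rw [a5]
      refine h3 _ ?_
      calc k * n + x ≤ k * n + n := by omega
        _ = (k + 1) * n := by ring
        _ ≤ (m + R + 1) * n := Nat.mul_le_mul_right _ (by omega)
    row_low := fun x hx => by
      rw [a5]
      exact h3 x (hx.trans (Nat.le_mul_of_pos_left _ (by omega)))
    digit := by
      rw [ag411.arr 6 (by omega)]
      exact h4'
    vec := by
      rw [ag611.arr 7 (by omega)]
      exact h6 }

/-- The isometry test; `R` is the number of matrices of each space that are guessed. -/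
def isometryTest (R : ℕ) : Prog :=
  .cond (.ne (.reg 2) (.reg 3)) (.assign 0 (.lit 0))
    (.seq setupField (.seq (setupTables R) (.seq (.assign 13 (.lit 0))
      (.seq (.search 12 8 (.reg 0) (.reg 7) (.reg 8) (tryGuess R))
        (.cond (.reg 13) (.assign 0 (.lit 1)) (.assign 0 (.lit 0)))))))

theorem halts_isometryTest_of_ne {m' : ℕ} (hm : s.reg 2 = m) (hm' : s.reg 3 = m') (hne : m ≠ m') :
    Halts B (isometryTest R) s fun s' => s'.reg 0 = 0 := by
  refine Halts.cond (fun _ => Halts.assign (by simp [Expr.eval])) fun h => absurd ?_ hne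
  rw [Expr.eval_ne_eq_zero] at h
  exact hm.symm.trans (h.trans hm')

theorem halts_isometryTest (hq1 : 1 < q) (hn : 0 < n) (hR : 1 ≤ R) (hqB : q ≤ B)
    (hNB : 2 * (n * n) ≤ B) (hrow : (m + R + 1) * n ≤ B) (hRB : 2 * R ≤ B)
    (hL : q ^ (2 * R * m + n) ≤ B)
    (hq : s.reg 0 = q) (hn1 : s.reg 1 = n) (hm : s.reg 2 = m) (hm' : s.reg 3 = m)
    (hadd : ∀ x y : F, s.arr 0 ((e x : ℕ) * q + e y) = e (x + y))
    (hmul : ∀ x y : F, s.arr 1 ((e x : ℕ) * q + e y) = e (x * y))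
    (hg : HoldsTuple e n 2 m g s) (hh : HoldsTuple e n 3 m h s) :
    Halts B (isometryTest R) s fun s' => (s'.reg 0 = 1 ∧ ∃ w, Certifies n m g h w) ∨
      (s'.reg 0 = 0 ∧ ∀ δ : ℕ → ℕ, (∀ i < 2 * R * m + n, δ i < q) →
        ∃ δ' : ℕ → ℕ, (∀ i < 2 * R * m + n, δ' i = δ i) ∧ ¬ Succeeds e n m R g h δ') := by
  have hle : ∀ k ≤ m + R + 1, k ≤ B := fun k hk =>
    (hk.trans (Nat.le_mul_of_pos_right _ hn)).trans hrow
  have hpow : ∀ k ≤ 2 * R * m + n, q ^ k ≤ B := fun k hk =>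
    (Nat.pow_le_pow_right (by omega) hk).trans hL
  have hmL : m ≤ 2 * R * m + n := by nlinarith
  refine Halts.cond (fun h' => absurd (Expr.eval_ne_eq_zero (s := s) (E := .reg 2) (E' := .reg 3)
    |>.2 (hm.trans hm'.symm)) h') fun _ => ?_
  refine Halts.seq (halts_setupField hq1 hqB hq hadd hmul fun s1 ag1 O1 h4 h5 => ?_)
  refine Halts.seq (halts_setupTables hn hqB hNB hrow hRB
    (((Nat.lt_pow_self hq1).le).trans hL) ((ag1.reg 0 (by omega)).trans hq)
    ((ag1.reg 1 (by omega)).trans hn1) ((ag1.reg 2 (by omega)).trans hm) O1 h4 h5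
    (hg.agree (by omega) ag1) (hh.agree (by omega) ag1) fun s2 R2 => ?_)
  refine Halts.seq (Halts.assign ?_)
  set s3 := s2.setReg 13 (Expr.eval s2 (.lit 0)) with hs3
  have ag3 : Agree 12 8 s2 s3 := agree_setReg _ _ (by omega)
  have R3 := R2.agree (by omega) (by omega) ag3
  refine Halts.seq (Halts.search (a := 8) (N := 2 * R * m + n) (W := q)
    (fun _ => ∃ w, Certifies n m g h w) (Succeeds e n m R g h) le_rfl ?_ (by omega)
    (((Nat.lt_pow_self hq1).le).trans hL) hL
    (fun s' ag => (R3.agree (by omega) (by omega) ag).q_eq)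
    (fun s' ag => (R3.agree (by omega) (by omega) ag).L_eq)
    (fun s' ag => (R3.agree (by omega) (by omega) ag).qL_eq) (by simp [hs3, Expr.eval]) ?_ ?_)
  · have h2 : eliminate.writesAbove 13 8 = true := by decide
    have h3 : testAll.writesAbove 13 8 = true := by decide
    simp [tryGuess, combine, initVecs, solve, Prog.for, Prog.sum, Prog.writesAbove, h2, h3]
  · intro s' ag hd
    exact halts_tryGuess hq1 hNB hn ((Nat.le_mul_of_pos_left n (by omega)).trans hrow)
      (hle m (by omega)) (hle 1 (by omega)) hR
      (hle R (by omega)) (hpow m hmL) (R3.agree (by omega) (by omega) ag) hd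
  · intro s' ag h1 h2
    refine Halts.cond (fun h6 => Halts.assign (Or.inl ⟨by simp [Expr.eval], ?_⟩))
      fun h6 => Halts.assign (Or.inr ⟨by simp [Expr.eval], fun δ hδ => ?_⟩)
    · obtain ⟨_, -, h7⟩ := h1 h6
      exact h7
    · by_contra h7
      push Not at h7
      exact h2 δ hδ h7 h6

end AltSpace

namespace AltSpace

open Matrix

variable {F : Type} [Field F] {q : ℕ} {e : F ≃ Fin q}
variable {n m R : ℕ}

/-! ### From certificates to isometries -/

theorem transpose_eq_neg_of_mem_alternating {A : Matrix (Fin n) (Fin n) F}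
    (hA : A ∈ alternating n F) : Aᵀ = -A := by
  have h : ∀ u : Fin n → F, u ⬝ᵥ (A *ᵥ u) = 0 := hA
  have key : ∀ u v : Fin n → F, u ⬝ᵥ (A *ᵥ v) + v ⬝ᵥ (A *ᵥ u) = 0 := fun u v => by
    have h1 := h (u + v)
    rw [mulVec_add, add_dotProduct, dotProduct_add, dotProduct_add, h u, h v] at h1
    linear_combination h1
  ext i j
  have h1 := key (Pi.single i 1) (Pi.single j 1)
  simp only [mulVec_single_one, single_one_dotProduct, col_apply] at h1
  rw [transpose_apply, neg_apply]
  linear_combination h1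

/-- The upper left `n × n` block of an infinite matrix. -/
def block (n : ℕ) (f : ℕ → ℕ → F) : Matrix (Fin n) (Fin n) F := of fun y z => f y z

/-- The matrix `A` encoded, column by column, in the entries `n ^ 2, …, 2 * n ^ 2 - 1`. -/
def matA {F : Type} (n : ℕ) (w : ℕ → F) : Matrix (Fin n) (Fin n) F :=
  of fun k y => w (n * n + (y * n + k))

/-- The matrix `D` encoded, column by column, in the first `n ^ 2` entries. -/
def matD {F : Type} (n : ℕ) (w : ℕ → F) : Matrix (Fin n) (Fin n) F := of fun k z => w (z * n + k)

theorem residual_eq {g h : ℕ → ℕ → F} (hg : (block n g)ᵀ = -block n g) (w : ℕ → F) (y z : Fin n) :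
    residual n g h y z w = (block n h * matD n w - (matA n w)ᵀ * block n g) y z := by
  have h1 : ∀ k : Fin n, g z k = -g k z := fun k => congrFun (congrFun hg k) z
  rw [residual_apply, Finset.sum_range, Matrix.sub_apply, mul_apply, mul_apply,
    ← Finset.sum_sub_distrib]
  refine Finset.sum_congr rfl fun k _ => ?_
  simp only [block, matA, matD, of_apply, transpose_apply, h1]
  ring

theorem forall_residual_iff {g h : ℕ → ℕ → F} (hg : (block n g)ᵀ = -block n g) (w : ℕ → F) :
    (∀ y < n, ∀ z < n, residual n g h y z w = 0) ↔
      (matA n w)ᵀ * block n g = block n h * matD n w := by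
  constructor
  · intro hw
    ext y z
    have := hw y y.2 z z.2
    rw [residual_eq hg, Matrix.sub_apply, sub_eq_zero] at this
    exact this.symm
  · intro hw y hy z hz
    have := residual_eq (h := h) hg w ⟨y, hy⟩ ⟨z, hz⟩
    rw [hw, sub_self] at this
    exact this

/-- A tuple of matrices, continued by zeros. -/
def extend (G : Fin m → Matrix (Fin n) (Fin n) F) : ℕ → ℕ → ℕ → F := fun i y z =>
  if h : i < m ∧ y < n ∧ z < n then G ⟨i, h.1⟩ ⟨y, h.2.1⟩ ⟨z, h.2.2⟩ else 0

theorem block_extend (G : Fin m → Matrix (Fin n) (Fin n) F) (i : Fin m) :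
    block n (extend G i) = G i := by
  ext y z
  simp [block, extend]

theorem block_sum_extend (G : Fin m → Matrix (Fin n) (Fin n) F) (c : ℕ → F) :
    block n (fun y z => ∑ j ∈ Finset.range m, c j * extend G j y z) = ∑ j : Fin m, c j • G j := by
  ext y z
  rw [block, of_apply, Finset.sum_range, Matrix.sum_apply]
  refine Finset.sum_congr rfl fun j _ => ?_
  rw [Matrix.smul_apply, smul_eq_mul, ← block_extend G j, block, of_apply]

theorem matA_mul_matD {w : ℕ → F} {μ : F} (hw : IsInversePair n μ w) :
    matA n w * matD n w = μ • 1 := by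
  ext y z
  rw [mul_apply, Matrix.smul_apply, one_apply, smul_eq_mul, mul_ite, mul_one, mul_zero]
  have h1 := hw y y.2 z z.2
  rw [Finset.sum_range] at h1
  simp only [matA, matD, of_apply]
  rw [h1]
  simp [Fin.ext_iff]

/-- The congruence `B ↦ Aᵀ * B * A`. -/
def congruence (A : Matrix (Fin n) (Fin n) F) :
    Matrix (Fin n) (Fin n) F →ₗ[F] Matrix (Fin n) (Fin n) F :=
  LinearMap.mulRight F A ∘ₗ LinearMap.mulLeft F Aᵀ

theorem congruence_apply (A B : Matrix (Fin n) (Fin n) F) : congruence A B = Aᵀ * B * A := rfl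

theorem congruence_injective (A : GL (Fin n) F) :
    Function.Injective (congruence (A : Matrix (Fin n) (Fin n) F)) := by
  intro M M' hM
  simp only [congruence_apply] at hM
  have hA : IsUnit (A : Matrix (Fin n) (Fin n) F) := A.isUnit
  have h1 := hA.mul_right_cancel hM
  exact ((isUnit_transpose _).2 hA).mul_left_cancel h1

theorem isometric_iff {𝒢 ℋ : Submodule F (Matrix (Fin n) (Fin n) F)} :
    Isometric 𝒢 ℋ ↔ ∃ A : GL (Fin n) F,
      𝒢.map (congruence (A : Matrix (Fin n) (Fin n) F)) = ℋ := by
  refine exists_congr fun A => ?_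
  exact SetLike.coe_set_eq (p := 𝒢.map (congruence (A : Matrix (Fin n) (Fin n) F))) (q := ℋ)

theorem IsLinearBasis.finrank_eq {G : Fin m → Matrix (Fin n) (Fin n) F}
    {𝒢 : Submodule F (Matrix (Fin n) (Fin n) F)} (hG : IsLinearBasis G 𝒢) :
    Module.finrank F 𝒢 = m := by
  rw [← hG.2, finrank_span_eq_card hG.1, Fintype.card_fin]

theorem Isometric.finrank_eq {𝒢 ℋ : Submodule F (Matrix (Fin n) (Fin n) F)}
    (h : Isometric 𝒢 ℋ) : Module.finrank F 𝒢 = Module.finrank F ℋ := by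
  obtain ⟨A, rfl⟩ := isometric_iff.1 h
  exact (LinearEquiv.finrank_eq (Submodule.equivMapOfInjective _ (congruence_injective A) 𝒢))

theorem IsLinearBasis.mem {G : Fin m → Matrix (Fin n) (Fin n) F}
    {𝒢 : Submodule F (Matrix (Fin n) (Fin n) F)} (hG : IsLinearBasis G 𝒢) (i : Fin m) :
    G i ∈ 𝒢 := hG.2 ▸ Submodule.subset_span ⟨i, rfl⟩

theorem isometric_of_certifies {𝒢 ℋ : Submodule F (Matrix (Fin n) (Fin n) F)}
    (h𝒢 : 𝒢 ≤ alternating n F) {G H : Fin m → Matrix (Fin n) (Fin n) F}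
    (hG : IsLinearBasis G 𝒢) (hH : IsLinearBasis H ℋ) {w : ℕ → F}
    (hw : Certifies n m (extend G) (extend H) w) : Isometric 𝒢 ℋ := by
  obtain ⟨⟨μ, hμ, hinv⟩, hmap⟩ := hw
  have hAD := matA_mul_matD hinv
  set A := matA n w
  set D := matD n w
  have h1 : A * (μ⁻¹ • D) = 1 := by
    rw [Matrix.mul_smul, hAD, smul_smul, inv_mul_cancel₀ hμ, one_smul]
  have hDA : D * A = μ • 1 := by
    have h2 : (μ⁻¹ • D) * A = 1 := mul_eq_one_comm.1 h1
    rw [Matrix.smul_mul] at h2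
    rw [← h2, smul_smul, mul_inv_cancel₀ hμ, one_smul]
  let A' : GL (Fin n) F := ⟨A, μ⁻¹ • D, h1, mul_eq_one_comm.1 h1⟩
  refine isometric_iff.2 ⟨A', ?_⟩
  refine Submodule.eq_of_le_of_finrank_eq ?_ ?_
  · rw [← hG.2, Submodule.map_span, Submodule.span_le]
    rintro _ ⟨_, ⟨i, rfl⟩, rfl⟩
    obtain ⟨c, hc⟩ := hmap i i.2
    rw [forall_residual_iff (by
      rw [block_extend]
      exact transpose_eq_neg_of_mem_alternating (h𝒢 (hG.mem i))), block_extend,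
      block_sum_extend] at hc
    change Aᵀ * G i * A ∈ ℋ
    rw [hc, Matrix.mul_assoc]
    change _ * (D * A) ∈ ℋ
    rw [hDA, Matrix.mul_smul, Matrix.mul_one]
    exact Submodule.smul_mem _ _ (Submodule.sum_mem _ fun j _ => Submodule.smul_mem _ _ (hH.mem j))
  · rw [hH.finrank_eq, ← hG.finrank_eq]
    exact (LinearEquiv.finrank_eq
      (Submodule.equivMapOfInjective _ (congruence_injective A') 𝒢)).symm

/-! ### Rigid tuples -/

/-- No nonzero pair of matrices `P`, `Q` with `P * g i = g i * Q` for all `i` has a singular `Q`.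
This makes an isometry that is known on the `g i` and on one vector unique among the solutions of
a linear system. -/
def Rigid (g : Fin R → Matrix (Fin n) (Fin n) F) : Prop :=
  ∀ v : Fin n → F, v ≠ 0 → ∀ P Q : Matrix (Fin n) (Fin n) F,
    (∀ i, P * g i = g i * Q) → Q *ᵥ v = 0 → P = 0 ∧ Q = 0

/-- The vector that encodes the matrices `A` and `D`. -/
def encodePair (A D : Matrix (Fin n) (Fin n) F) : ℕ → F := fun l =>
  if h : 0 < n ∧ l < n * n then D ⟨l % n, Nat.mod_lt _ h.1⟩ ⟨l / n, Nat.div_lt_of_lt_mul h.2⟩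
  else if h : 0 < n ∧ l - n * n < n * n then
    A ⟨(l - n * n) % n, Nat.mod_lt _ h.1⟩ ⟨(l - n * n) / n, Nat.div_lt_of_lt_mul h.2⟩
  else 0

theorem matD_encodePair (A D : Matrix (Fin n) (Fin n) F) : matD n (encodePair A D) = D := by
  ext k z
  have hn : 0 < n := k.pos
  have h1 := add_lt_square z.2 k.2
  have h2 : ((z : ℕ) * n + k) / n = z := by
    rw [mul_comm, Nat.mul_add_div hn, Nat.div_eq_of_lt k.2, add_zero]
  simp only [matD, encodePair, of_apply]
  rw [dif_pos ⟨hn, h1⟩]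
  simp only [h2, Nat.mul_add_mod_of_lt k.2]

theorem matA_encodePair (A D : Matrix (Fin n) (Fin n) F) : matA n (encodePair A D) = A := by
  ext k z
  have hn : 0 < n := k.pos
  have h1 := add_lt_square z.2 k.2
  have h2 : ((z : ℕ) * n + k) / n = z := by
    rw [mul_comm, Nat.mul_add_div hn, Nat.div_eq_of_lt k.2, add_zero]
  simp only [matA, encodePair, of_apply]
  rw [dif_neg (by omega), dif_pos ⟨hn, by omega⟩]
  simp only [Nat.add_sub_cancel_left, h2, Nat.mul_add_mod_of_lt k.2]

theorem encodePair_eq_zero_of_le {A D : Matrix (Fin n) (Fin n) F} {l : ℕ}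
    (hl : 2 * (n * n) ≤ l) : encodePair A D l = 0 := by
  rw [encodePair, dif_neg (by omega), dif_neg (by omega)]

/-- A vector is determined by the pair of matrices that it encodes. -/
theorem eq_of_matA_eq_of_matD_eq {F : Type} {x x' : ℕ → F} (hA : matA n x = matA n x')
    (hD : matD n x = matD n x') (h0 : ∀ l, 2 * (n * n) ≤ l → x l = x' l) : x = x' := by
  funext l
  rcases Nat.lt_or_ge l (2 * (n * n)) with hl | hl
  · have hn : 0 < n := by
      rcases Nat.eq_zero_or_pos n with rfl | hn
      · omega
      · exact hn
    rcases Nat.lt_or_ge l (n * n) with h1 | h1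
    · have := congrFun (congrFun hD ⟨l % n, Nat.mod_lt _ hn⟩) ⟨l / n, Nat.div_lt_of_lt_mul h1⟩
      simpa [matD, Nat.div_add_mod'] using this
    · have h2 : l - n * n < n * n := by omega
      have := congrFun (congrFun hA ⟨(l - n * n) % n, Nat.mod_lt _ hn⟩)
        ⟨(l - n * n) / n, Nat.div_lt_of_lt_mul h2⟩
      simpa [matA, Nat.div_add_mod', Nat.add_sub_cancel' h1] using this
  · exact h0 l hl

/-- The first `n` entries of a vector in the span of the initial vectors are proportional to
`v`. -/
theorem mem_spanBelow_initVec {N : ℕ} {u : F} {v x : ℕ → F} (hx : x ∈ spanBelow N (initVec n u v)) :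
    (∀ l, N ≤ l → n ≤ l → x l = 0) ∧ ∃ c, ∀ l < n, x l = c * v l := by
  refine Submodule.span_induction (p := fun x _ => (∀ l, N ≤ l → n ≤ l → x l = 0) ∧
    ∃ c, ∀ l < n, x l = c * v l) ?_ ?_ ?_ ?_ hx
  · rintro _ ⟨j, hj, rfl⟩
    have hj' : j < N := hj
    refine ⟨fun l hl hl' => ?_, if j < n then 1 else 0, fun l hl => ?_⟩
    · rw [initVec, if_neg (by omega), if_neg (by omega)]
    · by_cases h1 : j < n
      · rw [initVec, if_pos ⟨h1, hl⟩, if_pos h1, one_mul]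
      · rw [initVec, if_neg (by omega), if_neg (by omega), if_neg h1, zero_mul]
  · exact ⟨fun _ _ _ => rfl, 0, fun _ _ => by simp⟩
  · rintro x y - - ⟨h1, c, h2⟩ ⟨h3, d, h4⟩
    exact ⟨fun l hl hl' => by rw [Pi.add_apply, h1 l hl hl', h3 l hl hl', add_zero], c + d,
      fun l hl => by rw [Pi.add_apply, h2 l hl, h4 l hl, add_mul]⟩
  · rintro d x - ⟨h1, c, h2⟩
    exact ⟨fun l hl hl' => by rw [Pi.smul_apply, h1 l hl hl', smul_zero], d * c,
      fun l hl => by rw [Pi.smul_apply, h2 l hl, smul_eq_mul, mul_assoc]⟩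

theorem mem_spanBelow_initVec_of_eq {N : ℕ} {u : F} {v x : ℕ → F} (hu : u ≠ 0) (hn : 0 < n)
    (hnN : n ≤ N) (hx : ∀ l < n, x l = v l) (hx0 : ∀ l, N ≤ l → x l = 0) :
    x ∈ spanBelow N (initVec n u v) := by
  have hmem : ∀ j < N, initVec n u v j ∈ spanBelow N (initVec n u v) := fun j hj =>
    Submodule.subset_span ⟨j, hj, rfl⟩
  have : x = initVec n u v 0 + ∑ j ∈ Finset.Ico n N, (x j * u⁻¹) • initVec n u v j := by
    funext l
    rw [Pi.add_apply, Finset.sum_apply]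
    have hterm : ∀ j ∈ Finset.Ico n N, ((x j * u⁻¹) • initVec n u v j) l =
        if j = l then x l else 0 := by
      intro j hj
      rw [Finset.mem_Ico] at hj
      rw [Pi.smul_apply, initVec, if_neg (by omega), smul_eq_mul, mul_ite, mul_zero]
      split_ifs with h1
      · rw [h1, inv_mul_cancel_right₀ hu]
      · rfl
    rw [Finset.sum_congr rfl hterm, Finset.sum_ite_eq']
    by_cases h1 : l < n
    · rw [initVec, if_pos ⟨hn, h1⟩, if_neg (by simp; omega), add_zero, hx l h1]
    · rw [initVec, if_neg (by omega), if_neg (by omega), zero_add]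
      split_ifs with h2
      · rfl
      · exact hx0 l (by simp only [Finset.mem_Ico] at h2; omega)
  rw [this]
  refine add_mem (hmem 0 (by omega)) (Submodule.sum_mem _ fun j hj => Submodule.smul_mem _ _ ?_)
  exact hmem j (Finset.mem_Ico.1 hj).2

/-- The digits that encode coefficients `p`, `p'` and a vector `v`. -/
def encodeDigits (e : F ≃ Fin q) (m R : ℕ) (p p' : ℕ → ℕ → F) (v : ℕ → F) (x : ℕ) : ℕ :=
  if x < R * m then e (p (x / m) (x % m))
  else if x < 2 * R * m then e (p' (x / m - R) (x % m)) else e (v (x - 2 * R * m))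

theorem encodeDigits_lt {F : Type} {e : F ≃ Fin q} (p p' : ℕ → ℕ → F) (v : ℕ → F)
    (x : ℕ) : encodeDigits e m R p p' v x < q := by
  unfold encodeDigits
  split_ifs <;> exact Fin.isLt _

theorem encodeDigits_fst {F : Type} {e : F ≃ Fin q} (p p' : ℕ → ℕ → F) (v : ℕ → F)
    {i j : ℕ} (hi : i < R) (hj : j < m) :
    encodeDigits e m R p p' v (i * m + j) = e (p i j) := by
  have h1 : i * m + j < R * m := by
    calc i * m + j < i * m + m := by omega
      _ = (i + 1) * m := by ring
      _ ≤ R * m := Nat.mul_le_mul_right _ hi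
  have h2 : (i * m + j) / m = i := by
    rw [mul_comm, Nat.mul_add_div (by omega), Nat.div_eq_of_lt hj, add_zero]
  rw [encodeDigits, if_pos h1, h2, Nat.mul_add_mod_of_lt hj]

theorem encodeDigits_snd {F : Type} {e : F ≃ Fin q} (p p' : ℕ → ℕ → F) (v : ℕ → F)
    {i j : ℕ} (hi : i < R) (hj : j < m) :
    encodeDigits e m R p p' v ((R + i) * m + j) = e (p' i j) := by
  have h1 : (R + i) * m + j < 2 * R * m := by
    calc (R + i) * m + j < (R + i) * m + m := by omega
      _ = (R + i + 1) * m := by ring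
      _ ≤ 2 * R * m := Nat.mul_le_mul_right _ (by omega)
  have h2 : ((R + i) * m + j) / m = R + i := by
    rw [mul_comm, Nat.mul_add_div (by omega), Nat.div_eq_of_lt hj, add_zero]
  have h3 : R * m ≤ (R + i) * m + j := by
    rw [add_mul]
    omega
  rw [encodeDigits, if_neg (by omega), if_pos h1, h2, Nat.mul_add_mod_of_lt hj,
    Nat.add_sub_cancel_left]

theorem encodeDigits_vec {F : Type} {e : F ≃ Fin q} (p p' : ℕ → ℕ → F) (v : ℕ → F)
    (l : ℕ) : encodeDigits e m R p p' v (2 * R * m + l) = e (v l) := by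
  have : R * m ≤ 2 * R * m := Nat.mul_le_mul_right _ (by omega)
  rw [encodeDigits, if_neg (by omega), if_neg (by omega), Nat.add_sub_cancel_left]

/-- If `A` is an isometry and the matrices `γ i` of `𝒢` form a rigid tuple, then the linear system
for `γ i`, its image under `A`, and the first column of `D = A⁻¹` has only the multiples of the
pair `A`, `D` as solutions: a solution whose `D` has first column zero yields a pair as in the
definition of rigidity. -/
theorem exists_digits_succeeds {𝒢 ℋ : Submodule F (Matrix (Fin n) (Fin n) F)} (hn : 0 < n)
    (h𝒢 : 𝒢 ≤ alternating n F) {G H : Fin m → Matrix (Fin n) (Fin n) F}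
    (hG : IsLinearBasis G 𝒢) (hH : IsLinearBasis H ℋ) (hiso : Isometric 𝒢 ℋ)
    {γ : Fin R → Matrix (Fin n) (Fin n) F} (hγ : ∀ i, γ i ∈ 𝒢) (hrigid : Rigid γ) :
    ∃ δ : ℕ → ℕ, (∀ i, δ i < q) ∧ ∀ δ' : ℕ → ℕ, (∀ i < 2 * R * m + n, δ' i = δ i) →
      Succeeds e n m R (extend G) (extend H) δ' := by
  obtain ⟨A, hA⟩ := isometric_iff.1 hiso
  set A₀ : Matrix (Fin n) (Fin n) F := (A : Matrix (Fin n) (Fin n) F) with hA₀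
  set D₀ : Matrix (Fin n) (Fin n) F := ((A⁻¹ : GL (Fin n) F) : Matrix (Fin n) (Fin n) F) with hD₀
  have hAD : A₀ * D₀ = 1 := by
    rw [hA₀, hD₀, ← Units.val_mul, mul_inv_cancel, Units.val_one]
  have hDA : D₀ * A₀ = 1 := mul_eq_one_comm.1 hAD
  have hmemH : ∀ M ∈ 𝒢, A₀ᵀ * M * A₀ ∈ ℋ := fun M hM => hA ▸ ⟨M, hM, rfl⟩
  have coeffs : ∀ {G : Fin m → Matrix (Fin n) (Fin n) F}
      {𝒢 : Submodule F (Matrix (Fin n) (Fin n) F)}, IsLinearBasis G 𝒢 → ∀ M ∈ 𝒢,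
      ∃ c : ℕ → F, ∑ j : Fin m, c j • G j = M := by
    intro G 𝒢 hG M hM
    rw [← hG.2, Submodule.mem_span_range_iff_exists_fun] at hM
    obtain ⟨c, hc⟩ := hM
    exact ⟨fun j => if h : j < m then c ⟨j, h⟩ else 0, by simpa using hc⟩
  have hp : ∀ i : ℕ, ∃ c : ℕ → F, ∀ h : i < R, ∑ j : Fin m, c j • G j = γ ⟨i, h⟩ := fun i => by
    by_cases h : i < R
    · obtain ⟨c, hc⟩ := coeffs hG _ (hγ ⟨i, h⟩)
      exact ⟨c, fun _ => hc⟩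
    · exact ⟨0, fun h' => absurd h' h⟩
  have hp' : ∀ i : ℕ, ∃ c : ℕ → F, ∀ h : i < R,
      ∑ j : Fin m, c j • H j = A₀ᵀ * γ ⟨i, h⟩ * A₀ := fun i => by
    by_cases h : i < R
    · obtain ⟨c, hc⟩ := coeffs hH _ (hmemH _ (hγ ⟨i, h⟩))
      exact ⟨c, fun _ => hc⟩
    · exact ⟨0, fun h' => absurd h' h⟩
  choose p hp using hp
  choose p' hp' using hp'
  refine ⟨encodeDigits e m R p p' (encodePair A₀ D₀), fun i => encodeDigits_lt _ _ _ i, ?_⟩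
  intro δ hδ u V hu hV
  set x₀ := encodePair A₀ D₀ with hx₀
  have hD₀' : D₀ = matD n x₀ := (matD_encodePair _ _).symm
  have hA₀' : A₀ = matA n x₀ := (matA_encodePair _ _).symm
  set v : ℕ → F := fun l => decode e (δ (2 * R * m + l)) with hv
  have hv' : ∀ l < n, v l = x₀ l := fun l hl => by
    simp only [hv]
    rw [hδ _ (by omega), encodeDigits_vec, decode_label]
  -- The equations in terms of matrices.
  have heq : ∀ x : ℕ → F, (∀ i < R, ∀ y < n, ∀ z < n, residual n
      (fun y z => ∑ j ∈ Finset.range m, decode e (δ (i * m + j)) * extend G j y z)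
      (fun y z => ∑ j ∈ Finset.range m, decode e (δ ((R + i) * m + j)) * extend H j y z)
        y z x = 0) ↔
      ∀ i : Fin R, (matA n x)ᵀ * γ i = A₀ᵀ * γ i * A₀ * matD n x := by
    intro x
    have hblock : ∀ i (hi : i < R), block n
        (fun y z => ∑ j ∈ Finset.range m, decode e (δ (i * m + j)) * extend G j y z) =
          γ ⟨i, hi⟩ := fun i hi => by
      rw [block_sum_extend G fun j => decode e (δ (i * m + j)), ← hp i hi]
      refine Finset.sum_congr rfl fun j _ => ?_
      rw [hδ _ (add_lt_digits (by omega) j.2), encodeDigits_fst _ _ _ hi j.2, decode_label]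
    have hblock' : ∀ i (hi : i < R), block n
        (fun y z => ∑ j ∈ Finset.range m, decode e (δ ((R + i) * m + j)) * extend H j y z) =
          A₀ᵀ * γ ⟨i, hi⟩ * A₀ := fun i hi => by
      rw [block_sum_extend H fun j => decode e (δ ((R + i) * m + j)), ← hp' i hi]
      refine Finset.sum_congr rfl fun j _ => ?_
      rw [hδ _ (add_lt_digits (by omega) j.2), encodeDigits_snd _ _ _ hi j.2, decode_label]
    constructor
    · intro h i
      have h1 := h i i.2
      rw [forall_residual_iff, hblock i i.2, hblock' i i.2] at h1
      · exact h1
      · rw [hblock i i.2]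
        exact transpose_eq_neg_of_mem_alternating (h𝒢 (hγ _))
    · intro h i hi
      rw [forall_residual_iff, hblock i hi, hblock' i hi]
      · exact h ⟨i, hi⟩
      · rw [hblock i hi]
        exact transpose_eq_neg_of_mem_alternating (h𝒢 (hγ _))
  have hx₀V : x₀ ∈ spanBelow (2 * (n * n)) V := by
    refine (hV x₀).2 ⟨mem_spanBelow_initVec_of_eq hu hn ?_ (fun l hl => (hv' l hl).symm)
      fun l hl => encodePair_eq_zero_of_le hl, (heq x₀).2 fun i => ?_⟩
    · calc n ≤ n * n := Nat.le_mul_self n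
        _ ≤ _ := by omega
    · rw [← hD₀', ← hA₀', Matrix.mul_assoc _ A₀, hAD, Matrix.mul_one]
  -- Every solution is a multiple of `x₀`.
  have huniq : ∀ x ∈ spanBelow (2 * (n * n)) V, ∃ c : F, x = c • x₀ := by
    intro x hx
    obtain ⟨h1, h2⟩ := (hV x).1 hx
    obtain ⟨h3, c, hc⟩ := mem_spanBelow_initVec h1
    rw [heq] at h2
    refine ⟨c, ?_⟩
    set A₁ := matA n x - c • A₀ with hA₁
    set D₁ := matD n x - c • D₀ with hD₁
    have h4 : ∀ i, A₁ᵀ * γ i = A₀ᵀ * γ i * A₀ * D₁ := fun i => by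
      rw [hA₁, hD₁, transpose_sub, transpose_smul, Matrix.sub_mul, Matrix.mul_sub, h2 i,
        Matrix.mul_smul, Matrix.mul_assoc _ A₀ D₀, hAD, Matrix.mul_one, Matrix.smul_mul]
    have h5 : D₁ *ᵥ Pi.single ⟨0, hn⟩ 1 = 0 := by
      rw [mulVec_single_one]
      funext k
      have h6 : x k = c * x₀ k := by rw [hc k k.2, hv' k k.2]
      rw [hD₁, hD₀']
      simp [col_apply, matD, h6]
    have hDAT : D₀ᵀ * A₀ᵀ = 1 := by rw [← transpose_mul, hAD, transpose_one]
    have hADT : A₀ᵀ * D₀ᵀ = 1 := mul_eq_one_comm.1 hDAT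
    obtain ⟨h6, h7⟩ := hrigid (Pi.single ⟨0, hn⟩ 1) (by simp) (D₀ᵀ * A₁ᵀ) (A₀ * D₁) (fun i => by
      rw [Matrix.mul_assoc, h4, ← Matrix.mul_assoc, ← Matrix.mul_assoc, ← Matrix.mul_assoc, hDAT,
        Matrix.one_mul, Matrix.mul_assoc]) (by
      rw [← mulVec_mulVec, h5, mulVec_zero])
    have h8 : A₁ = 0 := by
      have : A₀ᵀ * (D₀ᵀ * A₁ᵀ) = A₁ᵀ := by rw [← Matrix.mul_assoc, hADT, Matrix.one_mul]
      rw [h6, Matrix.mul_zero] at this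
      rw [← transpose_transpose A₁, ← this, transpose_zero]
    have h9 : D₁ = 0 := by
      have : D₀ * (A₀ * D₁) = D₁ := by rw [← Matrix.mul_assoc, hDA, Matrix.one_mul]
      rw [← this, h7, Matrix.mul_zero]
    refine eq_of_matA_eq_of_matD_eq (n := n) ?_ ?_ fun l hl => ?_
    · rw [hA₀'] at hA₁
      exact sub_eq_zero.1 (hA₁.symm.trans h8)
    · rw [hD₀'] at hD₁
      exact sub_eq_zero.1 (hD₁.symm.trans h9)
    · rw [h3 l hl ((Nat.le_mul_self n).trans (by omega)), Pi.smul_apply, hx₀,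
        encodePair_eq_zero_of_le hl, smul_zero]
  have hx₀0 : x₀ ≠ 0 := fun h => by
    have h1 : D₀ = 0 := by
      rw [hD₀', h]
      rfl
    rw [h1, Matrix.mul_zero] at hAD
    have := congrFun (congrFun hAD ⟨0, hn⟩) ⟨0, hn⟩
    simp at this
  obtain ⟨j, hj, hVj⟩ : ∃ j < 2 * (n * n), V j ≠ 0 := by
    by_contra! h
    refine hx₀0 ?_
    have : spanBelow (2 * (n * n)) V ≤ ⊥ := Submodule.span_le.2 fun y ⟨j, hj, hy⟩ => by
      rw [← hy, h j hj]
      exact zero_mem _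
    exact (Submodule.mem_bot F).1 (this hx₀V)
  obtain ⟨c, hc⟩ := huniq (V j) (Submodule.subset_span ⟨j, hj, rfl⟩)
  have hc0 : c ≠ 0 := fun h => hVj (by rw [hc, h, zero_smul])
  have hVA : matA n (V j) = c • A₀ := by
    rw [hc, hA₀']
    rfl
  have hVD : matD n (V j) = c • D₀ := by
    rw [hc, hD₀']
    rfl
  refine ⟨j, hj, ⟨c * c, mul_ne_zero hc0 hc0, ?_⟩, fun i hi => ?_⟩
  · intro y hy z hz
    have h1 : matA n (V j) * matD n (V j) = (c * c) • 1 := by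
      rw [hVA, hVD, Matrix.smul_mul, Matrix.mul_smul, hAD, smul_smul]
    have h2 := congrFun (congrFun h1 ⟨y, hy⟩) ⟨z, hz⟩
    rw [mul_apply, Matrix.smul_apply, one_apply, smul_eq_mul, mul_ite, mul_one, mul_zero] at h2
    rw [Finset.sum_range]
    simpa [matA, matD] using h2
  · obtain ⟨d, hd⟩ := coeffs hH _ (hmemH _ (hG.mem ⟨i, hi⟩))
    refine ⟨d, ?_⟩
    have h1 : block n (extend G i) = G ⟨i, hi⟩ := block_extend G ⟨i, hi⟩
    rw [forall_residual_iff, h1, block_sum_extend, hd, hVA, hVD, transpose_smul, Matrix.smul_mul,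
      Matrix.mul_smul, Matrix.mul_assoc _ A₀, hAD, Matrix.mul_one]
    rw [h1]
    exact transpose_eq_neg_of_mem_alternating (h𝒢 (hG.mem _))

end AltSpace

namespace AltSpace

open Matrix Module

/-! ### Tuples that are not rigid contract a subspace -/

variable {n R : ℕ} {F : Type} [Field F]

/-- The orthogonal complement with respect to the dot product. -/
def orthogonal (W : Submodule F (Fin n → F)) : Submodule F (Fin n → F) :=
  LinearMap.BilinForm.orthogonal (dotProductBilin F F) W

theorem mem_orthogonal {W : Submodule F (Fin n → F)} {z : Fin n → F} :
    z ∈ orthogonal W ↔ ∀ w ∈ W, w ⬝ᵥ z = 0 := Iff.rfl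

theorem finrank_orthogonal (W : Submodule F (Fin n → F)) :
    finrank F (orthogonal W) = n - finrank F W := by
  have hB : LinearMap.BilinForm.Nondegenerate
      (dotProductBilin F F : LinearMap.BilinForm F (Fin n → F)) := by
    refine ⟨fun x hx => dotProduct_eq_zero x fun y => hx y, fun x hx =>
      dotProduct_eq_zero x fun y => ?_⟩
    rw [dotProduct_comm]
    exact hx y
  rw [orthogonal, LinearMap.BilinForm.finrank_orthogonal hB, finrank_fin_fun]

/-- The subspaces are the kernels or the images of `Q` and `P`, where `P * g i = g i * Q`. -/
theorem exists_contracted {g : Fin R → Matrix (Fin n) (Fin n) F} (hg : ¬ Rigid g) :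
    ∃ U W : Submodule F (Fin n → F), U ≠ ⊥ ∧ finrank F W ≤ finrank F U ∧ finrank F W < n ∧
      ∀ i, ∀ u ∈ U, g i *ᵥ u ∈ W := by
  simp only [Rigid, not_forall] at hg
  obtain ⟨v, hv, P, Q, hPQ, hQv, hne⟩ := hg
  have hcomm : ∀ i x, P *ᵥ (g i *ᵥ x) = g i *ᵥ (Q *ᵥ x) := fun i x => by
    rw [mulVec_mulVec, mulVec_mulVec, hPQ]
  have hP := LinearMap.finrank_range_add_finrank_ker P.mulVecLin
  have hQ := LinearMap.finrank_range_add_finrank_ker Q.mulVecLin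
  rw [finrank_fin_fun] at hP hQ
  have hkerQ : LinearMap.ker Q.mulVecLin ≠ ⊥ := fun h => hv <| by
    have : v ∈ LinearMap.ker Q.mulVecLin := hQv
    rwa [h, Submodule.mem_bot] at this
  have hkerQ' := Submodule.one_le_finrank_iff.2 hkerQ
  have hrange : ∀ M : Matrix (Fin n) (Fin n) F, M ≠ 0 → LinearMap.range M.mulVecLin ≠ ⊥ :=
    fun M hM h => hM <| by
      rw [LinearMap.range_eq_bot] at h
      exact Matrix.mulVec_injective (funext fun x => by simpa using LinearMap.congr_fun h x)
  by_cases hQ0 : Q = 0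
  · have hP0 : P ≠ 0 := fun h => hne ⟨h, hQ0⟩
    have := Submodule.one_le_finrank_iff.2 (hrange P hP0)
    refine ⟨⊤, LinearMap.ker P.mulVecLin, ?_, ?_, by omega, fun i u _ => ?_⟩
    · exact fun h => hv (by simpa [h] using (Submodule.mem_top : v ∈ (⊤ : Submodule F _)))
    · rw [finrank_top, finrank_fin_fun]; omega
    · rw [LinearMap.mem_ker, mulVecLin_apply, hcomm, hQ0, zero_mulVec, mulVec_zero]
  · by_cases hr : finrank F (LinearMap.range P.mulVecLin) ≤ finrank F (LinearMap.range Q.mulVecLin)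
    · refine ⟨LinearMap.range Q.mulVecLin, LinearMap.range P.mulVecLin, hrange Q hQ0, hr,
        by omega, ?_⟩
      rintro i _ ⟨x, rfl⟩
      exact ⟨g i *ᵥ x, hcomm i x⟩
    · refine ⟨LinearMap.ker Q.mulVecLin, LinearMap.ker P.mulVecLin, hkerQ, by omega, by omega, ?_⟩
      intro i u hu
      rw [LinearMap.mem_ker, mulVecLin_apply] at hu ⊢
      rw [hcomm, hu, mulVec_zero]

/-- Alternating matrices that map `U` into `W` also map the complement of `W` into the complement
of `U`. -/
theorem mulVec_mem_orthogonal {A : Matrix (Fin n) (Fin n) F} (hA : A ∈ alternating n F)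
    {U W : Submodule F (Fin n → F)} (h : ∀ u ∈ U, A *ᵥ u ∈ W) {z : Fin n → F}
    (hz : z ∈ orthogonal W) : A *ᵥ z ∈ orthogonal U := by
  rw [mem_orthogonal] at hz ⊢
  intro u hu
  have h1 := hz _ (h u hu)
  rw [dotProduct_mulVec, ← mulVec_transpose, transpose_eq_neg_of_mem_alternating hA, neg_mulVec,
    neg_dotProduct, h1, neg_zero]

/-- A pair of subspaces as in `exists_contracted` may be chosen with `2 * dim W ≤ n`, by passing to
the orthogonal complements; subspaces of the dimensions `a` and `2 * a` are then found inside `U`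
and around `W`. -/
theorem exists_small_contracted {g : Fin R → Matrix (Fin n) (Fin n) F} (hg : ¬ Rigid g)
    (halt : ∀ i, g i ∈ alternating n F) :
    ∃ a, 1 ≤ a ∧ 4 * a ≤ n + 3 ∧ ∃ (u : Fin a → Fin n → F) (w : Fin (2 * a) → Fin n → F),
      LinearIndependent F u ∧ ∀ i j, g i *ᵥ u j ∈ Submodule.span F (Set.range w) := by
  have key : ∃ U W : Submodule F (Fin n → F), U ≠ ⊥ ∧ finrank F W ≤ finrank F U ∧
      2 * finrank F W ≤ n ∧ ∀ i, ∀ u ∈ U, g i *ᵥ u ∈ W := by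
    obtain ⟨U, W, hU, hWU, hW, hgU⟩ := exists_contracted hg
    by_cases h2 : 2 * finrank F W ≤ n
    · exact ⟨U, W, hU, hWU, h2, hgU⟩
    · refine ⟨orthogonal W, orthogonal U, ?_, ?_, ?_, fun i z hz =>
        mulVec_mem_orthogonal (halt i) (hgU i) hz⟩
      · rw [← Submodule.one_le_finrank_iff, finrank_orthogonal]; omega
      all_goals simp only [finrank_orthogonal]; omega
  obtain ⟨U, W, hU, hWU, h2, hgU⟩ := key
  have hU1 := Submodule.one_le_finrank_iff.2 hU
  obtain ⟨a, ha⟩ : ∃ a, a = max 1 ((finrank F W + 1) / 2) := ⟨_, rfl⟩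
  have haU : a ≤ finrank F U := by omega
  have hUn : finrank F U ≤ n := by simpa using Submodule.finrank_le U
  have haW : finrank F W ≤ 2 * a := by omega
  refine ⟨a, by omega, by omega, ?_⟩
  obtain ⟨u, hu⟩ := exists_linearIndependent_of_le_finrank haU
  have hbasis := Submodule.exists_fun_fin_finrank_span_eq F (W : Set (Fin n → F))
  rw [Submodule.span_eq] at hbasis
  obtain ⟨f, -, hspan, -⟩ := hbasis
  refine ⟨fun j => u j, fun k => if h : (k : ℕ) < finrank F W then f ⟨k, h⟩ else 0,
    hu.map' U.subtype U.ker_subtype, fun i j => ?_⟩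
  refine Submodule.span_mono ?_ (hspan.symm ▸ hgU i _ (u j).2 : g i *ᵥ (u j : Fin n → F) ∈
    Submodule.span F (Set.range f))
  rintro _ ⟨k, rfl⟩
  exact ⟨⟨k, by omega⟩, by simp⟩

end AltSpace

namespace AltSpace

open Matrix Module

/-! ### Few alternating matrices contract a given subspace -/

section Contraction

variable {n a b R : ℕ} {F : Type} [Field F]

theorem exists_dual_vectors {u : Fin a → Fin n → F} (hu : LinearIndependent F u) :
    ∃ s : Fin a → Fin n → F, ∀ j k, s j ⬝ᵥ u k = if j = k then 1 else 0 := by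
  obtain ⟨p, hp⟩ := (Fintype.linearCombination F u).exists_leftInverse_of_injective
    (LinearMap.ker_eq_bot.2 hu.fintypeLinearCombination_injective)
  refine ⟨fun j => (dotProductEquiv F (Fin n)).symm (LinearMap.proj j ∘ₗ p), fun j k => ?_⟩
  have h1 := congrFun (LinearMap.congr_fun hp (Pi.single k 1)) j
  have h2 := LinearMap.congr_fun ((dotProductEquiv F (Fin n)).apply_symm_apply
    (LinearMap.proj j ∘ₗ p)) (u k)
  rw [dotProductEquiv_apply_apply] at h2
  rw [h2]
  simpa [Pi.single_apply] using h1

/-- The alternating matrix `∑ j, (f j * (s j)ᵀ - s j * (f j)ᵀ)`. -/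
def alternatingOfVectors (s : Fin a → Fin n → F) : (Fin a → Fin n → F) →ₗ[F] alternating n F where
  toFun f := ⟨∑ j, (vecMulVec (f j) (s j) - vecMulVec (s j) (f j)),
    Submodule.sum_mem _ fun j _ => by
    intro x
    simp only [sub_mulVec, vecMulVec_mulVec, dotProduct_sub, op_smul_eq_smul, dotProduct_smul,
      smul_eq_mul]
    rw [dotProduct_comm x, dotProduct_comm x]
    ring⟩
  map_add' f g := by
    ext1
    simp only [Pi.add_apply, add_vecMulVec, vecMulVec_add, Submodule.coe_add,
      ← Finset.sum_add_distrib]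
    exact Finset.sum_congr rfl fun j _ => by abel
  map_smul' c f := by
    ext1
    simp only [Pi.smul_apply, smul_vecMulVec, vecMulVec_smul, Submodule.coe_smul, Finset.smul_sum,
      smul_sub, RingHom.id_apply]

theorem alternatingOfVectors_mulVec {s u f : Fin a → Fin n → F}
    (hs : ∀ j k, s j ⬝ᵥ u k = if j = k then 1 else 0) (hf : ∀ j k, f j ⬝ᵥ u k = 0) (k : Fin a) :
    (alternatingOfVectors s f : Matrix (Fin n) (Fin n) F) *ᵥ u k = f k := by
  simp only [alternatingOfVectors, LinearMap.coe_mk, AddHom.coe_mk, sum_mulVec, sub_mulVec,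
    vecMulVec_mulVec, op_smul_eq_smul, hs, hf, zero_smul, sub_zero, ite_smul, one_smul,
    Finset.sum_ite_eq', Finset.mem_univ, if_true]

/-- The alternating matrices that map the vectors `u j` into the span of the vectors `w k`. -/
def contracting (u : Fin a → Fin n → F) (w : Fin b → Fin n → F) :
    Submodule F (alternating n F) where
  carrier := {A | ∀ j, (A : Matrix (Fin n) (Fin n) F) *ᵥ u j ∈ Submodule.span F (Set.range w)}
  add_mem' {A B} hA hB j := by
    rw [Submodule.coe_add, add_mulVec]
    exact Submodule.add_mem _ (hA j) (hB j)
  zero_mem' j := by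
    rw [Submodule.coe_zero, zero_mulVec]
    exact Submodule.zero_mem _
  smul_mem' c A hA j := by
    rw [Submodule.coe_smul, smul_mulVec]
    exact Submodule.smul_mem _ _ (hA j)

/-- The images of the `u j` under an alternating matrix may be any vectors in the orthogonal
complement of the `u j`, and the subspace spanned by `w` contains few of these. -/
theorem finrank_contracting_add_le {u : Fin a → Fin n → F} (hu : LinearIndependent F u)
    (w : Fin b → Fin n → F) :
    finrank F (contracting u w) + a * (n - a) ≤ finrank F (alternating n F) + a * b := by
  obtain ⟨s, hs⟩ := exists_dual_vectors hu
  let O := orthogonal (Submodule.span F (Set.range u))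
  have hO : finrank F O = n - a := by
    rw [finrank_orthogonal, finrank_span_eq_card hu, Fintype.card_fin]
  let Ψ : (Fin a → O) →ₗ[F] alternating n F :=
    alternatingOfVectors s ∘ₗ LinearMap.compLeft O.subtype (Fin a)
  have hΨ : ∀ f k, (Ψ f : Matrix (Fin n) (Fin n) F) *ᵥ u k = f k := fun f k =>
    alternatingOfVectors_mulVec (f := fun j => (f j : Fin n → F)) hs (fun i j => by
      rw [dotProduct_comm]
      exact (f i).2 _ (Submodule.subset_span ⟨j, rfl⟩)) k
  have hinj : Function.Injective Ψ := fun f g hfg => by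
    funext k
    exact Subtype.ext (by rw [← hΨ, ← hΨ, hfg])
  have hrange : finrank F (LinearMap.range Ψ) = a * (n - a) := by
    rw [LinearMap.finrank_range_of_inj hinj, finrank_pi_fintype]
    simp [hO]
  have hinf : finrank F ↥(contracting u w ⊓ LinearMap.range Ψ) ≤ a * b := by
    let T : ↥(contracting u w ⊓ LinearMap.range Ψ) →ₗ[F]
        (Fin a → Submodule.span F (Set.range w)) :=
      { toFun := fun A j => ⟨(A : Matrix (Fin n) (Fin n) F) *ᵥ u j, A.2.1 j⟩
        map_add' := fun A B => funext fun j => Subtype.ext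
          (add_mulVec (A : Matrix (Fin n) (Fin n) F) (B : Matrix (Fin n) (Fin n) F) (u j))
        map_smul' := fun c A => funext fun j =>
          Subtype.ext (smul_mulVec c (A : Matrix (Fin n) (Fin n) F) (u j)) }
    have hT : Function.Injective T := by
      rintro ⟨A, hA, f, rfl⟩ ⟨B, hB, g, rfl⟩ hAB
      have : f = g := funext fun j => Subtype.ext <| by
        rw [← hΨ, ← hΨ]
        exact congrArg Subtype.val (congrFun hAB j)
      simp [this]
    refine (LinearMap.finrank_le_finrank_of_injective hT).trans ?_
    rw [finrank_pi_fintype, Finset.sum_const, Finset.card_univ, Fintype.card_fin, smul_eq_mul]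
    exact Nat.mul_le_mul_left _ ((finrank_range_le_card w).trans (by simp))
  have h1 := Submodule.finrank_sup_add_finrank_inf_eq (contracting u w) (LinearMap.range Ψ)
  have h2 := Submodule.finrank_le (contracting u w ⊔ LinearMap.range Ψ)
  omega

theorem mul_le_finrank_alternating (ha : a ≤ n) :
    a * (n - a) ≤ finrank F (alternating n F) := by
  obtain ⟨u, hu⟩ := exists_linearIndependent_of_le_finrank (R := F) (M := Fin n → F)
    (n := a) (by simpa using ha)
  have := finrank_contracting_add_le hu (b := 0) Fin.elim0
  omega

end Contraction

/-! ### Few tuples are not rigid -/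

section Counting

variable {n R : ℕ} {F : Type} [Field F]

/-- The tuples of alternating matrices that are not rigid. -/
def nonrigid (n R : ℕ) (F : Type) [Field F] : Set (Fin R → alternating n F) :=
  {g | ¬ Rigid fun i => (g i : Matrix (Fin n) (Fin n) F)}

variable [Fintype F]

/-- At most a fraction `n / q ^ n` of the tuples is not rigid: union bound over the vectors that a
tuple contracts. -/
theorem ncard_nonrigid_mul_le (hn : 45 ≤ n) :
    (nonrigid n 20 F).ncard * Fintype.card F ^ n ≤
      n * (Fintype.card F ^ finrank F (alternating n F)) ^ 20 := by
  set q := Fintype.card F with hq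
  set N := finrank F (alternating n F) with hN
  have hq0 : 0 < q := Fintype.card_pos
  have hqV : ∀ a, Nat.card (Fin a → Fin n → F) = q ^ (n * a) := fun a => by
    rw [Nat.card_fun, Nat.card_fun, Nat.card_fin, Nat.card_fin, Nat.card_eq_fintype_card, pow_mul]
  let S (a : ℕ) (p : (Fin a → Fin n → F) × (Fin (2 * a) → Fin n → F)) :
      Set (Fin 20 → alternating n F) :=
    {g | (1 ≤ a ∧ LinearIndependent F p.1) ∧ ∀ i, g i ∈ contracting p.1 p.2}
  have hS : ∀ a, 4 * a ≤ n + 3 → ∀ p, (S a p).ncard * q ^ (3 * (n * a) + n) ≤ (q ^ N) ^ 20 := by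
    intro a ha p
    by_cases hp : 1 ≤ a ∧ LinearIndependent F p.1
    · have h1 : (S a p).ncard ≤ (q ^ finrank F (contracting p.1 p.2)) ^ 20 := by
        let φ : (Fin 20 → contracting p.1 p.2) → (Fin 20 → alternating n F) := fun f i => f i
        have h2 : S a p ⊆ Set.range φ := fun g hg => ⟨fun i => ⟨g i, hg.2 i⟩, rfl⟩
        refine (Set.ncard_le_ncard h2 (Set.toFinite _)).trans ?_
        rw [← Set.image_univ]
        refine (Set.ncard_image_le (Set.toFinite _)).trans ?_
        rw [Set.ncard_univ, Nat.card_fun, Nat.card_fin, natCard_eq_pow_finrank (K := F),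
          Nat.card_eq_fintype_card]
      refine (Nat.mul_le_mul_right _ h1).trans ?_
      rw [← pow_mul, ← pow_mul, ← pow_add]
      refine Nat.pow_le_pow_right hq0 ?_
      have h3 := finrank_contracting_add_le hp.2 p.2
      -- Each of the `20` entries loses `a * (n - 3 * a)` dimensions, which is about `a * n / 4`.
      obtain ⟨d, hd⟩ : ∃ d, n = 3 * a + d := ⟨n - 3 * a, by omega⟩
      have h4 : n - a = 2 * a + d := by omega
      rw [h4] at h3
      have h5 : n * 4 ≤ d * 20 := by omega
      nlinarith [Nat.mul_le_mul_left a h5, Nat.mul_le_mul_right n hp.1]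
    · have : S a p = ∅ := Set.eq_empty_of_forall_notMem fun g hg => hp hg.1
      rw [this, Set.ncard_empty, zero_mul]
      exact Nat.zero_le _
  have hU : ∀ a, 4 * a ≤ n + 3 → (⋃ p, S a p).ncard * q ^ n ≤ (q ^ N) ^ 20 := by
    intro a ha
    have h1 := Set.ncard_iUnion_le_of_fintype (S a)
    have h2 : q ^ (3 * (n * a)) = Nat.card ((Fin a → Fin n → F) × (Fin (2 * a) → Fin n → F)) := by
      rw [Nat.card_prod, hqV, hqV, ← pow_add]
      congr 1
      ring
    have h3 : (⋃ p, S a p).ncard * q ^ n * q ^ (3 * (n * a)) ≤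
        (q ^ N) ^ 20 * q ^ (3 * (n * a)) := calc
      _ ≤ (∑ p, (S a p).ncard) * q ^ n * q ^ (3 * (n * a)) :=
        Nat.mul_le_mul_right _ (Nat.mul_le_mul_right _ h1)
      _ = ∑ p, (S a p).ncard * q ^ (3 * (n * a) + n) := by
        rw [mul_assoc, ← pow_add, add_comm n, Finset.sum_mul]
      _ ≤ ∑ p : (Fin a → Fin n → F) × (Fin (2 * a) → Fin n → F), (q ^ N) ^ 20 :=
        Finset.sum_le_sum fun p _ => hS a ha p
      _ = (q ^ N) ^ 20 * q ^ (3 * (n * a)) := by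
        rw [Finset.sum_const, Finset.card_univ, ← Nat.card_eq_fintype_card, ← h2, smul_eq_mul,
          mul_comm]
    exact Nat.le_of_mul_le_mul_right h3 (Nat.pow_pos hq0)
  have hsub : nonrigid n 20 F ⊆ ⋃ a : Fin n, if 4 * (a : ℕ) ≤ n + 3 then ⋃ p, S a p else ∅ := by
    intro g hg
    obtain ⟨a, ha, ha', u, w, hu, hw⟩ := exists_small_contracted hg fun i => (g i).2
    simp only [Set.mem_iUnion]
    refine ⟨⟨a, by omega⟩, ?_⟩
    rw [if_pos ha', Set.mem_iUnion]
    exact ⟨(u, w), ⟨ha, hu⟩, fun i j => hw i j⟩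
  calc (nonrigid n 20 F).ncard * q ^ n
    _ ≤ (∑ a : Fin n, (if 4 * (a : ℕ) ≤ n + 3 then ⋃ p, S a p else ∅).ncard) * q ^ n :=
      Nat.mul_le_mul_right _ ((Set.ncard_le_ncard hsub (Set.toFinite _)).trans
        (Set.ncard_iUnion_le_of_fintype _))
    _ = ∑ a : Fin n, (if 4 * (a : ℕ) ≤ n + 3 then ⋃ p, S a p else ∅).ncard * q ^ n :=
      Finset.sum_mul _ _ _
    _ ≤ ∑ a : Fin n, (q ^ N) ^ 20 := Finset.sum_le_sum fun a _ => by
      split_ifs with ha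
      · exact hU a ha
      · simp
    _ = n * (q ^ N) ^ 20 := by simp

end Counting

end AltSpace

namespace AltSpace

open Module

/-! ### Subspaces all of whose tuples lie in a small set -/

section Subspaces

variable {F V : Type} [Field F] [Fintype F] [AddCommGroup V] [Module F V] [Finite V]

/-- At least half of all `m`-tuples in a space of dimension `N > m` are linearly independent. -/
theorem pow_mul_le_two_mul_prod {q N m : ℕ} (hq : 2 ≤ q) (hm : m + 1 ≤ N) :
    (q ^ N) ^ m ≤ 2 * ∏ i : Fin m, (q ^ N - q ^ (i : ℕ)) := by
  have key : ∀ k ≤ m, (q ^ N) * (q ^ N) ^ k ≤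
      (∏ i ∈ Finset.range k, (q ^ N - q ^ i)) * q ^ N + (q ^ N) ^ k * q ^ k := by
    intro k
    induction k with
    | zero => intro _; simp
    | succ k ih =>
      intro hk
      have h1 := ih (by omega)
      have h2 : q ^ k ≤ q ^ N := Nat.pow_le_pow_right (by omega) (by omega)
      rw [Finset.prod_range_succ]
      obtain ⟨d, hd⟩ := Nat.exists_eq_add_of_le h2
      rw [pow_succ _ k, pow_succ q k, hd, Nat.add_sub_cancel_left, ← hd]
      generalize ∏ i ∈ Finset.range k, (q ^ N - q ^ i) = p at *
      generalize (q ^ N) ^ k = Y at *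
      generalize q ^ k = x at *
      generalize q ^ N = y at *
      subst hd
      have h3 := Nat.mul_le_mul_right d h1
      have h4 := Nat.mul_le_mul_left (Y * (x + d) * x) hq
      nlinarith [Nat.zero_le (Y * x * x)]
  have h1 := key m le_rfl
  have h2 : 2 * q ^ m ≤ q ^ N := calc
    2 * q ^ m ≤ q ^ m * q := by rw [mul_comm]; exact Nat.mul_le_mul_left _ hq
    _ = q ^ (m + 1) := (pow_succ q m).symm
    _ ≤ q ^ N := Nat.pow_le_pow_right (by omega) hm
  rw [Finset.prod_range] at h1
  have h3 : 0 < q ^ N := Nat.pow_pos (by omega)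
  refine Nat.le_of_mul_le_mul_left (c := q ^ N) ?_ h3
  have h4 := Nat.mul_le_mul_left ((q ^ N) ^ m) h2
  linarith

/-- The number of linear bases of an `m`-dimensional space over a field of order `q`. -/
def numBases (q m : ℕ) : ℕ := ∏ i : Fin m, (q ^ m - q ^ (i : ℕ))

theorem numBases_pos {q m : ℕ} (hq : 2 ≤ q) : 0 < numBases q m :=
  Finset.prod_pos fun i _ => Nat.sub_pos_of_lt (Nat.pow_lt_pow_right hq i.2)

theorem ncard_bases (W : Submodule F V) :
    {s : Fin (finrank F W) → V | LinearIndependent F s ∧ Submodule.span F (Set.range s) = W}.ncard =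
      numBases (Fintype.card F) (finrank F W) := by
  have : Module.Finite F V := .of_finite
  rw [numBases, ← card_linearIndependent (K := F) (V := W) le_rfl, ← Nat.card_coe_set_eq]
  symm
  refine Nat.card_congr (Equiv.ofBijective (fun t => ⟨fun i => t.1 i,
    t.2.map' W.subtype W.ker_subtype, ?_⟩) ⟨fun s t h => ?_, ?_⟩)
  · have h := t.2.span_eq_top_of_card_eq_finrank' (Fintype.card_fin _)
    have h1 := congrArg (Submodule.map W.subtype) h
    rw [Submodule.map_span, ← Set.range_comp, Submodule.map_subtype_top] at h1
    exact h1
  · refine Subtype.ext (funext fun i => Subtype.ext ?_)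
    exact congrFun (congrArg Subtype.val h) i
  · rintro ⟨s, hs, hsW⟩
    refine ⟨⟨fun i => ⟨s i, ?_⟩, ?_⟩, rfl⟩
    · exact hsW.le (Submodule.subset_span ⟨i, rfl⟩)
    · exact LinearIndependent.of_comp W.subtype hs

/-- The linear bases of the members of a set of `m`-dimensional subspaces. -/
theorem ncard_mul_numBases {m : ℕ} {𝒮 : Set (Submodule F V)} (h𝒮 : ∀ W ∈ 𝒮, finrank F W = m) :
    𝒮.ncard * numBases (Fintype.card F) m =
      {s : Fin m → V | LinearIndependent F s ∧ Submodule.span F (Set.range s) ∈ 𝒮}.ncard := by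
  classical
  have : Fintype V := Fintype.ofFinite V
  have : Fintype (Submodule F V) := Fintype.ofFinite _
  rw [Set.ncard_eq_toFinset_card', Set.ncard_eq_toFinset_card',
    Finset.card_eq_sum_card_fiberwise (f := fun s => Submodule.span F (Set.range s))
      (t := 𝒮.toFinset),
    Finset.sum_const_nat (m := numBases (Fintype.card F) m)]
  · intro W hW
    rw [Set.mem_toFinset] at hW
    obtain rfl := h𝒮 W hW
    rw [← ncard_bases W, Set.ncard_eq_toFinset_card']
    congr 1
    ext s
    simp only [Finset.mem_filter, Set.mem_toFinset, Set.mem_ofPred_eq]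
    constructor
    · rintro ⟨⟨h1, -⟩, h2⟩
      exact ⟨h1, h2⟩
    · rintro ⟨h1, h2⟩
      exact ⟨⟨h1, h2.symm ▸ hW⟩, h2⟩
  · intro s hs
    simp only [Finset.mem_coe, Set.mem_toFinset, Set.mem_ofPred_eq] at hs ⊢
    exact hs.2

theorem ncard_initial_mem {R r : ℕ} (B : Set (Fin R → V)) :
    {s : Fin (R + r) → V | (fun i => s (Fin.castAdd r i)) ∈ B}.ncard =
      B.ncard * (Fintype.card F ^ finrank F V) ^ r := by
  have h : {s : Fin (R + r) → V | (fun i => s (Fin.castAdd r i)) ∈ B} =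
      Fin.appendEquiv R r '' (B ×ˢ Set.univ) := by
    ext s
    rw [Equiv.image_eq_preimage_symm]
    simp [Fin.appendEquiv]
  rw [h, Set.ncard_image_of_injective _ (Equiv.injective _), Set.ncard_prod, Set.ncard_univ,
    Nat.card_fun, Nat.card_fin, natCard_eq_pow_finrank (K := F), Nat.card_eq_fintype_card]

/-- If a set of `R`-tuples has density `ε`, then the subspaces of dimension `m` that have all their
`R`-tuples in this set have density at most `2 * ε`: count the linear bases of these subspaces by
their first `R` members. -/
theorem ncard_subspaces_mul_le {R m : ℕ} (B : Set (Fin R → V)) (hR : R ≤ m)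
    (hm : m + 1 ≤ finrank F V) :
    {W : Submodule F V | finrank F W = m ∧ ∀ γ : Fin R → V, (∀ i, γ i ∈ W) → γ ∈ B}.ncard *
        (Fintype.card F ^ finrank F V) ^ R ≤
      2 * B.ncard * {W : Submodule F V | finrank F W = m}.ncard := by
  have : Module.Finite F V := .of_finite
  obtain ⟨r, rfl⟩ := Nat.exists_eq_add_of_le hR
  set Bad := {W : Submodule F V | finrank F W = R + r ∧
    ∀ γ : Fin R → V, (∀ i, γ i ∈ W) → γ ∈ B}
  set All := {W : Submodule F V | finrank F W = R + r}
  set y := Fintype.card F ^ finrank F V with hy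
  have hq : 2 ≤ Fintype.card F := Fintype.one_lt_card
  have hβ := numBases_pos (m := R + r) hq
  set β := numBases (Fintype.card F) (R + r)
  have hBad : Bad.ncard * β ≤ B.ncard * y ^ r := by
    rw [ncard_mul_numBases fun W hW => hW.1, ← ncard_initial_mem (F := F)]
    refine Set.ncard_le_ncard (fun s hs => ?_) (Set.toFinite _)
    exact hs.2.2 _ fun i => Submodule.subset_span ⟨_, rfl⟩
  have hAll : y ^ (R + r) ≤ 2 * (All.ncard * β) := by
    refine (pow_mul_le_two_mul_prod hq hm).trans (le_of_eq ?_)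
    rw [← card_linearIndependent (by omega : R + r ≤ finrank F V),
      ncard_mul_numBases (𝒮 := All) fun W hW => hW,
      ← Nat.card_coe_set_eq]
    congr 1
    refine Nat.card_congr (Equiv.subtypeEquivRight fun s => ⟨fun h => ⟨h, ?_⟩, fun h => h.1⟩)
    exact (finrank_span_eq_card h).trans (Fintype.card_fin _)
  refine Nat.le_of_mul_le_mul_right ?_ hβ
  calc Bad.ncard * y ^ R * β = Bad.ncard * β * y ^ R := by ring
    _ ≤ B.ncard * y ^ r * y ^ R := Nat.mul_le_mul_right _ hBad
    _ = B.ncard * y ^ (R + r) := by rw [pow_add]; ring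
    _ ≤ B.ncard * (2 * (All.ncard * β)) := Nat.mul_le_mul_left _ hAll
    _ = 2 * B.ncard * All.ncard * β := by ring

end Subspaces

/-! ### Almost all alternating spaces contain a rigid tuple -/

section LinER

variable {n m : ℕ} {F : Type} [Field F] [Fintype F]

theorem ncard_nonrigid_spaces_mul_le (hn : 45 ≤ n) (hm : 20 ≤ m)
    (hmn : m + 1 ≤ finrank F (alternating n F)) :
    {𝒢 ∈ LinER n m F | ∀ γ : Fin 20 → Matrix (Fin n) (Fin n) F, (∀ i, γ i ∈ 𝒢) → ¬ Rigid γ}.ncard *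
      Fintype.card F ^ n ≤ 2 * n * (LinER n m F).ncard := by
  set Λ := alternating n F with hΛ
  set y := Fintype.card F ^ finrank F Λ with hy
  set Bad := {W : Submodule F Λ | finrank F W = m ∧
    ∀ γ : Fin 20 → Λ, (∀ i, γ i ∈ W) → γ ∈ nonrigid n 20 F}
  set All := {W : Submodule F Λ | finrank F W = m}
  have hinj : Function.Injective (Submodule.map Λ.subtype) :=
    Submodule.map_injective_of_injective Λ.injective_subtype
  have hbad : {𝒢 ∈ LinER n m F | ∀ γ : Fin 20 → Matrix (Fin n) (Fin n) F,
      (∀ i, γ i ∈ 𝒢) → ¬ Rigid γ} ⊆ Submodule.map Λ.subtype '' Bad := by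
    rintro 𝒢 ⟨⟨h1, h2⟩, h3⟩
    have h4 : Submodule.map Λ.subtype (Submodule.comap Λ.subtype 𝒢) = 𝒢 := by
      rw [Submodule.map_comap_subtype, inf_eq_right.2 h1]
    refine ⟨Submodule.comap Λ.subtype 𝒢, ⟨?_, fun γ hγ => h3 _ hγ⟩, h4⟩
    rw [← Submodule.finrank_map_subtype_eq, h4, h2]
  have hall : Submodule.map Λ.subtype '' All ⊆ LinER n m F := by
    rintro _ ⟨W, hW, rfl⟩
    exact ⟨Submodule.map_subtype_le _ _, (Submodule.finrank_map_subtype_eq _ _).trans hW⟩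
  have h1 : {𝒢 ∈ LinER n m F | ∀ γ : Fin 20 → Matrix (Fin n) (Fin n) F,
      (∀ i, γ i ∈ 𝒢) → ¬ Rigid γ}.ncard ≤ Bad.ncard := by
    refine (Set.ncard_le_ncard hbad (Set.toFinite _)).trans ?_
    rw [Set.ncard_image_of_injective _ hinj]
  have h2 : All.ncard ≤ (LinER n m F).ncard := by
    rw [← Set.ncard_image_of_injective All hinj]
    exact Set.ncard_le_ncard hall (Set.toFinite _)
  have h3 := ncard_subspaces_mul_le (F := F) (nonrigid n 20 F) hm hmn
  have h4 := ncard_nonrigid_mul_le (F := F) hn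
  have hy0 : 0 < y ^ 20 := Nat.pow_pos (Nat.pow_pos Fintype.card_pos)
  refine Nat.le_of_mul_le_mul_right ?_ hy0
  calc _ ≤ Bad.ncard * Fintype.card F ^ n * y ^ 20 :=
        Nat.mul_le_mul_right _ (Nat.mul_le_mul_right _ h1)
    _ = Bad.ncard * y ^ 20 * Fintype.card F ^ n := by ring
    _ ≤ 2 * (nonrigid n 20 F).ncard * All.ncard * Fintype.card F ^ n := Nat.mul_le_mul_right _ h3
    _ = 2 * All.ncard * ((nonrigid n 20 F).ncard * Fintype.card F ^ n) := by ring
    _ ≤ 2 * All.ncard * (n * y ^ 20) := Nat.mul_le_mul_left _ h4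
    _ ≤ 2 * (LinER n m F).ncard * (n * y ^ 20) :=
        Nat.mul_le_mul_right _ (Nat.mul_le_mul_left _ h2)
    _ = 2 * n * (LinER n m F).ncard * y ^ 20 := by ring

end LinER

end AltSpace

namespace AltSpace

open RAM

/-! ### The machine's input -/

section Input

variable {n m m' q : ℕ} {F : Type} [Field F]

theorem getD_ofFn_mkDivMod {a b : ℕ} (f : Fin (a * b) → ℕ) (i : Fin a) (j : Fin b) :
    (List.ofFn f).getD (i * b + j) 0 = f (Fin.mkDivMod i j) := by
  have h : (i : ℕ) * b + j = (Fin.mkDivMod i j : Fin (a * b)) := by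
    rw [Fin.coe_mkDivMod, mul_comm]
  rw [h, List.getD_eq_getElem?_getD, List.getElem?_ofFn, dif_pos (Fin.is_lt _), Option.getD_some]

theorem getD_opTable {F : Type} (e : F ≃ Fin q) (op : F → F → F) (x y : F) :
    (opTable e op).getD ((e x : ℕ) * q + e y) 0 = e (op x y) := by
  rw [opTable, getD_ofFn_mkDivMod, Fin.divNat_mkDivMod, Fin.modNat_mkDivMod, e.symm_apply_apply,
    e.symm_apply_apply]

theorem getD_tupleEntries (e : F ≃ Fin q) (G : Fin m → Matrix (Fin n) (Fin n) F) {i x y : ℕ}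
    (hi : i < m) (hx : x < n) (hy : y < n) :
    (tupleEntries e G).getD ((i * n + x) * n + y) 0 = e (extend G i x y) := by
  have h : (i * n + x) * n + y = i * (n * n) + (Fin.mkDivMod ⟨x, hx⟩ ⟨y, hy⟩ : Fin (n * n)) := by
    rw [Fin.coe_mkDivMod]
    ring
  rw [h]
  refine (getD_ofFn_mkDivMod _ ⟨i, hi⟩ _).trans ?_
  rw [Fin.divNat_mkDivMod, Fin.modNat_mkDivMod, Fin.divNat_mkDivMod, Fin.modNat_mkDivMod, extend,
    dif_pos ⟨hi, hx, hy⟩]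

theorem holdsTuple_input_left (e : F ≃ Fin q) (G : Fin m → Matrix (Fin n) (Fin n) F)
    (H : Fin m' → Matrix (Fin n) (Fin n) F) : HoldsTuple e n 2 m (extend G) (input e G H) :=
  fun _ hi _ hx _ hy => getD_tupleEntries e G hi hx hy

theorem holdsTuple_input_right (e : F ≃ Fin q) (G : Fin m → Matrix (Fin n) (Fin n) F)
    (H : Fin m' → Matrix (Fin n) (Fin n) F) : HoldsTuple e n 3 m' (extend H) (input e G H) :=
  fun _ hi _ hx _ hy => getD_tupleEntries e H hi hx hy

end Input

/-! ### Correctness and running time -/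

section Final

variable {n m R B T : ℕ} {F : Type} [Field F] [Fintype F]

theorem testsIsometryTo_of_rigid (hn : 0 < n) (hR : 1 ≤ R) (hqB : Fintype.card F ≤ B)
    (hNB : 2 * (n * n) ≤ B) (hrow : (m + R + 1) * n ≤ B) (hRB : 2 * R ≤ B)
    (hL : Fintype.card F ^ (2 * R * m + n) ≤ B) (hT : (isometryTest R).timeBound B ≤ T)
    {𝒢 : Submodule F (Matrix (Fin n) (Fin n) F)} (h𝒢 : 𝒢 ∈ LinER n m F)
    {γ : Fin R → Matrix (Fin n) (Fin n) F} (hγ : ∀ i, γ i ∈ 𝒢) (hrigid : Rigid γ) :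
    TestsIsometryTo (isometryTest R) T 𝒢 := by
  intro ℋ _ e m₁ m₂ G H hG hH
  obtain rfl : m₁ = m := hG.finrank_eq.symm.trans h𝒢.2
  rcases eq_or_ne m₁ m₂ with rfl | hne
  · obtain ⟨s, t, hrun, ht, hs⟩ := halts_isometryTest (e := e) (s := input e G H)
      Fintype.one_lt_card hn hR hqB hNB hrow hRB hL rfl rfl rfl rfl (getD_opTable e (· + ·))
      (getD_opTable e (· * ·)) (holdsTuple_input_left e G H) (holdsTuple_input_right e G H)
    refine ⟨s, t, hrun, ht.trans hT, ?_⟩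
    rcases hs with ⟨h1, w, hw⟩ | ⟨h0, hfail⟩
    · exact ⟨fun _ => h1, fun hiso => absurd (isometric_of_certifies h𝒢.1 hG hH hw) hiso⟩
    · refine ⟨fun hiso => ?_, fun _ => h0⟩
      obtain ⟨δ, hδ, hsucc⟩ := exists_digits_succeeds (e := e) hn h𝒢.1 hG hH hiso hγ hrigid
      obtain ⟨δ', hδ', hns⟩ := hfail δ fun i _ => hδ i
      exact absurd (hsucc δ' hδ') hns
  · obtain ⟨s, t, hrun, ht, hs⟩ := halts_isometryTest_of_ne (B := B) (R := R) (s := input e G H)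
      rfl rfl hne
    refine ⟨s, t, hrun, ht.trans hT, fun hiso => absurd ?_ hne, fun _ => hs⟩
    rw [← hG.finrank_eq, ← hH.finrank_eq, hiso.finrank_eq]

theorem four_mul_sq_le_two_pow (hn : 8 ≤ n) : 4 * n ^ 2 ≤ 2 ^ n := by
  induction n, hn using Nat.le_induction with
  | base => norm_num
  | succ k hk ih => rw [pow_succ 2]; nlinarith

/-- With `m ≤ D * n`, a single power `q ^ (E * n)` bounds all loop lengths, and so the running time
is at most `q ^ (C * n)`. -/
theorem exists_testsIsometryTo (D : ℕ) : ∃ C : ℕ, ∀ n m : ℕ, 45 ≤ n → m ≤ D * n →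
    ∀ (F : Type) [Field F] [Fintype F], ∀ 𝒢 ∈ LinER n m F,
      (∃ γ : Fin 20 → Matrix (Fin n) (Fin n) F, (∀ i, γ i ∈ 𝒢) ∧ Rigid γ) →
        TestsIsometryTo (isometryTest 20) (Fintype.card F ^ (C * n)) 𝒢 := by
  obtain ⟨K, k, hKk⟩ := (isometryTest 20).exists_timeBound_le
  refine ⟨K + (40 * D + 4) * k, fun n m hn hm F _ _ 𝒢 h𝒢 ⟨γ, hγ, hrigid⟩ => ?_⟩
  set q := Fintype.card F
  have hq : 1 < q := Fintype.one_lt_card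
  have hpow : ∀ {i j : ℕ}, i ≤ j → q ^ i ≤ q ^ j := fun h => Nat.pow_le_pow_right (by omega) h
  have hlt : ∀ i : ℕ, i ≤ q ^ i := fun i => (Nat.lt_pow_self hq).le
  have hltn : ∀ i : ℕ, i ≤ q ^ (i * n) := fun i =>
    (hlt i).trans (hpow (Nat.le_mul_of_pos_right _ (by omega)))
  have h3 : n * (n * n) ≤ q ^ ((40 * D + 4) * n) := calc
    n * (n * n) ≤ q ^ n * (q ^ n * q ^ n) :=
      Nat.mul_le_mul (hlt n) (Nat.mul_le_mul (hlt n) (hlt n))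
    _ = q ^ (3 * n) := by ring
    _ ≤ _ := hpow (Nat.mul_le_mul_right _ (by omega))
  refine testsIsometryTo_of_rigid (B := q ^ ((40 * D + 4) * n)) (m := m) (by omega) (by omega)
    ?_ ?_ ?_ ?_ ?_ ?_ h𝒢 hγ hrigid
  · exact (pow_one q).symm.le.trans (hpow (by nlinarith))
  · exact (Nat.mul_le_mul_right _ (by omega)).trans h3
  · calc (m + 20 + 1) * n ≤ ((D + 1) * n) * n := Nat.mul_le_mul_right _ (by linarith)
      _ ≤ (q ^ ((D + 1) * n) * q ^ n) * q ^ n :=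
        Nat.mul_le_mul (Nat.mul_le_mul (hltn _) (hlt n)) (hlt n)
      _ = q ^ ((D + 3) * n) := by ring
      _ ≤ _ := hpow (Nat.mul_le_mul_right _ (by omega))
  · refine le_trans ?_ h3
    nlinarith
  · refine hpow ?_
    nlinarith
  · calc _ ≤ K * (q ^ ((40 * D + 4) * n)) ^ k := hKk _ (Nat.one_le_pow _ _ (by omega))
      _ ≤ q ^ (K * n) * (q ^ ((40 * D + 4) * n)) ^ k := Nat.mul_le_mul_right _ (hltn K)
      _ = q ^ ((K + (40 * D + 4) * k) * n) := by ring

end Final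

end AltSpace

theorem theorem1 (c : ℝ) (hc : 0 < c) :
    ∃ (P : RAM.Prog) (C : ℕ) (δ : ℝ) (n₀ : ℕ), 0 < δ ∧
      ∀ n m : ℕ, n₀ ≤ n → (m : ℝ) = c * n →
      ∀ (F : Type) [Field F] [Fintype F],
        (({𝒢 ∈ AltSpace.LinER n m F |
            ¬ AltSpace.TestsIsometryTo P (Fintype.card F ^ (C * n)) 𝒢}.ncard : ℕ) : ℝ) ≤
          (1 / (Fintype.card F : ℝ) ^ (δ * n)) * ((AltSpace.LinER n m F).ncard : ℝ) := by
  set D := ⌈c⌉₊ with hD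
  obtain ⟨C, hC⟩ := AltSpace.exists_testsIsometryTo D
  -- `n₀` ensures `45 ≤ n`, `20 ≤ m` and that `Λ(n, q)` has dimension greater than `m`.
  refine ⟨AltSpace.isometryTest 20, C, 1 / 2, 45 + ⌈20 / c⌉₊ + (D + 2) ^ 2, by norm_num, ?_⟩
  intro n m hn hmn F _ _
  have hn45 : 45 ≤ n := by omega
  have hmD : m ≤ D * n := by
    have : (m : ℝ) ≤ D * n := hmn ▸ mul_le_mul_of_nonneg_right (Nat.le_ceil c) n.cast_nonneg
    exact_mod_cast this
  have hm20 : 20 ≤ m := by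
    have h1 : 20 / c ≤ (n : ℝ) := (Nat.le_ceil _).trans (by exact_mod_cast (by omega))
    have h2 : (20 : ℝ) ≤ m := by
      rw [hmn, mul_comm]
      exact (div_le_iff₀ hc).1 h1
    exact_mod_cast h2
  have hdim : m + 1 ≤ Module.finrank F (AltSpace.alternating n F) := by
    have h1 : (D + 2) ^ 2 ≤ n := by omega
    have h2 : D + 1 ≤ n := by nlinarith
    refine le_trans ?_ (AltSpace.mul_le_finrank_alternating h2)
    obtain ⟨d, hd⟩ := Nat.exists_eq_add_of_le h2
    rw [hd, Nat.add_sub_cancel_left]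
    rw [hd] at hmD h1
    nlinarith
  have hbad := AltSpace.ncard_nonrigid_spaces_mul_le hn45 hm20 hdim
  have hsub : {𝒢 ∈ AltSpace.LinER n m F |
      ¬ AltSpace.TestsIsometryTo (AltSpace.isometryTest 20) (Fintype.card F ^ (C * n)) 𝒢} ⊆
      {𝒢 ∈ AltSpace.LinER n m F |
        ∀ γ : Fin 20 → Matrix (Fin n) (Fin n) F, (∀ i, γ i ∈ 𝒢) → ¬ AltSpace.Rigid γ} := by
    rintro 𝒢 ⟨h1, h2⟩
    exact ⟨h1, fun γ hγ hrigid => h2 (hC n m hn45 hmD F 𝒢 h1 ⟨γ, hγ, hrigid⟩)⟩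
  have hle := (Nat.mul_le_mul_right (Fintype.card F ^ n)
    (Set.ncard_le_ncard hsub (Set.toFinite _))).trans hbad
  generalize Set.ncard {𝒢 ∈ AltSpace.LinER n m F |
    ¬ AltSpace.TestsIsometryTo (AltSpace.isometryTest 20) (Fintype.card F ^ (C * n)) 𝒢} = b at hle ⊢
  generalize (AltSpace.LinER n m F).ncard = L at hle ⊢
  have hq : 1 < Fintype.card F := Fintype.one_lt_card
  generalize Fintype.card F = q at hle hq ⊢
  have hq0 : (0 : ℝ) < q := by exact_mod_cast (by omega)
  -- `r = q ^ (n / 2)` is at least `2 * n`, so that half of the factor `q ^ n` absorbs `2 * n`.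
  set r : ℝ := (q : ℝ) ^ (1 / 2 * n : ℝ) with hr
  have hr0 : 0 < r := Real.rpow_pos_of_pos hq0 _
  have hrr : r * r = (q : ℝ) ^ n := by
    rw [hr, ← Real.rpow_add hq0, ← Real.rpow_natCast]
    congr 1
    ring
  have hnr : (2 * n : ℝ) ≤ r := by
    have h1 : 4 * n ^ 2 ≤ q ^ n :=
      (AltSpace.four_mul_sq_le_two_pow (by omega)).trans (Nat.pow_le_pow_left hq n)
    have h2 : (4 * n ^ 2 : ℝ) ≤ (q : ℝ) ^ n := by exact_mod_cast h1
    nlinarith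
  have hle' : (b : ℝ) * (q : ℝ) ^ n ≤ 2 * n * L := by exact_mod_cast hle
  rw [← hrr] at hle'
  rw [one_div, ← div_eq_inv_mul, le_div_iff₀ hr0]
  have h1 : (2 * n * L : ℝ) ≤ r * L := mul_le_mul_of_nonneg_right hnr L.cast_nonneg
  refine le_of_mul_le_mul_right (a := r) ?_ hr0
  linarith
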